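/- Let $(M,\mathcal V)$ be a Lie manifold of dimension $m$: $M$ is a compact manifold with corners, $\mathcal V$ is a finitely generated projective $C^\infty(M)$-module and Lie algebra of smooth vector fields tangent to all faces of $M$, and the anchor $A\to TM$ of the vector bundle $A$ with $\Gamma(A)=\mathcal V$ is an isomorphism over the interior $M_0$ of $M$. Let $\mathcal X=(X_1,\dots,X_k)$ be a weakly transversal family of submanifolds with corners: the $X_i$ are non-empty, connected, closed, distinct submanifolds with corners of positive codimension; every connected component of an intersection of members is again a member; and $\bigcap_j T_xX_{i_j}=T_x\big(\bigcap_jX_{i_j}\big)$ for all $x\in\bigcap_jX_{i_j}$. Order the family so that smaller members come first ($X_j\not\subseteq X_i$ for $i<j$). Put $M^{(0)}=M$ and $M^{(\ell)}=[M^{(\ell-1)}:Y^{(\ell)}]$ for $1\le\ell\le k$, where $Y^{(\ell)}\subset M^{(\ell-1)}$ is the lift of $X_\ell$; here the lift to a blow-up $[N:Y]$ of a set $Z\subset N$ is the closure of $Z\setminus Y$ in $[N:Y]$. Let $P=M^{(k)}=[M:\mathcal X]$ with composed blow-down map $\beta:P\to M$. For each $\ell$ let $r_\ell:M^{(\ell-1)}\to[0,\infty)$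 be a smoothed distance function to $Y^{(\ell)}$: it is continuous, smooth outside $Y^{(\ell)}$, vanishes exactly on $Y^{(\ell)}$, and near $Y^{(\ell)}$ it is the distance to $Y^{(\ell)}$ in a Riemannian metric on $M^{(\ell-1)}$ that is smooth up to the boundary and compatible with $Y^{(\ell)}$ (the geodesics normal to $Y^{(\ell)}$ exist for a uniform time and have constant boundary depth). Let $\rho=r_1r_2\cdots r_k$, each factor being lifted to $P$. Let $\mathcal W$ be the $C^\infty(P)$-module generated by the smooth vector fields $W$ on $P$ for which there is $V\in\mathcal V$ with $\beta_*W=\rho V$ over $M\setminus\bigcup\mathcal X$. Let $g$ be a metric on $A$ (a smooth, symmetric, positive definite section of $A^*\otimes A^*$). Then $(P,\mathcal W)$ is a Lie manifold. Let $B\to P$ be its Lie algebroid, $\Gamma(B)=\mathcal W$. The restriction of $\rho^{-2}g$ to $M_0\setminus\bigcup\mathcal X$, which is identified by $\beta$ with the interior of $P$, extends to a smooth metric $h$ on $B$. Let $\Delta_g$ and $\Delta_h$ be the Laplace operators on functions of the Riemannian metrics that $g$ and $h$ induce on this set, and let $\mathrm{Diff}^j_{\mathcal W}(P)$ denote the operators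 of order at most $j$ in the algebra of operators on $C^\infty(P)$ generated by $C^\infty(P)$ and $\mathcal W$. Then $$\rho^2\Delta_g-\Delta_h\in\mathrm{Diff}^1_{\mathcal W}(P).$$ In particular $\rho^2\Delta_g$ belongs to $\mathrm{Diff}^2_{\mathcal W}(P)$ and is elliptic there: its principal symbol, a function on $B^*$, does not vanish outside the zero section. -/

import Mathlib

open scoped Manifold ContDiff Bundle

noncomputable section

/-! ### Manifolds with corners: smooth functions, vector fields, tangency to the boundary

An `m`-dimensional manifold with corners is a Hausdorff space with a smooth atlas modelled on the
quadrant `[0,∞)^m`. -/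

/-- `ℝ^n` with its Euclidean norm. -/
abbrev Euc (n : ℕ) : Type := EuclideanSpace ℝ (Fin n)

/-- The model with corners `[0,∞)^m ⊆ ℝ^m`. -/
abbrev IQ (m : ℕ) : ModelWithCorners ℝ (Euc m) (EuclideanQuadrant m) :=
  modelWithCornersEuclideanQuadrant m

/-- The ring `C^∞(M)` of real smooth functions on a manifold with corners. -/
abbrev SmoothFun (m : ℕ) (M : Type*) [TopologicalSpace M] [ChartedSpace (EuclideanQuadrant m) M] :
    Type _ :=
  C^∞⟮IQ m, M; 𝓘(ℝ, ℝ), ℝ⟯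

/-- The space `Γ(TM)` of smooth vector fields on a manifold with corners. -/
abbrev SmoothVF (m : ℕ) (M : Type*) [TopologicalSpace M] [ChartedSpace (EuclideanQuadrant m) M]
    [IsManifold (IQ m) ∞ M] : Type _ :=
  Cₛ^∞⟮IQ m; Euc m, fun x : M => TangentSpace (IQ m) x⟯

section Basic

variable {m : ℕ} {M : Type*} [TopologicalSpace M] [ChartedSpace (EuclideanQuadrant m) M]

/-- The derivative `V u` of a function along a (not necessarily smooth) vector field. -/
def dirDeriv (V : ∀ x : M, TangentSpace (IQ m) x) (u : M → ℝ) (x : M) : ℝ :=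
  mfderiv (IQ m) 𝓘(ℝ, ℝ) u x (V x)

variable [IsManifold (IQ m) ∞ M]

instance SmoothVF.instSMulFun : SMul (SmoothFun m M) (SmoothVF m M) :=
  ⟨fun f V => ⟨fun x => f x • V x, f.contMDiff.smul_section V.contMDiff⟩⟩

@[simp] theorem SmoothVF.fun_smul_apply (f : SmoothFun m M) (V : SmoothVF m M) (x : M) :
    (f • V) x = f x • V x := rfl

/-- `Γ(TM)` as a module over `C^∞(M)`, with pointwise multiplication. -/
instance SmoothVF.instModuleFun : Module (SmoothFun m M) (SmoothVF m M) where
  one_smul V := by ext x; exact one_smul ℝ (V x)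
  mul_smul f g V := by ext x; exact mul_smul (f x) (g x) (V x)
  smul_zero f := by ext x; exact smul_zero (f x)
  smul_add f V W := by ext x; exact smul_add (f x) (V x) (W x)
  add_smul f g V := by ext x; exact add_smul (f x) (g x) (V x)
  zero_smul V := by ext x; exact zero_smul ℝ (V x)

instance SmoothVF.instTowerFun : IsScalarTower ℝ (SmoothFun m M) (SmoothVF m M) where
  smul_assoc c f V := by ext x; exact smul_assoc c (f x) (V x)

/-- `V ∈ 𝒱_M`: the vector field `V` is tangent to all boundary hyperfaces of `M`. In the preferred
chart at `x`, the hyperfaces through `x` are the coordinate hyperplanes on which `x` lies. -/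
def IsTangentToFaces (V : SmoothVF m M) : Prop :=
  ∀ (x : M) (i : Fin m), (chartAt (EuclideanQuadrant m) x x).1 i = 0 → (show Euc m from V x) i = 0

/-! ### The vector bundle of a module of vector fields, Lie manifolds, metrics -/

/-- The maximal ideal `𝔪_x` of functions vanishing at `x`. -/
def vanishingIdeal (m : ℕ) {M : Type*} [TopologicalSpace M]
    [ChartedSpace (EuclideanQuadrant m) M] (x : M) : Ideal (SmoothFun m M) :=
  RingHom.ker (ContMDiffMap.evalRingHom x : SmoothFun m M →+* ℝ)

/-- The fibre at `x` of the vector bundle `A` with `Γ(A) = 𝒱` (Serre–Swan): `A_x = 𝒱 / 𝔪_x 𝒱`. -/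
abbrev AFiber (𝒱 : Submodule (SmoothFun m M) (SmoothVF m M)) (x : M) : Type _ :=
  𝒱 ⧸ (vanishingIdeal m x • (⊤ : Submodule (SmoothFun m M) 𝒱)).restrictScalars ℝ

/-- The value in `A_x` of `V ∈ 𝒱 = Γ(A)`. -/
def AFiber.mk (𝒱 : Submodule (SmoothFun m M) (SmoothVF m M)) (x : M) : 𝒱 →ₗ[ℝ] AFiber 𝒱 x :=
  Submodule.mkQ _

/-- Evaluation `𝒱 → T_xM`. -/
def evalVF (𝒱 : Submodule (SmoothFun m M) (SmoothVF m M)) (x : M) :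
    𝒱 →ₗ[ℝ] TangentSpace (IQ m) x where
  toFun V := (V : SmoothVF m M) x
  map_add' _ _ := rfl
  map_smul' _ _ := rfl

theorem vanishing_le_ker (𝒱 : Submodule (SmoothFun m M) (SmoothVF m M)) (x : M) :
    (vanishingIdeal m x • (⊤ : Submodule (SmoothFun m M) 𝒱)).restrictScalars ℝ
      ≤ LinearMap.ker (evalVF 𝒱 x) := by
  intro V hV
  rw [Submodule.restrictScalars_mem] at hV
  rw [LinearMap.mem_ker]
  induction hV using Submodule.smul_induction_on' with
  | smul f hf W _ =>
    have hf' : f x = 0 := hf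
    change f x • (W : SmoothVF m M) x = 0
    rw [hf', zero_smul]
  | add V _ W _ hV hW => rw [map_add, hV, hW, add_zero]

/-- The anchor map `A_x → T_xM`. -/
def anchor (𝒱 : Submodule (SmoothFun m M) (SmoothVF m M)) (x : M) :
    AFiber 𝒱 x →ₗ[ℝ] TangentSpace (IQ m) x :=
  Submodule.liftQ _ (evalVF 𝒱 x) (vanishing_le_ker 𝒱 x)

/-- `(M, 𝒱)` is a Lie manifold: `M` is compact, `𝒱` is a Lie algebra of vector fields tangent to
all faces, it is a finitely generated projective `C^∞(M)`-module, and the anchor of the associated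
vector bundle `A` is an isomorphism over the interior of `M`. -/
structure IsLieManifold (𝒱 : Submodule (SmoothFun m M) (SmoothVF m M)) : Prop where
  compact : CompactSpace M
  tangent : ∀ V ∈ 𝒱, IsTangentToFaces V
  bracket : ∀ V ∈ 𝒱, ∀ W ∈ 𝒱, ∃ U ∈ 𝒱, ∀ x : M, U x = VectorField.mlieBracket (IQ m) V W x
  finite : Module.Finite (SmoothFun m M) 𝒱
  projective : Module.Projective (SmoothFun m M) 𝒱
  anchor_iso : ∀ x ∈ (IQ m).interior M, Function.Bijective (anchor 𝒱 x)

/-- A `𝒱`-metric: a smooth, symmetric, positive definite section of `A* ⊗ A*`. -/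
structure VMetric (𝒱 : Submodule (SmoothFun m M) (SmoothVF m M)) where
  inner : ∀ x : M, AFiber 𝒱 x →ₗ[ℝ] AFiber 𝒱 x →ₗ[ℝ] ℝ
  symm : ∀ x a b, inner x a b = inner x b a
  pos : ∀ x a, a ≠ 0 → 0 < inner x a a
  smooth : ∀ V W : 𝒱,
    ContMDiff (IQ m) 𝓘(ℝ, ℝ) ∞ (fun x => inner x (AFiber.mk 𝒱 x V) (AFiber.mk 𝒱 x W))

/-- The Riemannian metric on the interior of `M` induced by a `𝒱`-metric through the isomorphism
`A_x ≅ T_xM` (a meaningless value at points where the anchor is not an isomorphism). -/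
def VMetric.riem {𝒱 : Submodule (SmoothFun m M) (SmoothVF m M)} (g : VMetric 𝒱) (x : M)
    (v w : TangentSpace (IQ m) x) : ℝ :=
  g.inner x (Function.invFun (anchor 𝒱 x) v) (Function.invFun (anchor 𝒱 x) w)

/-! ### The Laplace–Beltrami operator -/

/-- Koszul's formula: `G(∇_X Y, Z)` for the Levi-Civita connection `∇` of the metric `G`. -/
def koszul (G : ∀ x : M, TangentSpace (IQ m) x → TangentSpace (IQ m) x → ℝ)
    (X Y Z : ∀ x : M, TangentSpace (IQ m) x) (x : M) : ℝ :=
  (1 / 2) * (dirDeriv X (fun z => G z (Y z) (Z z)) x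
    + dirDeriv Y (fun z => G z (X z) (Z z)) x
    - dirDeriv Z (fun z => G z (X z) (Y z)) x
    + G x (VectorField.mlieBracket (IQ m) X Y x) (Z x)
    - G x (VectorField.mlieBracket (IQ m) X Z x) (Y x)
    - G x (VectorField.mlieBracket (IQ m) Y Z x) (X x))

/-- The trace of the Hessian of `u` at a point `x` at which the frame `e` is orthonormal:
`∑_i (e_i (e_i u) - (∇_{e_i} e_i) u)(x)`. -/
def frameLaplacian (G : ∀ x : M, TangentSpace (IQ m) x → TangentSpace (IQ m) x → ℝ)
    (e : Fin m → SmoothVF m M) (u : M → ℝ) (x : M) : ℝ :=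
  ∑ i, (dirDeriv (e i) (dirDeriv (e i) u) x
    - ∑ j, koszul G (e i) (e i) (e j) x * dirDeriv (e j) u x)

open Classical in
/-- The Laplace–Beltrami operator `Δ_G u = tr_G (∇ du) = div grad u` at an interior point. The Hessian
is tensorial, so any smooth vector fields that are orthonormal at the point `x` compute it. -/
def laplacian (G : ∀ x : M, TangentSpace (IQ m) x → TangentSpace (IQ m) x → ℝ)
    (u : M → ℝ) (x : M) : ℝ :=
  if h : ∃ e : Fin m → SmoothVF m M, ∀ i j, G x (e i x) (e j x) = if i = j then 1 else 0 then
    frameLaplacian G h.choose u x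
  else 0

/-! ### Differential operators generated by `𝒱` and ellipticity -/

/-- The operator `T` on `C^∞(M)` is the derivative along the vector field `V`. -/
def IsDerivAlong (V : SmoothVF m M) (T : Module.End ℝ (SmoothFun m M)) : Prop :=
  ∀ (f : SmoothFun m M) (x : M), T f x = dirDeriv V f x

/-- `Diff^k_𝒱(M)`: the operators of order at most `k` in the algebra generated by `C^∞(M)` and `𝒱`,
spanned by the `V_1 ⋯ V_j f` with `j ≤ k`, `V_i ∈ 𝒱` and `f ∈ C^∞(M)`. -/
def DiffOp (𝒱 : Submodule (SmoothFun m M) (SmoothVF m M)) :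
    ℕ → Submodule ℝ (Module.End ℝ (SmoothFun m M))
  | 0 => LinearMap.range (LinearMap.mul ℝ (SmoothFun m M))
  | k + 1 => DiffOp 𝒱 k ⊔
      Submodule.span ℝ {Q | ∃ V ∈ 𝒱, ∃ T, IsDerivAlong V T ∧ ∃ D ∈ DiffOp 𝒱 k, Q = T * D}

/-- `σ` is the principal symbol of order `k + 1` of the operator `D`: modulo `Diff^k_𝒱`, the operator
is `∑_a V_{a,0} ⋯ V_{a,k}` with `V_{a,i} ∈ 𝒱`, and `σ(ξ) = ∑_a ξ(V_{a,0}) ⋯ ξ(V_{a,k})` for covectors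
`ξ ∈ A_x^*`. -/
def HasSymbol (𝒱 : Submodule (SmoothFun m M) (SmoothVF m M)) (k : ℕ)
    (D : Module.End ℝ (SmoothFun m M)) (σ : ∀ x : M, (AFiber 𝒱 x →ₗ[ℝ] ℝ) → ℝ) : Prop :=
  ∃ (s : ℕ) (V : Fin s → Fin (k + 1) → 𝒱) (T : Fin s → Fin (k + 1) → Module.End ℝ (SmoothFun m M)),
    (∀ a i, IsDerivAlong (V a i : SmoothVF m M) (T a i)) ∧
    D - ∑ a, (List.ofFn (T a)).prod ∈ DiffOp 𝒱 k ∧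
    ∀ x ξ, σ x ξ = ∑ a, ∏ i, ξ (AFiber.mk 𝒱 x (V a i))

/-- `D` is elliptic in `Diff^(k+1)_𝒱(M)`: it belongs to it and its principal symbol is invertible on
`A^*` outside the zero section. -/
def IsEllipticOp (𝒱 : Submodule (SmoothFun m M) (SmoothVF m M)) (k : ℕ)
    (D : Module.End ℝ (SmoothFun m M)) : Prop :=
  D ∈ DiffOp 𝒱 (k + 1) ∧ ∃ σ, HasSymbol 𝒱 k D σ ∧ ∀ x ξ, ξ ≠ 0 → σ x ξ ≠ 0

end Basic

/-! ### Submanifolds with corners -/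

section Submanifold

variable {m : ℕ} {M : Type*} [TopologicalSpace M] [ChartedSpace (EuclideanQuadrant m) M]

/-- The model with corners of `[0,∞)^n × ℝ^c`. -/
abbrev IQE (n c : ℕ) : ModelWithCorners ℝ (Euc n × Euc c) (EuclideanQuadrant n × Euc c) :=
  (IQ n).prod 𝓘(ℝ, Euc c)

/-- A diffeomorphism from an open subset of `M` onto an open subset of `[0,∞)^n × ℝ^c`. -/
abbrev CornerChart (m : ℕ) (M : Type*) [TopologicalSpace M]
    [ChartedSpace (EuclideanQuadrant m) M] (n c : ℕ) : Type _ :=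
  PartialDiffeomorph (IQ m) (IQE n c) M (EuclideanQuadrant n × Euc c) ∞

/-- The chart maps `X` to `[0,∞)^n × {0}`. -/
def IsAdaptedChart (X : Set M) {n c : ℕ} (φ : CornerChart m M n c) : Prop :=
  ∀ x ∈ φ.source, x ∈ X ↔ (φ x).2 = 0

/-- `X` is a submanifold with corners (a closed subset, of positive codimension) of `M`. -/
def IsSubmanifoldWithCorners (m : ℕ) {M : Type*} [TopologicalSpace M]
    [ChartedSpace (EuclideanQuadrant m) M] (X : Set M) : Prop :=
  IsClosed X ∧ ∀ x ∈ X, ∃ (n c : ℕ) (φ : CornerChart m M n (c + 1)),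
    x ∈ φ.source ∧ IsAdaptedChart X φ

/-- The tangent space `T_xX` of a submanifold with corners `X` of `M` at a point `x` of `X`: the
vectors that annihilate the smooth functions vanishing on `X`. -/
def tangentTo (m : ℕ) {M : Type*} [TopologicalSpace M] [ChartedSpace (EuclideanQuadrant m) M]
    (X : Set M) (x : M) : Set (TangentSpace (IQ m) x) :=
  {v | ∀ f : SmoothFun m M, (∀ z ∈ X, f z = 0) →
    (mfderiv (IQ m) 𝓘(ℝ, ℝ) f x v : ℝ) = 0}

/-- `X_0, …, X_{k-1}` is a weakly transversal family of submanifolds with corners. -/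
structure IsWeaklyTransversal (m : ℕ) {M : Type*} [TopologicalSpace M]
    [ChartedSpace (EuclideanQuadrant m) M] (k : ℕ) (X : ℕ → Set M) : Prop where
  submanifold : ∀ i < k, IsSubmanifoldWithCorners m (X i)
  connected : ∀ i < k, IsConnected (X i)
  /-- Components of intersections of members belong to the family. -/
  inter : ∀ S : Finset ℕ, S.Nonempty → (∀ i ∈ S, i < k) → ∀ x ∈ ⋂ i ∈ S, X i,
    ∃ l < k, connectedComponentIn (⋂ i ∈ S, X i) x = X l
  tangent : ∀ S : Finset ℕ, S.Nonempty → (∀ i ∈ S, i < k) → ∀ x ∈ ⋂ i ∈ S, X i,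
    ⋂ i ∈ S, tangentTo m (X i) x = tangentTo m (⋂ i ∈ S, X i) x

/-- The members are listed without repetition and smaller members come first, so that the minimal
members are blown up first, then the minimal ones among the lifts of the others, and so on. -/
def IsAdmissiblyOrdered {M : Type*} (k : ℕ) (X : ℕ → Set M) : Prop :=
  ∀ i j, i < j → j < k → ¬ X j ⊆ X i

/-! ### Blow-ups -/

/-- The unit sphere `S^c` in `ℝ^(c+1)`. -/
abbrev USphere (c : ℕ) : Type := Metric.sphere (0 : Euc (c + 1)) 1

/-- The model blow-up `[0,∞)^n × S^c × [0,∞)` of `[0,∞)^n × ℝ^(c+1)` along `[0,∞)^n × {0}`. -/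
abbrev BlowModel (n c : ℕ) : Type := EuclideanQuadrant n × USphere c × EuclideanQuadrant 1

/-- The model with corners of the model blow-up. -/
abbrev IBlow (n c : ℕ) : ModelWithCorners ℝ (Euc n × Euc c × Euc 1)
    (ModelProd (EuclideanQuadrant n) (ModelProd (Euc c) (EuclideanQuadrant 1))) :=
  (IQ n).prod ((𝓡 c).prod (IQ 1))

/-- The model blow-down map `(u, z, r) ↦ (u, r z)`. -/
def blowModelDown {n c : ℕ} (b : BlowModel n c) : EuclideanQuadrant n × Euc (c + 1) :=
  (b.1, b.2.2.1 0 • (b.2.1 : Euc (c + 1)))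

/-- `P = [M : X]` with blow-down map `β`: the map `β` is a diffeomorphism from the complement of
`β⁻¹(X)` onto `M \ X`, and near `X` there are charts `φ : U → V` of `M` adapted to `X` for which
`β⁻¹(U)` is the model blow-up `[V : V ∩ ([0,∞)^n × {0})]` and `β` is the model blow-down map. These
conditions determine `(P, β)` up to a unique diffeomorphism over `M`. -/
structure IsBlowup (m : ℕ) {M P : Type*} [TopologicalSpace M] [ChartedSpace (EuclideanQuadrant m) M]
    [TopologicalSpace P] [ChartedSpace (EuclideanQuadrant m) P] (X : Set M) (β : P → M) : Prop where
  isClosed : IsClosed X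
  away : ∃ Φ : PartialDiffeomorph (IQ m) (IQ m) P M ∞,
    Φ.source = β ⁻¹' Xᶜ ∧ Φ.target = Xᶜ ∧ ∀ p ∈ Φ.source, Φ p = β p
  near : ∀ x ∈ X, ∃ (n c : ℕ) (φ : CornerChart m M n (c + 1)),
    x ∈ φ.source ∧ IsAdaptedChart X φ ∧
    ∃ Ψ : PartialDiffeomorph (IQ m) (IBlow n c) P (BlowModel n c) ∞,
      Ψ.source = β ⁻¹' φ.source ∧ Ψ.target = blowModelDown ⁻¹' φ.target ∧
      ∀ p ∈ Ψ.source, φ (β p) = blowModelDown (Ψ p)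

end Submanifold

/-! ### Smoothed distance functions -/

section Distance

variable {m : ℕ} {M : Type*} [TopologicalSpace M] [ChartedSpace (EuclideanQuadrant m) M]
  [IsManifold (IQ m) ∞ M]

/-- A true Riemannian metric on `M`: a metric on `TM` smooth up to the boundary. -/
abbrev TrueMetric (m : ℕ) (M : Type*) [TopologicalSpace M] [ChartedSpace (EuclideanQuadrant m) M]
    [IsManifold (IQ m) ∞ M] : Type _ :=
  Bundle.ContMDiffRiemannianMetric (IQ m) ∞ (Euc m) (fun x : M => TangentSpace (IQ m) x)

/-- The distance from `x` to `X`: the infimum of the lengths of `C^1` paths in `M` from `x` to `X`. -/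
def TrueMetric.distTo (γ : TrueMetric m M) (X : Set M) (x : M) : ENNReal :=
  letI : Bundle.RiemannianBundle (fun x : M => TangentSpace (IQ m) x) := ⟨γ.toRiemannianMetric⟩
  ⨅ y ∈ X, Manifold.riemannianEDist (IQ m) x y

/-- The coordinate expression of a true metric in a chart, at the point `q` of `ℝ^n × ℝ^c`. -/
def TrueMetric.coord (γ : TrueMetric m M) {n c : ℕ} (φ : CornerChart m M n c)
    (q v w : Euc n × Euc c) : ℝ :=
  γ.inner (φ.symm ((IQE n c).symm q))
    (mfderiv (IQE n c) (IQ m) φ.symm ((IQE n c).symm q) v)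
    (mfderiv (IQE n c) (IQ m) φ.symm ((IQE n c).symm q) w)

/-- The geodesic equation at time `t` for a curve `a` in a chart, in Euler–Lagrange form:
`d/dt G_{a(t)}(a'(t), w) = (1/2) (∂_w G)_{a(t)}(a'(t), a'(t))` for all constant vectors `w`. -/
def TrueMetric.IsGeodesicAt (γ : TrueMetric m M) {n c : ℕ} (φ : CornerChart m M n c)
    (a : ℝ → Euc n × Euc c) (t : ℝ) : Prop :=
  ∀ w : Euc n × Euc c,
    HasDerivAt (fun s => γ.coord φ (a s) (deriv a s) w)
      ((1 / 2) * fderivWithin ℝ (fun q => γ.coord φ q (deriv a t) (deriv a t))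
        (Set.range (IQE n c)) (a t) w) t

/-- The adapted chart `φ = (u, y)` is given by the normal exponential map of `X` and an orthonormal
frame of the normal bundle: along `y = 0` the `∂_{y_j}` are orthonormal and orthogonal to `X`,
and the rays `t ↦ (u, t v)` are geodesics. -/
def TrueMetric.IsNormalChart (γ : TrueMetric m M) {n c : ℕ} (φ : CornerChart m M n c) : Prop :=
  (∀ u : EuclideanQuadrant n, (u, (0 : Euc c)) ∈ φ.target → ∀ (b : Euc n) (v v' : Euc c),
    γ.coord φ (u.1, 0) (0, v) (b, v') = inner ℝ v v') ∧
  (∀ (u : EuclideanQuadrant n) (v : Euc c) (t : ℝ), (u, t • v) ∈ φ.target →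
    γ.IsGeodesicAt φ (fun s => (u.1, s • v)) t)

/-- The true metric is compatible with `X`: the geodesics normal to `X` exist for a uniform time and
have constant boundary depth, that is, the normal exponential map of `X` gives charts of the manifold
with corners `M` around all points of `X`. -/
def TrueMetric.IsCompatible (γ : TrueMetric m M) (X : Set M) : Prop :=
  ∀ x ∈ X, ∃ (n c : ℕ) (φ : CornerChart m M n c),
    x ∈ φ.source ∧ IsAdaptedChart X φ ∧ γ.IsNormalChart φ

/-- `r` is a smoothed distance function to `X`: continuous, smooth outside `X`, zero exactly on `X`,
and close to `X` equal to the distance to `X` in a compatible true metric. -/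
structure IsSmoothedDistance (m : ℕ) {M : Type*} [TopologicalSpace M]
    [ChartedSpace (EuclideanQuadrant m) M] [IsManifold (IQ m) ∞ M] (X : Set M) (r : M → ℝ) :
    Prop where
  continuous : Continuous r
  smooth : ContMDiffOn (IQ m) 𝓘(ℝ, ℝ) ∞ r Xᶜ
  nonneg : ∀ x, 0 ≤ r x
  zero_iff : ∀ x, r x = 0 ↔ x ∈ X
  dist : ∃ γ : TrueMetric m M, γ.IsCompatible X ∧ ∃ U : Set M, IsOpen U ∧ X ⊆ U ∧
    ∀ x ∈ U, ENNReal.ofReal (r x) = γ.distTo X x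

end Distance

/-! ### Iterated blow-ups

`N 0 ← N 1 ← N 2 ← ⋯` is a sequence of manifolds with maps `β j : N (j+1) → N j`. -/

section Iterated

/-- The lifts of the members of the family: `lift β X j i` is the lift of `X i` to `N j`. One step
takes the closure of what remains outside the centre, which is the lift of the `j`-th member. -/
def liftFamily {N : ℕ → Type*} [∀ l, TopologicalSpace (N l)] (β : ∀ l, N (l + 1) → N l)
    (X : ℕ → Set (N 0)) : ∀ l, ℕ → Set (N l)
  | 0, i => X i
  | l + 1, i => closure (β l ⁻¹' (liftFamily β X l i \ liftFamily β X l l))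

/-- The composed blow-down map `N l → N 0`. -/
def blowdown {N : ℕ → Type*} (β : ∀ l, N (l + 1) → N l) : ∀ l, N l → N 0
  | 0, p => p
  | l + 1, p => blowdown β l (β l p)

/-- The product `r_0 r_1 ⋯ r_{l-1}`, pulled back to `N l`. -/
def rhoFun {N : ℕ → Type*} (β : ∀ l, N (l + 1) → N l) (r : ∀ l, N l → ℝ) : ∀ l, N l → ℝ
  | 0, _ => 1
  | l + 1, p => rhoFun β r l (β l p) * r l (β l p)

variable {m : ℕ} {M P : Type*} [TopologicalSpace M] [ChartedSpace (EuclideanQuadrant m) M]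
  [IsManifold (IQ m) ∞ M] [TopologicalSpace P] [ChartedSpace (EuclideanQuadrant m) P]
  [IsManifold (IQ m) ∞ P]

/-- The `C^∞(P)`-module `𝒲` generated by the lifts of the vector fields `ρ V`, `V ∈ 𝒱`, that is, by
the smooth vector fields on `P` that are related to `ρ V` outside the singular set `S`. -/
def blownUpModule (𝒱 : Submodule (SmoothFun m M) (SmoothVF m M)) (β : P → M) (S : Set M)
    (ρ : P → ℝ) : Submodule (SmoothFun m P) (SmoothVF m P) :=
  Submodule.span (SmoothFun m P) {W | ∃ V ∈ 𝒱, ∀ p, β p ∉ S →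
    mfderiv (IQ m) (IQ m) β p (W p) = ρ p • V (β p)}

end Iterated

end

noncomputable section

/-! ### Parametric integrals and Hadamard's lemma on domains with corners -/

section Hadamard

set_option linter.unusedSectionVars false

open Set intervalIntegral

variable {E F : Type} [NormedAddCommGroup E] [NormedSpace ℝ E] [NormedAddCommGroup F]
  [NormedSpace ℝ F]

/-! The argument separates the geometry of blow-ups from the algebra of Lie manifolds. The interface
between the two is `IsConformalLift`. It says that `β : P → M` is smooth, that it is a local
diffeomorphism outside the preimage of the singular set `S`, and that this preimage misses the
interior of `P`. It says further that `ρ` is smooth on `P` and nonzero outside that preimage, and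
that every `ρ V` with `V ∈ 𝒱` lifts to a smooth field `W` tangent to the faces with `W ρ = a ρ`, `a`
smooth.

Geometry. For a single blow-up, the Gauss lemma (`gauss_lemma`) identifies the distance to the
centre with the length `|y|` of the normal coordinate
(`TrueMetric.IsNormalChart.eventually_distTo_eq`). Hadamard's lemma compares the normal coordinates
of different adapted charts. In polar coordinates `y = s z` this gives `r = s e` with `e > 0`
smooth, and `V r` lifts to a smooth function, because the derivative of `|y|` is homogeneous of
degree `0` (`IsBlowup.distance_near_front`). The field `r V` lifts because the map `(u, y, s) ↦ (u,
s y)` sends `(s a, v, 0)` to `s (a, v)` (`IsBlowup.exists_lift`). These steps are iterated in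
`isConformalLift_blowdown`: if `W` lifts `ρ V` with `W ρ = a ρ` and `W'` lifts `r W`, then `W' (ρ r)
= (W r + r a) ρ r`.

Algebra. Sending the lift of `ρ V` to `V` identifies `B` with `β^* A` (`IsConformalLift.fibreMap`).
So a finite dual basis of `𝒱` lifts to one of `𝒲`, and the pull-back `h` of `g` is a smooth metric
on `B`. Since the anchor of `B` is `ρ` times that of `A`, `h` restricts to `ρ⁻² g`. The condition `W
ρ = a ρ` is what makes `𝒲` closed under brackets (`IsConformalLift.bracket_upVF`).

Laplacians. For generators `V_i` and coefficients `K_ij` of the dual metric, `Δ_g = ∑ K_ij V_i V_j +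
X` with `X ∈ 𝒱` (`VMetric.exists_laplacian_eq`). The lifts `W_i` satisfy `W_i W_j = ρ² V_i V_j + a_i
W_j`, and the pulled back `K_ij` are coefficients of the dual metric of `h`. Hence `ρ² Δ_g` and
`Δ_h` have the same second order part `∑ K_ij W_i W_j` and differ by a section of `B`. The `K_ij`
are chosen positive definite, and the generators span every fibre, so the symbol is positive on
nonzero covectors. -/

theorem hasFDerivWithinAt_partial {S : Set E} {f : ℝ × E → F}
    (hf : ContDiffOn ℝ ∞ f (Icc (0 : ℝ) 1 ×ˢ S)) {t : ℝ} (ht : t ∈ Icc (0 : ℝ) 1) {x : E}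
    (hx : x ∈ S) :
    HasFDerivWithinAt (fun x => f (t, x))
      ((fderivWithin ℝ f (Icc (0 : ℝ) 1 ×ˢ S) (t, x)).comp (ContinuousLinearMap.inr ℝ ℝ E)) S x := by
  have h1 := ((hf.differentiableOn (by simp)) (t, x) ⟨ht, hx⟩).hasFDerivWithinAt
  have h2 : HasFDerivWithinAt (fun x : E => (t, x)) (ContinuousLinearMap.inr ℝ ℝ E) S x :=
    (hasFDerivAt_prodMk_right t x).hasFDerivWithinAt
  exact h1.comp x h2 fun y hy => ⟨ht, hy⟩

theorem contDiffOn_partial {S : Set E} (hS : UniqueDiffOn ℝ S) {f : ℝ × E → F}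
    (hf : ContDiffOn ℝ ∞ f (Icc (0 : ℝ) 1 ×ˢ S)) :
    ContDiffOn ℝ ∞ (fun q => (fderivWithin ℝ f (Icc (0 : ℝ) 1 ×ˢ S) q).comp
      (ContinuousLinearMap.inr ℝ ℝ E)) (Icc (0 : ℝ) 1 ×ˢ S) :=
  (hf.fderivWithin ((uniqueDiffOn_Icc zero_lt_one).prod hS) (by simp)).clm_comp contDiffOn_const

theorem intervalIntegrable_slice {S : Set E} {f : ℝ × E → F}
    (hf : ContinuousOn f (Icc (0 : ℝ) 1 ×ˢ S)) {x : E} (hx : x ∈ S) :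
    IntervalIntegrable (fun t => f (t, x)) MeasureTheory.volume 0 1 := by
  apply ContinuousOn.intervalIntegrable
  rw [uIcc_of_le zero_le_one]
  exact hf.comp (by fun_prop) fun t ht => ⟨ht, hx⟩

/-- Uniformity in `t` comes from the compactness of `[0, 1]` alone: the estimate holds near each `t`
and is glued over a finite cover. Nothing is assumed about `S`, so domains with corners are allowed.
-/
theorem eventually_forall_Icc_dist_lt {G : Type*} [PseudoMetricSpace G] {S : Set E}
    {f : ℝ × E → G} (hf : ContinuousOn f (Icc (0 : ℝ) 1 ×ˢ S)) {x : E} (hx : x ∈ S) {ε : ℝ}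
    (hε : 0 < ε) :
    ∃ δ > 0, ∀ y ∈ S ∩ Metric.ball x δ, ∀ t ∈ Icc (0 : ℝ) 1, dist (f (t, y)) (f (t, x)) < ε := by
  have key : ∀ t ∈ Icc (0 : ℝ) 1, ∀ᶠ q : E × ℝ in nhdsWithin x S ×ˢ nhdsWithin t (Icc 0 1),
      dist (f (q.2, q.1)) (f (q.2, x)) < ε := by
    intro t ht
    have h1 : Filter.Tendsto (fun q : E × ℝ => f (q.2, q.1))
        (nhdsWithin x S ×ˢ nhdsWithin t (Icc 0 1)) (nhds (f (t, x))) := by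
      refine Filter.Tendsto.comp (y := nhdsWithin (t, x) (Icc (0 : ℝ) 1 ×ˢ S)) (hf (t, x) ⟨ht, hx⟩) ?_
      rw [nhdsWithin_prod_eq]
      exact Filter.tendsto_snd.prodMk Filter.tendsto_fst
    have h2 : Filter.Tendsto (fun q : E × ℝ => f (q.2, x))
        (nhdsWithin x S ×ˢ nhdsWithin t (Icc 0 1)) (nhds (f (t, x))) := by
      refine Filter.Tendsto.comp (y := nhdsWithin (t, x) (Icc (0 : ℝ) 1 ×ˢ S)) (hf (t, x) ⟨ht, hx⟩) ?_
      rw [nhdsWithin_prod_eq]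
      refine Filter.tendsto_snd.prodMk ?_
      exact tendsto_nhdsWithin_of_tendsto_nhds_of_eventually_within _ tendsto_const_nhds
        (Filter.Eventually.of_forall fun _ => hx)
    have := (h1.dist h2)
    rw [dist_self] at this
    exact this.eventually_lt_const hε
  have h := (isCompact_Icc (a := (0 : ℝ)) (b := 1)).induction_on
    (p := fun s => ∀ᶠ y in nhdsWithin x S, ∀ t ∈ s ∩ Icc (0 : ℝ) 1, dist (f (t, y)) (f (t, x)) < ε)
    (by simp) (fun s t hst h => h.mono fun y hy u hu => hy u ⟨hst hu.1, hu.2⟩)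
    (fun s t hs ht => by
      filter_upwards [hs, ht] with y h1 h2 u hu
      exact hu.1.elim (fun h => h1 u ⟨h, hu.2⟩) (fun h => h2 u ⟨h, hu.2⟩))
    (fun t ht => by
      obtain ⟨pa, ha, pb, hb, hab⟩ := Filter.eventually_prod_iff.1 (key t ht)
      exact ⟨{u | pb u}, hb, ha.mono fun y hy u hu => hab hy hu.1⟩)
  obtain ⟨δ, hδ, hb⟩ := Metric.mem_nhdsWithin_iff.1 h
  exact ⟨δ, hδ, fun y hy t ht => hb ⟨hy.2, hy.1⟩ t ⟨ht, ht⟩⟩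

theorem intervalIntegrable_clm_apply {φ : ℝ → E →L[ℝ] F}
    (h : IntervalIntegrable φ MeasureTheory.volume 0 1) (v : E) :
    IntervalIntegrable (fun t => φ t v) MeasureTheory.volume 0 1 :=
  ⟨h.1.apply_continuousLinearMap v, h.2.apply_continuousLinearMap v⟩

/-- Differentiation under the integral sign up to the boundary of `S`. The derivatives at `y` and
`x` are uniformly close in `t`, and convexity lets the mean value inequality bound the remainder of
each slice by `ε ‖y - x‖`. -/
theorem hasFDerivWithinAt_integral_unit [CompleteSpace F] {S : Set E} (hc : Convex ℝ S)
    (hS : UniqueDiffOn ℝ S) {f : ℝ × E → F} (hf : ContDiffOn ℝ ∞ f (Icc (0 : ℝ) 1 ×ˢ S)) {x : E}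
    (hx : x ∈ S) :
    HasFDerivWithinAt (fun x => ∫ t in (0 : ℝ)..1, f (t, x))
      (∫ t in (0 : ℝ)..1, (fderivWithin ℝ f (Icc (0 : ℝ) 1 ×ˢ S) (t, x)).comp
        (ContinuousLinearMap.inr ℝ ℝ E)) S x := by
  have hD := (contDiffOn_partial hS hf).continuousOn
  rw [hasFDerivWithinAt_iff_isLittleO, Asymptotics.isLittleO_iff]
  intro ε hε
  obtain ⟨δ, hδ, hb⟩ := eventually_forall_Icc_dist_lt hD hx hε
  filter_upwards [inter_mem_nhdsWithin S (Metric.ball_mem_nhds x hδ)] with y hy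
  have hi1 := intervalIntegrable_slice hf.continuousOn hy.1
  have hi2 := intervalIntegrable_slice hf.continuousOn hx
  have hi3 := intervalIntegrable_slice hD hx
  rw [ContinuousLinearMap.intervalIntegral_apply hi3, ← integral_sub hi1 hi2,
    ← integral_sub (hi1.sub hi2) (intervalIntegrable_clm_apply hi3 _)]
  have := norm_integral_le_of_norm_le_const (a := (0 : ℝ)) (b := 1) (C := ε * ‖y - x‖)
    (f := fun t => f (t, y) - f (t, x) - ((fderivWithin ℝ f (Icc (0 : ℝ) 1 ×ˢ S) (t, x)).comp
        (ContinuousLinearMap.inr ℝ ℝ E)) (y - x)) (fun t ht => ?_)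
  · simpa using this
  · rw [uIoc_of_le zero_le_one] at ht
    have ht' : t ∈ Icc (0 : ℝ) 1 := ⟨ht.1.le, ht.2⟩
    exact (hc.inter (convex_ball x δ)).norm_image_sub_le_of_norm_hasFDerivWithin_le'
      (f := fun x => f (t, x))
      (fun z hz => (hasFDerivWithinAt_partial hf ht' hz.1).mono inter_subset_left)
      (fun z hz => by simpa [dist_eq_norm] using (hb z hz t ht').le)
      ⟨hx, Metric.mem_ball_self hδ⟩ hy

/-- The target is quantified inside the induction because the derivative of the integral is again
such an integral, with values in `E →L[ℝ] F`. -/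
theorem contDiffOn_integral_unit_nat (n : ℕ) : ∀ {F : Type} [NormedAddCommGroup F]
    [NormedSpace ℝ F] [CompleteSpace F] {S : Set E} (_ : Convex ℝ S)
    (_ : UniqueDiffOn ℝ S) {f : ℝ × E → F} (_ : ContDiffOn ℝ ∞ f (Icc (0 : ℝ) 1 ×ˢ S)),
    ContDiffOn ℝ n (fun x => ∫ t in (0 : ℝ)..1, f (t, x)) S := by
  induction n with
  | zero =>
    intro F _ _ _ S hc hS f hf
    simp only [Nat.cast_zero, contDiffOn_zero]
    exact fun x hx => (hasFDerivWithinAt_integral_unit hc hS hf hx).continuousWithinAt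
  | succ n ih =>
    intro F _ _ _ S hc hS f hf
    rw [Nat.cast_succ, contDiffOn_succ_iff_fderivWithin hS]
    refine ⟨fun x hx => (hasFDerivWithinAt_integral_unit hc hS hf hx).differentiableWithinAt,
      by simp, ?_⟩
    exact (ih hc hS (contDiffOn_partial hS hf)).congr fun x hx =>
      (hasFDerivWithinAt_integral_unit hc hS hf hx).fderivWithin (hS x hx)

/-- The integral over `[0,1]` of a smooth function depends smoothly on parameters in a convex set. -/
theorem contDiffOn_integral_unit [CompleteSpace F] {S : Set E} (hc : Convex ℝ S)
    (hS : UniqueDiffOn ℝ S) {f : ℝ × E → F} (hf : ContDiffOn ℝ ∞ f (Icc (0 : ℝ) 1 ×ˢ S)) :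
    ContDiffOn ℝ ∞ (fun x => ∫ t in (0 : ℝ)..1, f (t, x)) S :=
  contDiffOn_infty.2 fun n => contDiffOn_integral_unit_nat n hc hS hf

/-- Hadamard's lemma: a smooth function `f(a, y)` that vanishes for `y = 0` is of the form
`M(a, y) y` with `M` smooth. -/
theorem exists_contDiffOn_clm_apply_eq {E' : Type} [NormedAddCommGroup E'] [NormedSpace ℝ E']
    [CompleteSpace F] {A : Set E} (hA : Convex ℝ A) (hA' : UniqueDiffOn ℝ A) {ε : ℝ}
    {f : E × E' → F} (hf : ContDiffOn ℝ ∞ f (A ×ˢ Metric.ball (0 : E') ε))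
    (h0 : ∀ a ∈ A, f (a, 0) = 0) :
    ∃ L : E × E' → E' →L[ℝ] F, ContDiffOn ℝ ∞ L (A ×ˢ Metric.ball (0 : E') ε) ∧
      ∀ q ∈ A ×ˢ Metric.ball (0 : E') ε, f q = L q q.2 := by
  set S := A ×ˢ Metric.ball (0 : E') ε with hSdef
  have hc : Convex ℝ S := hA.prod (convex_ball _ _)
  have hS : UniqueDiffOn ℝ S := hA'.prod Metric.isOpen_ball.uniqueDiffOn
  have hmaps : ∀ t ∈ Icc (0 : ℝ) 1, ∀ q ∈ S, ((q.1, t • q.2) : E × E') ∈ S := by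
    intro t ht q hq
    refine ⟨hq.1, ?_⟩
    have h2 := hq.2
    rw [mem_ball_zero_iff] at h2 ⊢
    rw [norm_smul, Real.norm_of_nonneg ht.1]
    nlinarith [norm_nonneg q.2, ht.2, ht.1]
  -- The witness is `L(a, y) = ∫₀¹ ∂_y f(a, t y) dt`. The fundamental theorem of calculus along `t ↦
  -- (a, t y)` gives `f(a, y) - f(a, 0) = L(a, y) y`.
  have hD : ContDiffOn ℝ ∞ (fun p : ℝ × E × E' =>
      (fderivWithin ℝ f S (p.2.1, p.1 • p.2.2)).comp (ContinuousLinearMap.inr ℝ E E'))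
      (Icc (0 : ℝ) 1 ×ˢ S) := by
    refine ContDiffOn.clm_comp ?_ contDiffOn_const
    refine (hf.fderivWithin hS (m := ∞) (by simp)).comp (g := fderivWithin ℝ f S)
      (f := fun p : ℝ × E × E' => (p.2.1, p.1 • p.2.2)) ?_ fun p hp => hmaps _ hp.1 _ hp.2
    exact (by fun_prop : ContDiff ℝ ∞ (fun p : ℝ × E × E' => (p.2.1, p.1 • p.2.2))).contDiffOn
  refine ⟨_, contDiffOn_integral_unit hc hS hD, fun q hq => ?_⟩
  have hi := intervalIntegrable_slice hD.continuousOn hq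
  have hd : ∀ t ∈ Icc (0 : ℝ) 1, HasDerivWithinAt (fun t : ℝ => f (q.1, t • q.2))
      (((fderivWithin ℝ f S (q.1, t • q.2)).comp (ContinuousLinearMap.inr ℝ E E')) q.2)
      (Icc 0 1) t := by
    intro t ht
    have h1 := ((hf.differentiableOn (by simp)) _ (hmaps t ht q hq)).hasFDerivWithinAt
    have h2 : HasDerivWithinAt (fun t : ℝ => ((q.1, t • q.2) : E × E')) ((0 : E), q.2) (Icc 0 1) t := by
      have := ((hasDerivAt_const t q.1).prodMk ((hasDerivAt_id t).smul_const q.2)).hasDerivWithinAt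
        (s := Icc 0 1)
      simpa using this
    exact h1.comp_hasDerivWithinAt t h2 fun s hs => hmaps s hs q hq
  have hftc := integral_eq_sub_of_hasDerivAt_of_le (zero_le_one (α := ℝ))
    (f := fun t : ℝ => f (q.1, t • q.2)) (fun t ht => (hd t ht).continuousWithinAt)
    (fun t ht => (hd t ⟨ht.1.le, ht.2.le⟩).hasDerivAt (Icc_mem_nhds ht.1 ht.2))
    (intervalIntegrable_clm_apply hi _)
  rw [ContinuousLinearMap.intervalIntegral_apply hi, hftc]
  simp [h0 q.1 hq.1]

end Hadamard

/-! ### Vector fields, derivatives along vector fields, gluing -/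

section General

open Set

variable {E : Type*} [NormedAddCommGroup E] [NormedSpace ℝ E] {H : Type*} [TopologicalSpace H]
  {I : ModelWithCorners ℝ E H} {M : Type*} [TopologicalSpace M] [ChartedSpace H M]
  [IsManifold I ∞ M]
  {E' : Type*} [NormedAddCommGroup E'] [NormedSpace ℝ E'] {H' : Type*} [TopologicalSpace H']
  {I' : ModelWithCorners ℝ E' H'} {M' : Type*} [TopologicalSpace M'] [ChartedSpace H' M']
  [IsManifold I' ∞ M']
  {E'' : Type*} [NormedAddCommGroup E''] [NormedSpace ℝ E''] {H'' : Type*} [TopologicalSpace H'']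
  {I'' : ModelWithCorners ℝ E'' H''} {Q : Type*} [TopologicalSpace Q] [ChartedSpace H'' Q]

/-- The differential of a smooth map takes smooth sections to smooth sections. -/
theorem ContMDiffOn.mfderiv_section {f : M → M'} {U : Set M} (hU : IsOpen U)
    (hf : ContMDiffOn I I' ∞ f U) {s : Set Q} {b : Q → M} (hb : MapsTo b s U)
    {v : ∀ q, TangentSpace I (b q)}
    (hv : ContMDiffOn I'' I.tangent ∞ (fun q => (⟨b q, v q⟩ : TangentBundle I M)) s) :
    ContMDiffOn I'' I'.tangent ∞
      (fun q => (⟨f (b q), mfderiv I I' f (b q) (v q)⟩ : TangentBundle I' M')) s := by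
  have h1 := hf.contMDiffOn_tangentMapWithin (m := ∞) (by simp) hU.uniqueMDiffOn
  refine (h1.comp hv fun q hq => hb hq).congr fun q hq => ?_
  simp only [Function.comp, tangentMapWithin]
  rw [mfderivWithin_of_isOpen hU (hb hq)]

theorem ContMDiffOn.snd_modelSpace {s : Set Q} {b : Q → H} {v : ∀ q, TangentSpace I (b q)}
    (hv : ContMDiffOn I'' I.tangent ∞ (fun q => (⟨b q, v q⟩ : TangentBundle I H)) s) :
    ContMDiffOn I'' 𝓘(ℝ, E) ∞ (fun q => (show E from v q)) s :=
  (contMDiff_snd_tangentBundle_modelSpace H I).comp_contMDiffOn hv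

theorem ContMDiffOn.mfderiv_apply {f : M → E'} {U : Set M} (hU : IsOpen U)
    (hf : ContMDiffOn I 𝓘(ℝ, E') ∞ f U) {s : Set Q} {b : Q → M} (hb : MapsTo b s U)
    {v : ∀ q, TangentSpace I (b q)}
    (hv : ContMDiffOn I'' I.tangent ∞ (fun q => (⟨b q, v q⟩ : TangentBundle I M)) s) :
    ContMDiffOn I'' 𝓘(ℝ, E') ∞ (fun q => (show E' from mfderiv I 𝓘(ℝ, E') f (b q) (v q))) s :=
  ContMDiffOn.snd_modelSpace (hf.mfderiv_section hU hb hv)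

/-- A smooth map to the model space gives a section of its tangent bundle. -/
theorem ContMDiffOn.section_modelSpace {s : Set Q} {b : Q → H} {v : Q → E}
    (hb : ContMDiffOn I'' I ∞ b s) (hv : ContMDiffOn I'' 𝓘(ℝ, E) ∞ v s) :
    ContMDiffOn I'' I.tangent ∞
      (fun q => (⟨b q, (show TangentSpace I (b q) from v q)⟩ : TangentBundle I H)) s := by
  have h0 := hb.prodMk hv
  -- The product of two model spaces carries a product atlas and the atlas of a model space. They
  -- agree, but only after this rewriting.
  rw [chartedSpaceSelf_prod] at h0
  exact (contMDiff_tangentBundleModelSpaceHomeomorph_symm (I := I) (n := ∞)).comp_contMDiffOn h0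

end General

/-! ### Derivatives along vector fields, brackets, density of the interior. -/

section Fields

open Set

variable {m : ℕ} {M : Type*} [TopologicalSpace M] [ChartedSpace (EuclideanQuadrant m) M]

theorem dirDeriv_congr {V : ∀ x : M, TangentSpace (IQ m) x} {u u' : M → ℝ} {x : M}
    (h : u =ᶠ[nhds x] u') : dirDeriv V u x = dirDeriv V u' x := by
  unfold dirDeriv
  rw [h.mfderiv_eq]
  rfl

theorem dirDeriv_congr_left {V V' : ∀ x : M, TangentSpace (IQ m) x} {u : M → ℝ} {x : M}
    (h : V x = V' x) : dirDeriv V u x = dirDeriv V' u x := by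
  unfold dirDeriv
  rw [h]

theorem dirDeriv_const (V : ∀ x : M, TangentSpace (IQ m) x) (c : ℝ) (x : M) :
    dirDeriv V (fun _ => c) x = 0 := by
  unfold dirDeriv
  rw [mfderiv_const]
  rfl

theorem dirDeriv_add {V : ∀ x : M, TangentSpace (IQ m) x} {u v : M → ℝ} {x : M}
    (hu : MDifferentiableAt (IQ m) 𝓘(ℝ, ℝ) u x) (hv : MDifferentiableAt (IQ m) 𝓘(ℝ, ℝ) v x) :
    dirDeriv V (fun y => u y + v y) x = dirDeriv V u x + dirDeriv V v x := by
  unfold dirDeriv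
  change mfderiv (IQ m) 𝓘(ℝ, ℝ) (u + v) x (V x) = _
  rw [mfderiv_add hu hv]
  rfl

theorem dirDeriv_mul {V : ∀ x : M, TangentSpace (IQ m) x} {u v : M → ℝ} {x : M}
    (hu : MDifferentiableAt (IQ m) 𝓘(ℝ, ℝ) u x) (hv : MDifferentiableAt (IQ m) 𝓘(ℝ, ℝ) v x) :
    dirDeriv V (fun y => u y * v y) x = u x * dirDeriv V v x + v x * dirDeriv V u x := by
  unfold dirDeriv
  change mfderiv (IQ m) 𝓘(ℝ, ℝ) (u * v) x (V x) = _
  rw [(hu.hasMFDerivAt.mul hv.hasMFDerivAt).mfderiv]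
  rfl

theorem dirDeriv_const_mul {V : ∀ x : M, TangentSpace (IQ m) x} {u : M → ℝ} {x : M} (c : ℝ)
    (hu : MDifferentiableAt (IQ m) 𝓘(ℝ, ℝ) u x) :
    dirDeriv V (fun y => c * u y) x = c * dirDeriv V u x := by
  rw [dirDeriv_mul mdifferentiableAt_const hu, dirDeriv_const]
  ring

theorem dirDeriv_add_left (V W : ∀ x : M, TangentSpace (IQ m) x) (u : M → ℝ) (x : M) :
    dirDeriv (fun y => V y + W y) u x = dirDeriv V u x + dirDeriv W u x :=
  map_add (mfderiv (IQ m) 𝓘(ℝ, ℝ) u x) (V x) (W x)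

theorem dirDeriv_smul_left (f : M → ℝ) (V : ∀ x : M, TangentSpace (IQ m) x) (u : M → ℝ) (x : M) :
    dirDeriv (fun y => f y • V y) u x = f x * dirDeriv V u x :=
  map_smul (mfderiv (IQ m) 𝓘(ℝ, ℝ) u x) (f x) (V x)

theorem dirDeriv_sum_smul_left {ι : Type*} (s : Finset ι) (f : ι → M → ℝ)
    (V : ι → ∀ x : M, TangentSpace (IQ m) x) (u : M → ℝ) (x : M) :
    dirDeriv (fun y => ∑ i ∈ s, f i y • V i y) u x = ∑ i ∈ s, f i x * dirDeriv (V i) u x := by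
  unfold dirDeriv
  rw [map_sum]
  exact Finset.sum_congr rfl fun i _ => map_smul (mfderiv (IQ m) 𝓘(ℝ, ℝ) u x) (f i x) (V i x)

variable [IsManifold (IQ m) ∞ M]

theorem SmoothVF.contMDiff_mk (V : SmoothVF m M) :
    ContMDiff (IQ m) (IQ m).tangent ∞ (fun x => (⟨x, V x⟩ : TangentBundle (IQ m) M)) :=
  V.contMDiff

theorem contMDiffOn_dirDeriv {V : ∀ x : M, TangentSpace (IQ m) x} {u : M → ℝ} {U : Set M}
    (hU : IsOpen U)
    (hV : ContMDiffOn (IQ m) (IQ m).tangent ∞ (fun x => (⟨x, V x⟩ : TangentBundle (IQ m) M)) U)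
    (hu : ContMDiffOn (IQ m) 𝓘(ℝ, ℝ) ∞ u U) :
    ContMDiffOn (IQ m) 𝓘(ℝ, ℝ) ∞ (dirDeriv V u) U :=
  hu.mfderiv_apply hU (fun _ h => h) hV

theorem SmoothVF.contMDiffOn_dirDeriv (V : SmoothVF m M) {u : M → ℝ} {U : Set M}
    (hU : IsOpen U) (hu : ContMDiffOn (IQ m) 𝓘(ℝ, ℝ) ∞ u U) :
    ContMDiffOn (IQ m) 𝓘(ℝ, ℝ) ∞ (dirDeriv V u) U :=
  _root_.contMDiffOn_dirDeriv hU V.contMDiff_mk.contMDiffOn hu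

theorem SmoothVF.contMDiff_dirDeriv (V : SmoothVF m M) {u : M → ℝ}
    (hu : ContMDiff (IQ m) 𝓘(ℝ, ℝ) ∞ u) : ContMDiff (IQ m) 𝓘(ℝ, ℝ) ∞ (dirDeriv V u) :=
  contMDiffOn_univ.1 (V.contMDiffOn_dirDeriv isOpen_univ hu.contMDiffOn)

/-- The derivation of `C^∞(M)` given by a vector field. -/
def SmoothVF.deriv (V : SmoothVF m M) : Module.End ℝ (SmoothFun m M) where
  toFun f := ⟨dirDeriv V f, V.contMDiff_dirDeriv f.contMDiff⟩
  map_add' f g := by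
    ext x
    exact dirDeriv_add f.mdifferentiableAt g.mdifferentiableAt
  map_smul' c f := by
    ext x
    exact dirDeriv_const_mul c f.mdifferentiableAt

theorem SmoothVF.isDerivAlong_deriv (V : SmoothVF m M) : IsDerivAlong V V.deriv :=
  fun _ _ => rfl

instance isManifold_minSmoothness_two : IsManifold (IQ m) (minSmoothness ℝ 2) M := by
  rw [minSmoothness_of_isRCLikeNormedField]
  infer_instance

instance isManifold_minSmoothness_three : IsManifold (IQ m) (minSmoothness ℝ 3) M := by
  rw [minSmoothness_of_isRCLikeNormedField]
  exact IsManifold.of_le (n := ∞) (WithTop.coe_le_coe.2 le_top : ((3 : ℕ∞) : WithTop ℕ∞) ≤ _)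

/-- The Lie bracket of smooth vector fields. -/
def SmoothVF.bracket (V W : SmoothVF m M) : SmoothVF m M :=
  ⟨VectorField.mlieBracket (IQ m) V W,
    haveI : IsManifold (IQ m) (((⊤ : ℕ∞) : WithTop ℕ∞) + 1) M := inferInstanceAs (IsManifold (IQ m) ∞ M)
    ContDiff.mlieBracket_vectorField (m := (⊤ : ℕ∞)) (n := (⊤ : ℕ∞)) V.contMDiff W.contMDiff (by simp)⟩

theorem SmoothVF.mdifferentiableAt_mk (V : SmoothVF m M) (x : M) :
    MDifferentiableAt (IQ m) (IQ m).tangent (fun x => (⟨x, V x⟩ : TangentBundle (IQ m) M)) x :=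
  (V.contMDiff_mk x).mdifferentiableAt (by simp)

/-- A chart image of a neighbourhood is relatively open in the quadrant, which is the closure of its
interior, and being an interior point does not depend on the chart. Smooth objects are therefore
determined by their restriction to the interior. -/
theorem dense_interior_quadrant : Dense ((IQ m).interior M) := by
  intro x
  rw [mem_closure_iff_nhds]
  intro U hU
  have h1 : extChartAt (IQ m) x x ∈ closure (interior (range (IQ m))) :=
    (IQ m).range_subset_closure_interior (mem_range_self _)
  have h2 : (extChartAt (IQ m) x).symm ⁻¹' U ∩ (extChartAt (IQ m) x).target ∈
      nhdsWithin (extChartAt (IQ m) x x) (range (IQ m)) :=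
    Filter.inter_mem
      ((continuousAt_extChartAt_symm x).continuousWithinAt.preimage_mem_nhdsWithin (by simpa using hU))
      (extChartAt_target_mem_nhdsWithin x)
  obtain ⟨O, hO, hxO, hOs⟩ := mem_nhdsWithin.1 h2
  obtain ⟨y, hyO, hy⟩ := mem_closure_iff.1 h1 O hO hxO
  obtain ⟨hyU, hyt⟩ := hOs ⟨hyO, interior_subset hy⟩
  refine ⟨(extChartAt (IQ m) x).symm y, hyU, ?_⟩
  have hs : (extChartAt (IQ m) x).symm y ∈ (chartAt (EuclideanQuadrant m) x).source := by
    rw [← extChartAt_source (IQ m)]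
    exact (extChartAt (IQ m) x).map_target hyt
  have := (IQ m).isInteriorPoint_iff_of_mem_atlas (M := M) (n := ∞) (by simp)
    (chart_mem_atlas (EuclideanQuadrant m) x) hs
  refine this.2 (OpenPartialHomeomorph.mem_interior_extend_target _ ?_ ?_)
  · rw [← OpenPartialHomeomorph.extend_source (I := IQ m)] at hs
    exact (chartAt (EuclideanQuadrant m) x).map_source (by simpa using hs)
  · change (extChartAt (IQ m) x) ((extChartAt (IQ m) x).symm y) ∈ interior (range (IQ m))
    rw [(extChartAt (IQ m) x).right_inv hyt]
    exact hy

end Fields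

/-! ### Extension from dense sets, and tangency to the faces. -/

section Gluing

open Set Filter

variable {m : ℕ} {M : Type*} [TopologicalSpace M] [ChartedSpace (EuclideanQuadrant m) M]

theorem eqOn_of_dense {Z : Type*} [TopologicalSpace Z] [T2Space Z] {D U : Set M} (hD : Dense D)
    (hU : IsOpen U) {f g : M → Z} (hf : ContinuousOn f U) (hg : ContinuousOn g U)
    (h : ∀ x ∈ D ∩ U, f x = g x) {x : M} (hx : x ∈ U) : f x = g x := by
  have : (nhdsWithin x D).NeBot := mem_closure_iff_nhdsWithin_neBot.1 (hD x)
  have h1 := (hf.continuousAt (hU.mem_nhds hx)).mono_left (nhdsWithin_le_nhds (s := D))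
  have h2 := (hg.continuousAt (hU.mem_nhds hx)).mono_left (nhdsWithin_le_nhds (s := D))
  refine tendsto_nhds_unique_of_eventuallyEq h1 h2 ?_
  filter_upwards [self_mem_nhdsWithin, mem_nhdsWithin_of_mem_nhds (hU.mem_nhds hx)] with y h3 h4
  exact h y ⟨h3, h4⟩

/-- Smooth functions that are given locally on a dense set extend uniquely. -/
theorem exists_smoothFun_eqOn_dense {D : Set M} (hD : Dense D) (F : M → ℝ)
    (hloc : ∀ p : M, ∃ U : Set M, IsOpen U ∧ p ∈ U ∧ ∃ f : M → ℝ,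
      ContMDiffOn (IQ m) 𝓘(ℝ, ℝ) ∞ f U ∧ ∀ q ∈ D ∩ U, f q = F q) :
    ∃ f : SmoothFun m M, ∀ q ∈ D, f q = F q := by
  choose U hU hpU f hf hfF using hloc
  -- Two local extensions agree on their overlap by density, so the diagonal function `p ↦ f p p`
  -- coincides near each point with one of the local extensions.
  have key : ∀ p, ∀ q ∈ U p, f q q = f p q := fun p q hq =>
    eqOn_of_dense hD ((hU q).inter (hU p)) ((hf q).continuousOn.mono inter_subset_left)
      ((hf p).continuousOn.mono inter_subset_right)
      (fun x hx => (hfF q x ⟨hx.1, hx.2.1⟩).trans (hfF p x ⟨hx.1, hx.2.2⟩).symm) ⟨hpU q, hq⟩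
  refine ⟨⟨fun p => f p p, fun p => ?_⟩, fun q hq => hfF q q ⟨hq, hpU q⟩⟩
  refine ((hf p).contMDiffAt ((hU p).mem_nhds (hpU p))).congr_of_eventuallyEq ?_
  filter_upwards [(hU p).mem_nhds (hpU p)] with q hq using key p q hq

theorem SmoothFun.ext_of_dense {D : Set M} (hD : Dense D) {f g : SmoothFun m M}
    (h : ∀ x ∈ D, f x = g x) : f = g := by
  ext x
  exact eqOn_of_dense hD isOpen_univ f.contMDiff.continuous.continuousOn
    g.contMDiff.continuous.continuousOn (fun y hy => h y hy.1) (mem_univ x)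

theorem hasMFDerivAt_chart_coord (x : M) (i : Fin m) :
    HasMFDerivAt (IQ m) 𝓘(ℝ, ℝ) (fun y => (chartAt (EuclideanQuadrant m) x y).1 i) x
      (EuclideanSpace.proj i : Euc m →L[ℝ] ℝ) := by
  refine ⟨?_, ?_⟩
  · have h1 : ContinuousAt (chartAt (EuclideanQuadrant m) x) x :=
      (chartAt (EuclideanQuadrant m) x).continuousAt (mem_chart_source _ x)
    have h2 : Continuous fun q : EuclideanQuadrant m => q.1 i :=
      (EuclideanSpace.proj i : Euc m →L[ℝ] ℝ).continuous.comp continuous_subtype_val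
    exact h2.continuousAt.comp h1
  · refine ((EuclideanSpace.proj i : Euc m →L[ℝ] ℝ).hasFDerivWithinAt).congr_of_eventuallyEq ?_ ?_
    · filter_upwards [extChartAt_target_mem_nhdsWithin (I := IQ m) x] with y hy
      have := (extChartAt (IQ m) x).right_inv hy
      exact congrArg (fun z : Euc m => z i) this
    · have := (extChartAt (IQ m) x).left_inv (mem_extChartAt_source (I := IQ m) x)
      change (chartAt (EuclideanQuadrant m) x ((extChartAt (IQ m) x).symm (extChartAt (IQ m) x x))).1 i = _
      rw [this]
      rfl

/-- In the chart, a direction tangent to the faces can be followed for both signs of time without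
leaving the quadrant. Along this segment `f` has a local minimum at time `0`. -/
theorem HasMFDerivAt.apply_eq_zero_of_nonneg {x : M} {f : M → ℝ} {f' : Euc m →L[ℝ] ℝ}
    (hf : HasMFDerivAt (IQ m) 𝓘(ℝ, ℝ) f x f') (hpos : ∀ᶠ y in nhds x, 0 ≤ f y) (h0 : f x = 0)
    {w : Euc m} (hv : ∀ i : Fin m, (chartAt (EuclideanQuadrant m) x x).1 i = 0 → w i = 0) :
    f' w = 0 := by
  set q := extChartAt (IQ m) x x with hq
  have hd : HasFDerivWithinAt (f ∘ (extChartAt (IQ m) x).symm) (f')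
      (range (IQ m)) q := hf.2
  have hr : range (IQ m) = {y : Euc m | ∀ i, 0 ≤ y i} := range_euclideanQuadrant m
  -- Coordinates that vanish at `q` do not move, and the others are positive and stay so for small
  -- `t`.
  have hcurve : ∀ᶠ t : ℝ in nhds 0, q + t • w ∈ range (IQ m) := by
    rw [hr]
    refine eventually_all.2 fun i => ?_
    have hqi : (0 : ℝ) ≤ q i := (chartAt (EuclideanQuadrant m) x x).2 i
    rcases hqi.eq_or_lt with h | h
    · refine Eventually.of_forall fun t => ?_
      have := hv i h.symm
      change 0 ≤ q i + t * w i
      rw [this, ← h]; simp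
    · have hc : ContinuousAt (fun t : ℝ => q i + t * w i) 0 := by fun_prop
      have := hc.eventually_const_lt (u := 0) (by simpa using h)
      exact this.mono fun t ht => ht.le
  have hcd : HasDerivWithinAt (fun t : ℝ => q + t • w) w
      {t | q + t • w ∈ range (IQ m)} 0 := by
    have := ((hasDerivAt_id (0 : ℝ)).smul_const w).const_add q
    simpa only [id, one_smul] using this.hasDerivWithinAt
  have hcomp := HasFDerivWithinAt.comp_hasDerivWithinAt_of_eq (x := (0 : ℝ)) (y := q)
    (f := fun t : ℝ => q + t • w) hd hcd (fun t ht => ht) (by simp)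
  have hderiv := hcomp.hasDerivAt hcurve
  refine IsLocalMin.hasDerivAt_eq_zero ?_ hderiv
  have hcont : ContinuousAt (fun t : ℝ => (extChartAt (IQ m) x).symm (q + t • w)) 0 := by
    have h1 : ContinuousAt (extChartAt (IQ m) x).symm (q + (0 : ℝ) • w) := by
      simpa only [zero_smul, add_zero] using continuousAt_extChartAt_symm (I := IQ m) x
    exact ContinuousAt.comp (f := fun t : ℝ => q + t • w) h1 (by fun_prop)
  have hx0 : (extChartAt (IQ m) x).symm (q + (0 : ℝ) • w) = x := by
    rw [zero_smul, add_zero]; exact extChartAt_to_inv x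
  have hcont' : Tendsto (fun t : ℝ => (extChartAt (IQ m) x).symm (q + t • w))
      (nhds 0) (nhds x) := by
    have := hcont.tendsto
    rwa [hx0] at this
  filter_upwards [hcont'.eventually hpos] with t ht
  simp only [Function.comp]
  rw [hx0, h0]
  exact ht

/-- A tangent vector is tangent to the faces if and only if it annihilates the nonnegative functions
vanishing at its base point. -/
theorem tangent_to_faces_iff (x : M) (v : TangentSpace (IQ m) x) :
    (∀ i : Fin m, (chartAt (EuclideanQuadrant m) x x).1 i = 0 → (show Euc m from v) i = 0) ↔
    ∀ f : M → ℝ, MDifferentiableAt (IQ m) 𝓘(ℝ, ℝ) f x → (∀ᶠ y in nhds x, 0 ≤ f y) → f x = 0 →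
      (mfderiv (IQ m) 𝓘(ℝ, ℝ) f x v : ℝ) = 0 := by
  constructor
  · intro hv f hf hpos h0
    exact hf.hasMFDerivAt.apply_eq_zero_of_nonneg hpos h0 hv
  · intro h i hi
    -- The `i`-th chart coordinate is itself a nonnegative function vanishing at `x`.
    have hd := hasMFDerivAt_chart_coord x i
    have := h _ hd.mdifferentiableAt (Eventually.of_forall fun y => (chartAt (EuclideanQuadrant m) x y).2 i) hi
    rw [hd.mfderiv] at this
    exact this

variable [IsManifold (IQ m) ∞ M]

/-- In a trivialisation of the tangent bundle the fields become functions with values in the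
Hausdorff space `Euc m`; no separation property of `M` is needed. -/
theorem vectorField_eq_of_dense {D U : Set M} (hD : Dense D) (hU : IsOpen U)
    {V W : ∀ x : M, TangentSpace (IQ m) x}
    (hV : ContMDiffOn (IQ m) (IQ m).tangent ∞ (fun x => (⟨x, V x⟩ : TangentBundle (IQ m) M)) U)
    (hW : ContMDiffOn (IQ m) (IQ m).tangent ∞ (fun x => (⟨x, W x⟩ : TangentBundle (IQ m) M)) U)
    (h : ∀ x ∈ D ∩ U, V x = W x) {x : M} (hx : x ∈ U) : V x = W x := by
  set e := trivializationAt (Euc m) (TangentSpace (IQ m) (M := M)) x with he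
  have hsub : ∀ y ∈ U ∩ e.baseSet, ∀ v : TangentSpace (IQ m) y,
      (⟨y, v⟩ : TangentBundle (IQ m) M) ∈ e.source := fun y hy v => (e.mem_source).2 hy.2
  have hx' : x ∈ e.baseSet := FiberBundle.mem_baseSet_trivializationAt' x
  have hc : ∀ Z : ∀ x : M, TangentSpace (IQ m) x,
      ContMDiffOn (IQ m) (IQ m).tangent ∞ (fun x => (⟨x, Z x⟩ : TangentBundle (IQ m) M)) U →
      ContinuousOn (fun y => (e (⟨y, Z y⟩ : TangentBundle (IQ m) M)).2) (U ∩ e.baseSet) :=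
    fun Z hZ => continuous_snd.comp_continuousOn <| e.continuousOn.comp (hZ.continuousOn.mono inter_subset_left)
      fun y hy => hsub y hy _
  have := eqOn_of_dense hD (hU.inter e.open_baseSet) (hc V hV) (hc W hW)
    (fun y hy => by rw [h y ⟨hy.1, hy.2.1⟩]) ⟨hx, hx'⟩
  have hv := hsub x ⟨hx, hx'⟩ (V x)
  have hw := hsub x ⟨hx, hx'⟩ (W x)
  have h2 : (⟨x, V x⟩ : TangentBundle (IQ m) M) = ⟨x, W x⟩ :=
    e.injOn hv hw (Prod.ext ((e.coe_fst hv).trans (e.coe_fst hw).symm) this)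
  exact (Bundle.TotalSpace.mk_inj).1 h2

theorem SmoothVF.ext_of_dense {D : Set M} (hD : Dense D) {V W : SmoothVF m M}
    (h : ∀ x ∈ D, V x = W x) : V = W := by
  ext1 x
  exact vectorField_eq_of_dense hD isOpen_univ V.contMDiff_mk.contMDiffOn
    W.contMDiff_mk.contMDiffOn (fun y hy => h y hy.1) (mem_univ x)

/-- Smooth vector fields that are given locally on a dense set extend uniquely. -/
theorem exists_smoothVF_eqOn_dense {D : Set M} (hD : Dense D)
    (F : ∀ x : M, TangentSpace (IQ m) x)
    (hloc : ∀ p : M, ∃ U : Set M, IsOpen U ∧ p ∈ U ∧ ∃ W : ∀ x : M, TangentSpace (IQ m) x,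
      ContMDiffOn (IQ m) (IQ m).tangent ∞ (fun x => (⟨x, W x⟩ : TangentBundle (IQ m) M)) U ∧
        ∀ q ∈ D ∩ U, W q = F q) :
    ∃ W : SmoothVF m M, ∀ q ∈ D, W q = F q := by
  choose U hU hpU f hf hfF using hloc
  have key : ∀ p, ∀ q ∈ U p, f q q = f p q := fun p q hq =>
    vectorField_eq_of_dense hD ((hU q).inter (hU p)) ((hf q).mono inter_subset_left)
      ((hf p).mono inter_subset_right)
      (fun x hx => (hfF q x ⟨hx.1, hx.2.1⟩).trans (hfF p x ⟨hx.1, hx.2.2⟩).symm) ⟨hpU q, hq⟩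
  refine ⟨⟨fun p => f p p, fun p => ?_⟩, fun q hq => hfF q q ⟨hq, hpU q⟩⟩
  refine ((hf p).contMDiffAt ((hU p).mem_nhds (hpU p))).congr_of_eventuallyEq ?_
  filter_upwards [(hU p).mem_nhds (hpU p)] with q hq
  rw [key p q hq]

end Gluing

/-! ### The Gauss lemma in normal charts -/

section Gauss

open Set Filter

variable {E₁ E₂ : Type*} [NormedAddCommGroup E₁] [NormedSpace ℝ E₁] [NormedAddCommGroup E₂]
  [InnerProductSpace ℝ E₂]

/-- A function with zero derivative on `(0, 1)` that is continuous on `[0, 1]` is constant. -/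
theorem eq_of_hasDerivAt_zero {f : ℝ → ℝ} (hc : ContinuousOn f (Icc 0 1))
    (hf : ∀ t ∈ Ioo (0 : ℝ) 1, HasDerivAt f 0 t) : f 1 = f 0 := by
  obtain ⟨t, -, ht⟩ := exists_hasDerivAt_eq_slope f (fun _ => 0) zero_lt_one hc hf
  simp only [sub_zero, div_one] at ht
  linarith

set_option synthInstance.maxHeartbeats 200000 in
set_option maxHeartbeats 1000000 in
theorem DifferentiableWithinAt.exists_hasFDerivWithinAt_apply₂ {E : Type*} [NormedAddCommGroup E]
    [NormedSpace ℝ E] {G : E → E →L[ℝ] E →L[ℝ] ℝ} {s : Set E} {q : E}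
    (hd : DifferentiableWithinAt ℝ G s q) (v w : E) : ∃ L : E →L[ℝ] ℝ,
      HasFDerivWithinAt (fun q => G q v w) L s q ∧ ∀ z, L z = fderivWithin ℝ G s q z v w := by
  have h2 := hd.hasFDerivWithinAt.clm_apply (hasFDerivWithinAt_const v q s)
  have h3 := h2.clm_apply (hasFDerivWithinAt_const w q s)
  refine ⟨_, h3, fun z => ?_⟩
  simp

set_option synthInstance.maxHeartbeats 200000 in
set_option maxHeartbeats 1000000 in
theorem DifferentiableWithinAt.exists_hasFDerivWithinAt_quadratic {E : Type*}
    [NormedAddCommGroup E] [NormedSpace ℝ E] {G : E → E →L[ℝ] E →L[ℝ] ℝ} {s : Set E} {q : E}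
    (hd : DifferentiableWithinAt ℝ G s q) (P : E →L[ℝ] E) : ∃ L : E →L[ℝ] ℝ,
      HasFDerivWithinAt (fun q => G q (P q) (P q)) L s q ∧
        ∀ z, L z = fderivWithin ℝ G s q z (P q) (P q) + G q (P z) (P q) + G q (P q) (P z) := by
  have h1 := hd.hasFDerivWithinAt
  have h2 := h1.clm_apply (P.hasFDerivWithinAt (s := s) (x := q))
  have h3 := h2.clm_apply (P.hasFDerivWithinAt (s := s) (x := q))
  refine ⟨_, h3, fun z => ?_⟩
  simp
  ring

set_option synthInstance.maxHeartbeats 200000 in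
set_option maxHeartbeats 1000000 in
-- Rays have constant speed, so `G_(u,y)(y, y) = |y|²`. Differentiating this identity in a direction
-- `w` and inserting the geodesic equation gives an ordinary differential equation in `t` for
-- `G_(u,ty)(y, w)`. Its solution that is regular at `t = 0` is the constant `⟨y, w⟩`. The set `A`
-- is the quadrant in the application, so all derivatives are taken within `A × E₂`.
theorem gauss_lemma {A : Set E₁} (hA : UniqueDiffOn ℝ A) {U : Set (E₁ × E₂)}
    (hU : IsOpen U) (hstar : ∀ u ∈ A, ∀ y, (u, y) ∈ U → ∀ t ∈ Icc (0 : ℝ) 1, (u, t • y) ∈ U)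
    {G : E₁ × E₂ → E₁ × E₂ →L[ℝ] E₁ × E₂ →L[ℝ] ℝ} (hsymm : ∀ q v w, G q v w = G q w v)
    (hd : ∀ q ∈ (A ×ˢ (univ : Set E₂)) ∩ U, DifferentiableWithinAt ℝ G (A ×ˢ univ) q)
    (hgeo : ∀ u ∈ A, ∀ (v : E₂) (t : ℝ), (u, t • v) ∈ U → ∀ w,
      HasDerivAt (fun s => G (u, s • v) (0, v) w)
        (1 / 2 * fderivWithin ℝ (fun q => G q (0, v) (0, v)) (A ×ˢ univ) (u, t • v) w) t)
    (h0 : ∀ u ∈ A, (u, (0 : E₂)) ∈ U → ∀ (v : E₂) (b : E₁) (v' : E₂),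
      G (u, 0) (0, v) (b, v') = inner ℝ v v')
    {u : E₁} (hu : u ∈ A) {y : E₂} (hy : (u, y) ∈ U) (b : E₁) (w : E₂) :
    G (u, y) (0, y) (b, w) = inner ℝ y w := by
  have hR : UniqueDiffOn ℝ (A ×ˢ (univ : Set E₂)) := hA.prod uniqueDiffOn_univ
  have hdv : ∀ q ∈ (A ×ˢ (univ : Set E₂)) ∩ U, ∀ v w : E₁ × E₂, ∃ L : E₁ × E₂ →L[ℝ] ℝ,
      HasFDerivWithinAt (fun q => G q v w) L (A ×ˢ univ) q ∧
        ∀ z, L z = fderivWithin ℝ G (A ×ˢ univ) q z v w := by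
    intro q hq v w
    exact (hd q hq).exists_hasFDerivWithinAt_apply₂ v w
  have hray : ∀ (u : E₁) (v : E₂) (t : ℝ), HasDerivAt (fun s : ℝ => ((u, s • v) : E₁ × E₂)) (0, v) t := by
    intro u v t
    have := (hasDerivAt_const t u).prodMk ((hasDerivAt_id t).smul_const v)
    simpa using this
  have hU0 : ∀ u ∈ A, ∀ y, (u, y) ∈ U → (u, (0 : E₂)) ∈ U := fun u hu y hy => by
    simpa using hstar u hu y hy 0 (by simp)
  have hcont : ∀ u ∈ A, ∀ y, (u, y) ∈ U → ∀ w,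
      ContinuousOn (fun s : ℝ => G (u, s • y) (0, y) w) (Icc 0 1) := fun u hu y hy w t ht =>
    (hgeo u hu y t (hstar u hu y hy t ht) w).continuousAt.continuousWithinAt
  -- the speed is constant along the rays
  have hspeed : ∀ u ∈ A, ∀ y, (u, y) ∈ U → G (u, y) (0, y) (0, y) = inner ℝ y y := by
    intro u hu y hy
    have hz : ∀ t ∈ Icc (0 : ℝ) 1, HasDerivAt (fun s => G (u, s • y) (0, y) (0, y)) 0 t := by
      intro t ht
      have hq : (u, t • y) ∈ U := hstar u hu y hy t ht
      have h1 := hgeo u hu y t hq (0, y)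
      have hqq : ((u, t • y) : E₁ × E₂) ∈ (A ×ˢ (univ : Set E₂)) ∩ U := ⟨⟨hu, mem_univ _⟩, hq⟩
      obtain ⟨L, hL, -⟩ := hdv _ hqq (0, y) (0, y)
      have h2 := hL.comp_hasDerivAt t (hray u y t) 
        (Eventually.of_forall fun s => show _ ∈ A ×ˢ (univ : Set E₂) from ⟨hu, mem_univ _⟩)
      rw [hL.fderivWithin (hR _ hqq.1)] at h1
      have h3 := h1.unique h2
      -- The chain rule gives the derivative of the squared speed as `L (0, y)`, while the geodesic
      -- equation tested on the velocity gives half of it.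
      have h4 : L (0, y) = 0 := by linarith
      rw [h4] at h2
      exact h2
    have := eq_of_hasDerivAt_zero (hcont u hu y hy _) fun t ht => hz t ⟨ht.1.le, ht.2.le⟩
    simp only [one_smul, zero_smul] at this
    rw [this, h0 u hu (hU0 u hu y hy)]
  -- differentiate the square of the norm
  have hdiff : ∀ u ∈ A, ∀ y, (u, y) ∈ U → ∀ w : E₁ × E₂,
      fderivWithin ℝ (fun q => G q (0, y) (0, y)) (A ×ˢ univ) (u, y) w
        + 2 * G (u, y) (0, y) (0, w.2) = 2 * inner ℝ y w.2 := by
    intro u hu y hy w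
    have hqq : ((u, y) : E₁ × E₂) ∈ (A ×ˢ (univ : Set E₂)) ∩ U := ⟨⟨hu, mem_univ _⟩, hy⟩
    let P : E₁ × E₂ →L[ℝ] E₁ × E₂ :=
      (ContinuousLinearMap.inr ℝ E₁ E₂).comp (ContinuousLinearMap.snd ℝ E₁ E₂)
    obtain ⟨L2, h2, hL2⟩ := (hd _ hqq).exists_hasFDerivWithinAt_quadratic P
    have h3 : HasFDerivWithinAt (fun q : E₁ × E₂ => (inner ℝ q.2 q.2 : ℝ))
        (2 • (innerSL ℝ y).comp (ContinuousLinearMap.snd ℝ E₁ E₂)) (A ×ˢ univ) (u, y) := by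
      have := ((hasStrictFDerivAt_norm_sq y).hasFDerivAt.comp (u, y)
        (ContinuousLinearMap.snd ℝ E₁ E₂).hasFDerivAt).hasFDerivWithinAt (s := A ×ˢ univ)
      simp only [Function.comp_def, ContinuousLinearMap.coe_snd'] at this
      simp only [real_inner_self_eq_norm_sq]
      exact this
    have h4 : (fun q : E₁ × E₂ => G q (P q) (P q)) =ᶠ[nhdsWithin (u, y) (A ×ˢ univ)]
        (fun q : E₁ × E₂ => (inner ℝ q.2 q.2 : ℝ)) := by
      filter_upwards [self_mem_nhdsWithin, mem_nhdsWithin_of_mem_nhds (hU.mem_nhds hy)] with q hq hqU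
      exact hspeed q.1 hq.1 q.2 hqU
    have h5 := h3.congr_of_eventuallyEq h4 (hspeed u hu y hy)
    have h6 := congrArg (fun L : E₁ × E₂ →L[ℝ] ℝ => L w) ((hR _ hqq.1).eq h2 h5)
    obtain ⟨L, hL, hL'⟩ := hdv _ hqq (0, y) (0, y)
    rw [hL.fderivWithin (hR _ hqq.1), hL' w]
    have h7 : G (u, y) (0, w.2) (0, y) = G (u, y) (0, y) (0, w.2) := hsymm _ _ _
    have h8 := hL2 w
    simp [P] at h6 h8
    linarith
  -- The identity `hdiff` at the point `(u, t y)` reads `t² ∂_w G(y, y) + 2 t G(y, w) = 2 t ⟨y, w⟩`,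
  -- with `w` standing for its fibre component in the last two terms. The geodesic equation turns
  -- `∂_w G(y, y)` into `2 d`, and one factor `t` is cancelled.
  have hφ : ∀ w : E₁ × E₂, ∀ t ∈ Ioo (0 : ℝ) 1, ∃ d, HasDerivAt (fun s => G (u, s • y) (0, y) w) d t ∧
      t * d = inner ℝ y w.2 - G (u, t • y) (0, y) (0, w.2) := by
    intro w t ht
    have hq : (u, t • y) ∈ U := hstar u hu y hy t ⟨ht.1.le, ht.2.le⟩
    have hqq : ((u, t • y) : E₁ × E₂) ∈ (A ×ˢ (univ : Set E₂)) ∩ U := ⟨⟨hu, mem_univ _⟩, hq⟩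
    refine ⟨_, hgeo u hu y t hq w, ?_⟩
    have h1 := hdiff u hu (t • y) hq w
    obtain ⟨L, hL, hL'⟩ := hdv _ hqq (0, y) (0, y)
    obtain ⟨L2, hL2, hL2'⟩ := hdv _ hqq (0, t • y) (0, t • y)
    have hs : ((0, t • y) : E₁ × E₂) = t • (0, y) := by simp
    rw [hL2.fderivWithin (hR _ hqq.1), hL2' w, hs] at h1
    rw [hL.fderivWithin (hR _ hqq.1), hL' w]
    simp only [map_smul, smul_apply, smul_eq_mul, inner_smul_left, RCLike.conj_to_real] at h1
    have ht0 : t ≠ 0 := ht.1.ne'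
    have h2 : t * (t * fderivWithin ℝ G (A ×ˢ univ) (u, t • y) w (0, y) (0, y)
        + 2 * G (u, t • y) (0, y) (0, w.2)) = t * (2 * inner ℝ y w.2) := by linarith
    have h3 := mul_left_cancel₀ ht0 h2
    linarith
  -- the component along the fibre
  have hfib : ∀ w : E₂, ∀ τ ∈ Ioc (0 : ℝ) 1, G (u, τ • y) (0, y) (0, w) = inner ℝ y w := by
    intro w τ hτ
    -- For directions in the fibre, the equation of `hφ` says precisely that this product has zero
    -- derivative, and it vanishes at `t = 0`.
    set f : ℝ → ℝ := fun t => t * (G (u, t • y) (0, y) (0, w) - inner ℝ y w) with hf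
    have hc : ContinuousOn f (Icc 0 τ) := continuousOn_id.mul
      (((hcont u hu y hy (0, w)).mono (Icc_subset_Icc_right hτ.2)).sub continuousOn_const)
    have hfd : ∀ t ∈ Ioo (0 : ℝ) τ, HasDerivAt f 0 t := by
      intro t ht
      obtain ⟨d, hd1, hd2⟩ := hφ (0, w) t ⟨ht.1, ht.2.trans_le hτ.2⟩
      have := (hasDerivAt_id t).mul (hd1.sub_const (inner ℝ y w))
      simp only [id, one_mul] at this
      rw [show G (u, t • y) (0, y) (0, w) - inner ℝ y w + t * d = 0 by linarith] at this
      exact this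
    obtain ⟨t, -, ht⟩ := exists_hasDerivAt_eq_slope f (fun _ => 0) hτ.1 hc hfd
    have h1 : f τ = 0 := by
      have := hτ.1.ne'
      field_simp at ht
      simpa [hf] using ht.symm
    have := (mul_eq_zero.1 h1).resolve_left hτ.1.ne'
    linarith
  -- The right side in `hφ` involves only the fibre component of the direction, which has just been
  -- shown to give zero.
  have hz : ∀ t ∈ Ioo (0 : ℝ) 1, HasDerivAt (fun s => G (u, s • y) (0, y) (b, w)) 0 t := by
    intro t ht
    obtain ⟨d, hd1, hd2⟩ := hφ (b, w) t ht
    rw [hfib w t ⟨ht.1, ht.2.le⟩, sub_self] at hd2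
    have : d = 0 := by
      rcases mul_eq_zero.1 hd2 with h | h
      · exact absurd h ht.1.ne'
      · exact h
    rwa [this] at hd1
  have := eq_of_hasDerivAt_zero (hcont u hu y hy (b, w)) hz
  simp only [one_smul, zero_smul] at this
  rw [this, h0 u hu (hU0 u hu y hy)]

end Gauss

/-! ### The distance to a submanifold in a normal chart -/

section NormalDistance

open Set Filter Bundle Manifold Topology

variable {m : ℕ} {M : Type*} [TopologicalSpace M] [ChartedSpace (EuclideanQuadrant m) M]
  
/-! ### Products of model spaces. -/

section ModelProduct

variable {E₁ H₁ E₂ H₂ : Type*} [NormedAddCommGroup E₁] [NormedSpace ℝ E₁] [TopologicalSpace H₁]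
  {I₁ : ModelWithCorners ℝ E₁ H₁} [NormedAddCommGroup E₂] [NormedSpace ℝ E₂] [TopologicalSpace H₂]
  {I₂ : ModelWithCorners ℝ E₂ H₂} {E' H' Q : Type*} [NormedAddCommGroup E'] [NormedSpace ℝ E']
  [TopologicalSpace H'] {J : ModelWithCorners ℝ E' H'} [TopologicalSpace Q] [ChartedSpace H' Q]

/-- The product of two models with corners, as a model over the product of the model spaces. -/
abbrev ModelWithCorners.selfProd (I₁ : ModelWithCorners ℝ E₁ H₁) (I₂ : ModelWithCorners ℝ E₂ H₂) :
    ModelWithCorners ℝ (E₁ × E₂) (H₁ × H₂) :=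
  I₁.prod I₂

theorem contMDiff_fst_model :
    ContMDiff (I₁.selfProd I₂) I₁ ∞ (Prod.fst : H₁ × H₂ → H₁) := by
  have h := contMDiff_fst (I := I₁) (J := I₂) (n := ∞) (M := H₁) (N := H₂)
  rw [chartedSpaceSelf_prod] at h
  exact h

theorem contMDiff_snd_model :
    ContMDiff (I₁.selfProd I₂) I₂ ∞ (Prod.snd : H₁ × H₂ → H₂) := by
  have h := contMDiff_snd (I := I₁) (J := I₂) (n := ∞) (M := H₁) (N := H₂)
  rw [chartedSpaceSelf_prod] at h
  exact h

theorem ContMDiffOn.prodMk_model {s : Set Q} {f : Q → H₁} {g : Q → H₂}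
    (hf : ContMDiffOn J I₁ ∞ f s) (hg : ContMDiffOn J I₂ ∞ g s) :
    ContMDiffOn J (I₁.selfProd I₂) ∞ (fun q => ((f q, g q) : H₁ × H₂)) s := by
  have h := hf.prodMk hg
  rw [chartedSpaceSelf_prod] at h
  exact h

theorem hasMFDerivAt_snd_model (p : H₁ × H₂) :
    HasMFDerivAt (I₁.selfProd I₂) I₂ (Prod.snd : H₁ × H₂ → H₂) p
      (ContinuousLinearMap.snd ℝ E₁ E₂) := by
  have h := hasMFDerivAt_snd (I := I₁) (I' := I₂) (M := H₁) (M' := H₂) p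
  rw [chartedSpaceSelf_prod] at h
  exact h

theorem hasMFDerivAt_fst_model (p : H₁ × H₂) :
    HasMFDerivAt (I₁.selfProd I₂) I₁ (Prod.fst : H₁ × H₂ → H₁) p
      (ContinuousLinearMap.fst ℝ E₁ E₂) := by
  have h := hasMFDerivAt_fst (I := I₁) (I' := I₂) (M := H₁) (M' := H₂) p
  rw [chartedSpaceSelf_prod] at h
  exact h

theorem HasMFDerivAt.prodMk_model {q : Q} {f : Q → H₁} {g : Q → H₂}
    {f' : TangentSpace J q →L[ℝ] TangentSpace I₁ (f q)}
    {g' : TangentSpace J q →L[ℝ] TangentSpace I₂ (g q)}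
    (hf : HasMFDerivAt J I₁ f q f') (hg : HasMFDerivAt J I₂ g q g') :
    HasMFDerivAt J (I₁.selfProd I₂) (fun q => ((f q, g q) : H₁ × H₂)) q (f'.prod g') := by
  have h := hf.prodMk hg
  rw [chartedSpaceSelf_prod] at h
  exact h

end ModelProduct

/-- The source of lower bounds for lengths: a function whose differential has norm at most `1` grows
along a path by at most the length, as one sees by integrating the derivative of `h ∘ η`. -/
theorem enorm_sub_le_pathELength [RiemannianBundle (fun x : M => TangentSpace (IQ m) x)]
    {h : M → ℝ} {V : Set M} (hV : IsOpen V) (hh : ContMDiffOn (IQ m) 𝓘(ℝ, ℝ) 1 h V)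
    (hle : ∀ x ∈ V, ∀ v : TangentSpace (IQ m) x,
      letI w : ℝ := mfderiv (IQ m) 𝓘(ℝ, ℝ) h x v; ‖w‖ₑ ≤ ‖v‖ₑ)
    {η : ℝ → M} (hη : ContMDiffOn 𝓘(ℝ, ℝ) (IQ m) 1 η (Icc 0 1)) (hm : MapsTo η (Icc 0 1) V) :
    ‖h (η 1) - h (η 0)‖ₑ ≤ pathELength (IQ m) η 0 1 := by
  have h1 : ContMDiffOn 𝓘(ℝ, ℝ) 𝓘(ℝ, ℝ) 1 (h ∘ η) (Icc 0 1) := hh.comp hη hm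
  have h2 : ContDiffOn ℝ 1 (h ∘ η) (Icc 0 1) := h1.contDiffOn
  refine (enorm_sub_le_lintegral_derivWithin_Icc_of_contDiffOn_Icc h2 zero_le_one).trans ?_
  rw [pathELength_eq_lintegral_mfderivWithin_Icc]
  refine MeasureTheory.setLIntegral_mono' measurableSet_Icc fun t ht => ?_
  have h3 : mfderivWithin 𝓘(ℝ, ℝ) 𝓘(ℝ, ℝ) (h ∘ η) (Icc 0 1) t = _ :=
    mfderiv_comp_mfderivWithin t
      ((hh.contMDiffAt (hV.mem_nhds (hm ht))).mdifferentiableAt (by simp))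
      ((hη t ht).mdifferentiableWithinAt (by simp))
      (uniqueMDiffWithinAt_iff_uniqueDiffWithinAt.2 (uniqueDiffOn_Icc zero_lt_one t ht))
  rw [mfderivWithin_eq_fderivWithin] at h3
  rw [← fderivWithin_derivWithin, h3]
  exact hle _ (hm ht) _

variable [IsManifold (IQ m) ∞ M]

/-- The coordinate expression of a true metric in a chart, as a field of bilinear forms. -/
def TrueMetric.coordCLM (γ : TrueMetric m M) {n c : ℕ} (φ : CornerChart m M n c)
    (q : Euc n × Euc c) : Euc n × Euc c →L[ℝ] Euc n × Euc c →L[ℝ] ℝ :=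
  (show Euc m →L[ℝ] Euc m →L[ℝ] ℝ from γ.inner (φ.symm ((IQE n c).symm q))).bilinearComp
    (show Euc n × Euc c →L[ℝ] Euc m from mfderiv (IQE n c) (IQ m) φ.symm ((IQE n c).symm q))
    (show Euc n × Euc c →L[ℝ] Euc m from mfderiv (IQE n c) (IQ m) φ.symm ((IQE n c).symm q))

theorem TrueMetric.contMDiffOn_inner (γ : TrueMetric m M) {E' H' Q : Type*} [NormedAddCommGroup E']
    [NormedSpace ℝ E'] [TopologicalSpace H'] {J : ModelWithCorners ℝ E' H'} [TopologicalSpace Q]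
    [ChartedSpace H' Q] {s : Set Q} {b : Q → M} {v w : ∀ q, TangentSpace (IQ m) (b q)}
    (hv : ContMDiffOn J (IQ m).tangent ∞ (fun q => (⟨b q, v q⟩ : TangentBundle (IQ m) M)) s)
    (hw : ContMDiffOn J (IQ m).tangent ∞ (fun q => (⟨b q, w q⟩ : TangentBundle (IQ m) M)) s) :
    ContMDiffOn J 𝓘(ℝ, ℝ) ∞ (fun q => γ.inner (b q) (v q) (w q)) s := by
  let : RiemannianBundle (fun x : M => TangentSpace (IQ m) x) := ⟨γ.toRiemannianMetric⟩
  exact fun x hx => ContMDiffWithinAt.inner_bundle (hv x hx) (hw x hx)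

theorem TrueMetric.contDiffOn_coord (γ : TrueMetric m M) {n c : ℕ} (φ : CornerChart m M n c)
    (v w : Euc n × Euc c) :
    ContDiffOn ℝ ∞ (fun q => γ.coord φ q v w)
      (range (IQE n c) ∩ (IQE n c).symm ⁻¹' φ.target) := by
  have hs : ∀ v : Euc n × Euc c, ContMDiffOn (IQE n c) (IQ m).tangent ∞
      (fun p => (⟨φ.symm p, mfderiv (IQE n c) (IQ m) φ.symm p v⟩ : TangentBundle (IQ m) M))
      φ.target := fun v =>
    φ.symm.contMDiffOn.mfderiv_section φ.open_target (fun _ h => h)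
      (ContMDiffOn.section_modelSpace contMDiffOn_id contMDiffOn_const)
  have h1 := γ.contMDiffOn_inner (hs v) (hs w)
  have h2 : ContMDiffOn 𝓘(ℝ, Euc n × Euc c) (IQE n c) ∞ (IQE n c).symm (range (IQE n c)) :=
    (IQE n c).contMDiffOn_symm
  exact (h1.comp (h2.mono inter_subset_left) fun q hq => hq.2).contDiffOn

theorem TrueMetric.contDiffOn_coordCLM (γ : TrueMetric m M) {n c : ℕ} (φ : CornerChart m M n c) :
    ContDiffOn ℝ ∞ (γ.coordCLM φ) (range (IQE n c) ∩ (IQE n c).symm ⁻¹' φ.target) := by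
  refine contDiffOn_clm_apply.2 fun v => contDiffOn_clm_apply.2 fun w => ?_
  exact γ.contDiffOn_coord φ v w

theorem range_IQE (n c : ℕ) :
    range (IQE n c) = {u : Euc n | ∀ i, 0 ≤ u i} ×ˢ (univ : Set (Euc c)) := by
  rw [ModelWithCorners.range_prod]
  congr 1
  · exact range_euclideanQuadrant n
  · simp

theorem IQE_symm_mk {n c : ℕ} {u : Euc n} (hu : ∀ i, 0 ≤ u i) (y : Euc c) :
    (IQE n c).symm (u, y) = (⟨u, hu⟩, y) :=
  (IQE n c).left_inv (⟨u, hu⟩, y)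

theorem uniqueDiffOn_quadrant (n : ℕ) : UniqueDiffOn ℝ {u : Euc n | ∀ i, 0 ≤ u i} := by
  rw [← range_euclideanQuadrant n]
  exact (IQ n).uniqueDiffOn

theorem convex_quadrant (n : ℕ) : Convex ℝ {u : Euc n | ∀ i, 0 ≤ u i} := by
  rw [← range_euclideanQuadrant n]
  exact (IQ n).convex_range

/-- The case of `gauss_lemma` in which `A` is the quadrant and `G` the coordinate expression of the
metric. The set `U` is needed because a chart domain need not be star-shaped in the normal
direction. -/
theorem TrueMetric.IsNormalChart.gauss {γ : TrueMetric m M} {n c : ℕ} {φ : CornerChart m M n c}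
    (hφ : γ.IsNormalChart φ) {U : Set (Euc n × Euc c)} (hU : IsOpen U)
    (hUφ : U ⊆ (IQE n c).symm ⁻¹' φ.target)
    (hstar : ∀ u y, (u, y) ∈ U → ∀ t ∈ Icc (0 : ℝ) 1, (u, t • y) ∈ U)
    {u : Euc n} (hu : ∀ i, 0 ≤ u i) {y : Euc c} (hy : (u, y) ∈ U) (b : Euc n) (w : Euc c) :
    γ.coord φ (u, y) (0, y) (b, w) = inner ℝ y w := by
  have hmem : ∀ {u : Euc n} (hu : ∀ i, 0 ≤ u i) {y : Euc c}, (u, y) ∈ U →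
      ((⟨u, hu⟩, y) : EuclideanQuadrant n × Euc c) ∈ φ.target := fun hu y hy => by
    have := hUφ hy
    rwa [mem_preimage, IQE_symm_mk hu] at this
  refine gauss_lemma (A := {u : Euc n | ∀ i, 0 ≤ u i}) (G := γ.coordCLM φ)
    (uniqueDiffOn_quadrant n) hU (fun u _ => hstar u) (fun q v w => γ.symm _ _ _) ?_ ?_ ?_ hu hy b w
  · intro q hq
    have h1 : q ∈ range (IQE n c) := by rw [range_IQE]; exact hq.1
    have h2 := ((γ.contDiffOn_coordCLM φ).differentiableOn (by simp)) q ⟨h1, hUφ hq.2⟩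
    rw [← range_IQE]
    refine h2.mono_of_mem_nhdsWithin ?_
    exact inter_mem self_mem_nhdsWithin
      (mem_nhdsWithin_of_mem_nhds (mem_of_superset (hU.mem_nhds hq.2) hUφ))
  · intro u hu v t ht w
    have h1 := hφ.2 ⟨u, hu⟩ v t (hmem hu ht) w
    have h2 : ∀ s, deriv (fun s : ℝ => ((u, s • v) : Euc n × Euc c)) s = (0, v) := fun s => by
      have := ((hasDerivAt_const s u).prodMk ((hasDerivAt_id s).smul_const v)).deriv
      simpa using this
    simp only [h2] at h1
    rw [← range_IQE]
    exact h1
  · intro u hu h v b v'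
    exact hφ.1 ⟨u, hu⟩ (hmem hu h) b v v'

theorem TrueMetric.inner_congr (γ : TrueMetric m M) {x x' : M} (h : x = x') (v w : Euc m) :
    γ.inner x v w = γ.inner x' v w := by
  subst h
  rfl

theorem TrueMetric.abs_inner_le (γ : TrueMetric m M) (x : M) (v w : TangentSpace (IQ m) x) :
    |γ.inner x v w| ≤ √(γ.inner x v v) * √(γ.inner x w w) := by
  let : RiemannianBundle (fun x : M => TangentSpace (IQ m) x) := ⟨γ.toRiemannianMetric⟩
  have h := abs_real_inner_le_norm v w
  rw [norm_eq_sqrt_real_inner v, norm_eq_sqrt_real_inner w] at h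
  exact h

theorem PartialDiffeomorph.mfderiv_symm_mfderiv {E₁ H₁ M₁ E₂ H₂ M₂ : Type*}
    [NormedAddCommGroup E₁] [NormedSpace ℝ E₁] [TopologicalSpace H₁] [TopologicalSpace M₁]
    [ChartedSpace H₁ M₁] [NormedAddCommGroup E₂] [NormedSpace ℝ E₂] [TopologicalSpace H₂]
    [TopologicalSpace M₂] [ChartedSpace H₂ M₂] {I₁ : ModelWithCorners ℝ E₁ H₁}
    {I₂ : ModelWithCorners ℝ E₂ H₂}
    (φ : PartialDiffeomorph I₁ I₂ M₁ M₂ ∞) {x : M₁} (hx : x ∈ φ.source) (v : E₁) :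
    (show E₁ from mfderiv I₂ I₁ φ.symm (φ x) (show E₂ from mfderiv I₁ I₂ φ x v)) = v := by
  have h1 : MDifferentiableAt I₁ I₂ φ x := φ.mdifferentiableAt (by simp) hx
  have h2 : MDifferentiableAt I₂ I₁ φ.symm (φ x) :=
    φ.symm.mdifferentiableAt (by simp) (φ.map_source hx)
  have h3 : φ.symm ∘ φ =ᶠ[𝓝 x] id := by
    filter_upwards [φ.open_source.mem_nhds hx] with z hz using φ.left_inv hz
  have h4 := mfderiv_comp x h2 h1
  rw [h3.mfderiv_eq, mfderiv_id] at h4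
  exact (DFunLike.congr_fun h4 v).symm

/-- In a normal chart `(u, y)`, the gradient of `|y| ^ 2 / 2` is the radial vector field. -/
theorem TrueMetric.IsNormalChart.exists_radial {γ : TrueMetric m M} {n c : ℕ}
    {φ : CornerChart m M n c} (hφ : γ.IsNormalChart φ) {U : Set (Euc n × Euc c)} (hU : IsOpen U)
    (hUφ : U ⊆ (IQE n c).symm ⁻¹' φ.target)
    (hstar : ∀ u y, (u, y) ∈ U → ∀ t ∈ Icc (0 : ℝ) 1, (u, t • y) ∈ U)
    {x : M} (hx : x ∈ φ.source) (hxU : IQE n c (φ x) ∈ U) :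
    ∃ e : TangentSpace (IQ m) x, γ.inner x e e = ‖(φ x).2‖ ^ 2 ∧ ∀ v : TangentSpace (IQ m) x,
      letI w : Euc n × Euc c := mfderiv (IQ m) (IQE n c) φ x v
      γ.inner x e v = inner ℝ (φ x).2 w.2 := by
  have hux := (φ x).1.2
  have hq : IQE n c (φ x) = ((φ x).1.1, (φ x).2) := rfl
  have hxx : φ.symm (φ x) = x := φ.left_inv hx
  refine ⟨(show Euc m from mfderiv (IQE n c) (IQ m) φ.symm (φ x)
    ((0, (φ x).2) : Euc n × Euc c)), ?_, fun v => ?_⟩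
  · have h2 := hφ.gauss hU hUφ hstar hux (hq ▸ hxU) 0 (φ x).2
    rw [TrueMetric.coord, IQE_symm_mk hux, real_inner_self_eq_norm_sq] at h2
    exact (γ.inner_congr hxx _ _).symm.trans h2
  · let w : Euc n × Euc c := mfderiv (IQ m) (IQE n c) φ x v
    have h1 := hφ.gauss hU hUφ hstar hux (hq ▸ hxU) w.1 w.2
    rw [TrueMetric.coord, IQE_symm_mk hux] at h1
    refine Eq.trans ?_ ((γ.inner_congr hxx _ _).symm.trans h1)
    congr 1
    exact (φ.mfderiv_symm_mfderiv hx v).symm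

theorem TrueMetric.enorm_eq (γ : TrueMetric m M) (x : M) (v : TangentSpace (IQ m) x) :
    letI : RiemannianBundle (fun x : M => TangentSpace (IQ m) x) := ⟨γ.toRiemannianMetric⟩
    ‖v‖ₑ = ENNReal.ofReal √(γ.inner x v v) := by
  let : RiemannianBundle (fun x : M => TangentSpace (IQ m) x) := ⟨γ.toRiemannianMetric⟩
  have h : ‖v‖ = √(γ.inner x v v) := norm_eq_sqrt_real_inner v
  rw [← h, ofReal_norm]

/-- A regularisation of the norm: paths ending on the submanifold reach `y = 0`, where `‖y‖` is not
differentiable. -/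
theorem hasFDerivAt_sqrt_norm_sq_add {F : Type*} [NormedAddCommGroup F] [InnerProductSpace ℝ F]
    {ε : ℝ} (hε : 0 < ε) (y : F) :
    HasFDerivAt (fun y : F => √(‖y‖ ^ 2 + ε ^ 2)) ((√(‖y‖ ^ 2 + ε ^ 2))⁻¹ • innerSL ℝ y) y := by
  have h0 : ‖y‖ ^ 2 + ε ^ 2 ≠ 0 := by positivity
  have h1 := ((hasStrictFDerivAt_norm_sq y).hasFDerivAt.add_const (ε ^ 2)).sqrt h0
  refine h1.congr_fderiv ?_
  ext w
  simp
  field_simp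

/-- Paths inside a normal chart that end on the submanifold are at least as long as the normal
coordinate of the starting point. -/
theorem TrueMetric.IsNormalChart.norm_le_pathELength {γ : TrueMetric m M} {n c : ℕ}
    {φ : CornerChart m M n c} (hφ : γ.IsNormalChart φ) {U : Set (Euc n × Euc c)} (hU : IsOpen U)
    (hUφ : U ⊆ (IQE n c).symm ⁻¹' φ.target)
    (hstar : ∀ u y, (u, y) ∈ U → ∀ t ∈ Icc (0 : ℝ) 1, (u, t • y) ∈ U)
    {η : ℝ → M} (hη : ContMDiffOn 𝓘(ℝ, ℝ) (IQ m) 1 η (Icc 0 1))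
    (hm : ∀ t ∈ Icc (0 : ℝ) 1, η t ∈ φ.source ∧ IQE n c (φ (η t)) ∈ U)
    (h1 : (φ (η 1)).2 = 0) :
    letI : RiemannianBundle (fun x : M => TangentSpace (IQ m) x) := ⟨γ.toRiemannianMetric⟩
    ENNReal.ofReal ‖(φ (η 0)).2‖ ≤ pathELength (IQ m) η 0 1 := by
  let : RiemannianBundle (fun x : M => TangentSpace (IQ m) x) := ⟨γ.toRiemannianMetric⟩
  set V : Set M := φ.source ∩ φ ⁻¹' (IQE n c ⁻¹' U) with hVdef
  have hV : IsOpen V := φ.toOpenPartialHomeomorph.continuousOn.isOpen_inter_preimage φ.open_source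
    (hU.preimage (IQE n c).continuous)
  -- With `k = √(|y|² + ε²)` and `e` the radial field, the derivative of `k` along `v` is `⟨e, v⟩ /
  -- k`. Cauchy–Schwarz bounds it by `|y| |v| / k ≤ |v|`. At the end of the path `k = ε`, which is
  -- the loss in the estimate.
  have key : ∀ ε : ℝ, 0 < ε → ENNReal.ofReal (‖(φ (η 0)).2‖ - ε) ≤ pathELength (IQ m) η 0 1 := by
    intro ε hε
    set k : Euc c → ℝ := fun y => √(‖y‖ ^ 2 + ε ^ 2) with hk
    have hkc : ContDiff ℝ 1 k := by
      refine ContDiff.sqrt ((contDiff_norm_sq ℝ).add contDiff_const) fun y => ?_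
      positivity
    have hh : ContMDiffOn (IQ m) 𝓘(ℝ, ℝ) 1 (fun x => k (φ x).2) V :=
      (hkc.contMDiff.comp ((contMDiff_snd_model).of_le (by simp))).comp_contMDiffOn
        ((φ.contMDiffOn.of_le (by simp)).mono inter_subset_left)
    have hle : ∀ x ∈ V, ∀ v : TangentSpace (IQ m) x,
      letI w : ℝ := mfderiv (IQ m) 𝓘(ℝ, ℝ) (fun x => k (φ x).2) x v; ‖w‖ₑ ≤ ‖v‖ₑ := by
      intro x hx v
      obtain ⟨e, he1, he2⟩ := hφ.exists_radial hU hUφ hstar hx.1 hx.2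
      let w : Euc n × Euc c := mfderiv (IQ m) (IQE n c) φ x v
      have hd : HasMFDerivAt (IQ m) 𝓘(ℝ, ℝ) (fun x => k (φ x).2) x _ :=
        ((hasFDerivAt_sqrt_norm_sq_add hε (φ x).2).hasMFDerivAt.comp (φ x)
          (hasMFDerivAt_snd_model (φ x))).comp x (φ.mdifferentiableAt (by simp) hx.1).hasMFDerivAt
      have hd2 : (mfderiv (IQ m) 𝓘(ℝ, ℝ) (fun x => k (φ x).2) x v : ℝ)
          = (k (φ x).2)⁻¹ * inner ℝ (φ x).2 w.2 := by
        rw [hd.mfderiv]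
        rfl
      rw [hd2, γ.enorm_eq, ← he2 v, ← ofReal_norm, Real.norm_eq_abs]
      refine ENNReal.ofReal_le_ofReal ?_
      have h3 := γ.abs_inner_le x e v
      rw [he1, Real.sqrt_sq (norm_nonneg _)] at h3
      have hkpos : 0 < k (φ x).2 := by positivity
      have hkge : ‖(φ x).2‖ ≤ k (φ x).2 := Real.le_sqrt_of_sq_le (by nlinarith)
      rw [abs_mul, abs_of_pos (inv_pos.2 hkpos), inv_mul_le_iff₀ hkpos]
      exact h3.trans (mul_le_mul_of_nonneg_right hkge (Real.sqrt_nonneg _))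
    have h2 := enorm_sub_le_pathELength hV hh hle hη hm
    refine le_trans ?_ h2
    rw [← ofReal_norm, Real.norm_eq_abs, abs_sub_comm]
    refine ENNReal.ofReal_le_ofReal (le_trans ?_ (le_abs_self _))
    have h4 : k (φ (η 1)).2 = ε := by
      simp only [hk, h1]
      simp [Real.sqrt_sq hε.le]
    have hkge : ‖(φ (η 0)).2‖ ≤ k (φ (η 0)).2 := Real.le_sqrt_of_sq_le (by nlinarith)
    linarith
  have hlim : Tendsto (fun ε : ℝ => ENNReal.ofReal (‖(φ (η 0)).2‖ - ε)) (𝓝[>] 0)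
      (𝓝 (ENNReal.ofReal (‖(φ (η 0)).2‖ - 0))) :=
    ((ENNReal.continuous_ofReal.comp (continuous_const.sub continuous_id)).tendsto 0).mono_left
      nhdsWithin_le_nhds
  rw [sub_zero] at hlim
  exact le_of_tendsto hlim (eventually_mem_nhdsWithin.mono fun ε hε => key ε hε)

/-- The ray `t ↦ (u, t y)` joins `X` to `x`, and by the Gauss lemma it has constant speed `|y|`. -/
theorem TrueMetric.IsNormalChart.distTo_le {γ : TrueMetric m M} {n c : ℕ}
    {φ : CornerChart m M n c} (hφ : γ.IsNormalChart φ) {U : Set (Euc n × Euc c)} (hU : IsOpen U)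
    (hUφ : U ⊆ (IQE n c).symm ⁻¹' φ.target)
    (hstar : ∀ u y, (u, y) ∈ U → ∀ t ∈ Icc (0 : ℝ) 1, (u, t • y) ∈ U)
    {X : Set M} (hX : IsAdaptedChart X φ)
    {x : M} (hx : x ∈ φ.source) (hxU : IQE n c (φ x) ∈ U) :
    γ.distTo X x ≤ ENNReal.ofReal ‖(φ x).2‖ := by
  let : RiemannianBundle (fun x : M => TangentSpace (IQ m) x) := ⟨γ.toRiemannianMetric⟩
  set u := (φ x).1 with hu
  set y := (φ x).2 with hy
  have hxU' : (u.1, y) ∈ U := hxU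
  have hT : ∀ t ∈ Icc (0 : ℝ) 1, ((u, t • y) : EuclideanQuadrant n × Euc c) ∈ φ.target := by
    intro t ht
    have := hUφ (hstar u.1 y hxU' t ht)
    rwa [mem_preimage, IQE_symm_mk u.2] at this
  set a : ℝ → EuclideanQuadrant n × Euc c := fun t => (u, t • y) with ha
  have hac : ContMDiff 𝓘(ℝ, ℝ) (IQE n c) ∞ a := contMDiffOn_univ.1
    (contMDiffOn_const.prodMk_model (contMDiff_id.smul contMDiff_const).contMDiffOn)
  set η : ℝ → M := fun t => φ.symm (a t) with hη
  have hηc : ContMDiffOn 𝓘(ℝ, ℝ) (IQ m) 1 η (Icc 0 1) :=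
    (φ.symm.contMDiffOn.comp hac.contMDiffOn fun t ht => hT t ht).of_le (by exact_mod_cast le_top)
  have h1 : η 1 = x := by
    simp only [hη, ha, one_smul]
    exact φ.left_inv hx
  have h0 : η 0 ∈ X := by
    have h2 : a 0 ∈ φ.target := hT 0 (by simp)
    have h3 : φ.symm (a 0) ∈ φ.source := φ.map_target h2
    rw [hX _ h3]
    have : φ (φ.symm (a 0)) = a 0 := φ.right_inv h2
    rw [this]
    simp [ha]
  have hlen : pathELength (IQ m) η 0 1 ≤ ENNReal.ofReal ‖y‖ := by
    rw [pathELength_eq_lintegral_mfderiv_Ioo]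
    -- The Gauss lemma at `(u, t y)` computes the norm of `t y`, not of the velocity `y`; on the
    -- open interval the factor `t²` can be cancelled.
    have hle : ∀ t ∈ Ioo (0 : ℝ) 1,
        ‖(mfderiv 𝓘(ℝ, ℝ) (IQ m) η t (1 : ℝ) : TangentSpace (IQ m) (η t))‖ₑ
          ≤ ENNReal.ofReal ‖y‖ := by
      intro t ht
      have ht' : t ∈ Icc (0 : ℝ) 1 := Ioo_subset_Icc_self ht
      have hd1 : HasMFDerivAt 𝓘(ℝ, ℝ) (IQ m) η t _ :=
        (φ.symm.mdifferentiableAt (by simp) (hT t ht')).hasMFDerivAt.comp t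
          (hac.mdifferentiableAt (by simp) (x := t)).hasMFDerivAt
      have hd2 : HasMFDerivAt 𝓘(ℝ, ℝ) (IQE n c) a t _ :=
        (hasMFDerivAt_const u t).prodMk_model
          (((hasDerivAt_id t).smul_const y).hasFDerivAt.hasMFDerivAt)
      have hval : mfderiv 𝓘(ℝ, ℝ) (IQE n c) a t (1 : ℝ) = ((0, y) : Euc n × Euc c) := by
        rw [hd2.mfderiv]
        refine Prod.ext rfl ?_
        change (1 : ℝ) • ((1 : ℝ) • y) = y
        simp
      rw [γ.enorm_eq]
      refine ENNReal.ofReal_le_ofReal (le_of_eq ?_)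
      have hg := hφ.gauss hU hUφ hstar u.2 (hstar u.1 y hxU' t ht') 0 (t • y)
      rw [TrueMetric.coord, IQE_symm_mk u.2] at hg
      set w : Euc m := mfderiv (IQE n c) (IQ m) φ.symm (a t) ((0, y) : Euc n × Euc c) with hw
      have hw2 : (show Euc m from mfderiv (IQE n c) (IQ m) φ.symm (a t)
          ((0, t • y) : Euc n × Euc c)) = t • w := by
        rw [show ((0, t • y) : Euc n × Euc c) = t • (0, y) by simp]
        exact map_smul (mfderiv (IQE n c) (IQ m) φ.symm (a t)) t ((0, y) : Euc n × Euc c)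
      have hw3 : (show Euc m from mfderiv 𝓘(ℝ, ℝ) (IQ m) η t (1 : ℝ)) = w := by
        rw [hd1.mfderiv, hw, ← hval]
        rfl
      have hg2 : γ.inner (η t) (show Euc m from t • w) (show Euc m from t • w)
          = inner ℝ (t • y) (t • y) := by
        rw [← hw2]
        exact hg
      have hg3 : γ.inner (η t) (show Euc m from t • w) (show Euc m from t • w)
          = t * (t * γ.inner (η t) w w) := by
        refine (congrArg (fun L : TangentSpace (IQ m) (η t) →L[ℝ] ℝ => L (t • w))
          (map_smul (γ.inner (η t)) t w)).trans ?_
        exact congrArg (t * ·) (map_smul (γ.inner (η t) w) t w)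
      have hg4 : γ.inner (η t) w w = ‖y‖ ^ 2 := by
        rw [hg3, real_inner_self_eq_norm_sq, norm_smul, mul_pow, Real.norm_eq_abs, sq_abs] at hg2
        have ht2 : t ≠ 0 := ht.1.ne'
        field_simp at hg2
        exact hg2
      refine Eq.trans ?_ (Real.sqrt_sq (norm_nonneg y))
      rw [← hg4]
      congr 1
      exact congrArg (fun z : Euc m => γ.inner (η t) z z) hw3
    refine (MeasureTheory.setLIntegral_mono' measurableSet_Ioo hle).trans ?_
    simp
  have h3 : riemannianEDist (IQ m) x (η 0) ≤ ENNReal.ofReal ‖y‖ := by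
    rw [riemannianEDist_comm]
    exact (riemannianEDist_le_pathELength hηc rfl h1 zero_le_one).trans hlen
  exact (iInf₂_le (η 0) h0).trans h3

/-- Near a point of `X`, the distance to `X` is the length of the normal coordinate. -/
theorem TrueMetric.IsNormalChart.eventually_distTo_eq [T2Space M] {γ : TrueMetric m M} {n c : ℕ}
    {φ : CornerChart m M n c} (hφ : γ.IsNormalChart φ) {X : Set M} (hX : IsAdaptedChart X φ)
    {x₀ : M} (hx₀ : x₀ ∈ φ.source) (hx₀X : x₀ ∈ X) :
    ∀ᶠ x in 𝓝 x₀, γ.distTo X x = ENNReal.ofReal ‖(φ x).2‖ := by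
  let : RiemannianBundle (fun x : M => TangentSpace (IQ m) x) := ⟨γ.toRiemannianMetric⟩
  have hy0 : (φ x₀).2 = 0 := (hX _ hx₀).1 hx₀X
  obtain ⟨δ, hδ, hball⟩ : ∃ δ > 0, Metric.ball (φ x₀).1.1 δ ×ˢ Metric.ball (0 : Euc c) δ ⊆
      (IQE n c).symm ⁻¹' φ.target := by
    have ho : IsOpen ((IQE n c).symm ⁻¹' φ.target) :=
      φ.open_target.preimage (IQE n c).continuous_symm
    have hm : ((φ x₀).1.1, (0 : Euc c)) ∈ (IQE n c).symm ⁻¹' φ.target := by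
      rw [mem_preimage, IQE_symm_mk (φ x₀).1.2, ← hy0]
      exact φ.map_source hx₀
    obtain ⟨δ, hδ, h⟩ := Metric.isOpen_iff.1 ho _ hm
    exact ⟨δ, hδ, by rwa [ball_prod_same]⟩
  set U := Metric.ball (φ x₀).1.1 δ ×ˢ Metric.ball (0 : Euc c) δ with hUdef
  have hU : IsOpen U := Metric.isOpen_ball.prod Metric.isOpen_ball
  have hstar : ∀ u y, (u, y) ∈ U → ∀ t ∈ Icc (0 : ℝ) 1, (u, t • y) ∈ U := by
    rintro u y ⟨h1, h2⟩ t ht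
    refine ⟨h1, ?_⟩
    simp only [Metric.mem_ball, dist_zero_right, norm_smul, Real.norm_eq_abs,
      abs_of_nonneg ht.1] at h2 ⊢
    nlinarith [norm_nonneg y, ht.2]
  have hVn : φ.source ∩ φ ⁻¹' (IQE n c ⁻¹' U) ∈ 𝓝 x₀ := by
    have hV := φ.toOpenPartialHomeomorph.continuousOn.isOpen_inter_preimage φ.open_source
      (hU.preimage (IQE n c).continuous)
    refine hV.mem_nhds ⟨hx₀, ?_⟩
    refine ⟨Metric.mem_ball_self hδ, ?_⟩
    change (φ x₀).2 ∈ _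
    rw [hy0]
    exact Metric.mem_ball_self hδ
  have : LocallyCompactSpace M := Manifold.locallyCompact_of_finiteDimensional (IQ m)
  have : IsContinuousRiemannianBundle (Euc m) (fun x : M => TangentSpace (IQ m) x) :=
    ⟨⟨γ.inner, γ.contMDiff.continuous, fun x v w => rfl⟩⟩
  obtain ⟨C, hC, hCV⟩ := setOfPred_riemannianEDist_lt_subset_nhds (IQ m) hVn
  -- A path that starts within `C / 2` of `x₀` and is shorter than `C / 2` stays in the ball of
  -- radius `C`, hence in the chart, where `norm_le_pathELength` applies.
  have hC2 : (0 : ENNReal) < (C : ENNReal) / 2 := ENNReal.half_pos (by exact_mod_cast hC.ne')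
  have hN : ∀ᶠ x in 𝓝 x₀, ENNReal.ofReal ‖(φ x).2‖ < (C : ENNReal) / 2 := by
    have hcont : ContinuousAt (fun x => ENNReal.ofReal ‖(φ x).2‖) x₀ :=
      ENNReal.continuous_ofReal.continuousAt.comp
        (continuous_norm.continuousAt.comp (continuous_snd.continuousAt.comp
          (φ.toOpenPartialHomeomorph.continuousAt hx₀)))
    refine hcont.eventually_lt_const ?_
    simpa [hy0] using hC2
  filter_upwards [hN, hVn, eventually_riemannianEDist_lt (IQ m) x₀ hC2] with x hx1 hx2 hx3
  refine le_antisymm (hφ.distTo_le hU hball hstar hX hx2.1 hx2.2) ?_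
  refine le_iInf₂ fun z hz => ?_
  by_contra! hlt
  obtain ⟨η, h0, h1, hηc, hlen⟩ := exists_lt_of_riemannianEDist_lt hlt
  have hmem : ∀ t ∈ Icc (0 : ℝ) 1, η t ∈ φ.source ∩ φ ⁻¹' (IQE n c ⁻¹' U) := by
    intro t ht
    refine hCV ?_
    have h4 : riemannianEDist (IQ m) x (η t) ≤ pathELength (IQ m) η 0 1 :=
      (riemannianEDist_le_pathELength (hηc.mono (Icc_subset_Icc_right ht.2)) h0 rfl ht.1).trans
        (pathELength_mono le_rfl ht.2)
    calc riemannianEDist (IQ m) x₀ (η t) ≤ _ + _ := riemannianEDist_triangle (y := x)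
      _ < (C : ENNReal) / 2 + (C : ENNReal) / 2 :=
        ENNReal.add_lt_add hx3 (h4.trans_lt (hlen.trans hx1))
      _ = C := ENNReal.add_halves _
  have h5 := hφ.norm_le_pathELength hU hball hstar hηc hmem
    ((hX _ (hmem 1 (by simp)).1).1 (h1 ▸ hz))
  rw [h0] at h5
  exact absurd hlen (not_lt.2 h5)

end NormalDistance

/-! ### The blow-down map of one blow-up -/

section BlowdownMap

open Set Filter Bundle Manifold Topology

theorem contMDiff_quadrant_coord (n : ℕ) (i : Fin n) :
    ContMDiff (IQ n) 𝓘(ℝ, ℝ) ∞ (fun u : EuclideanQuadrant n => u.1 i) :=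
  ((EuclideanSpace.proj i : Euc n →L[ℝ] ℝ).contDiff.contMDiff).comp (IQ n).contMDiff

theorem contMDiff_blowModel_fst (n c : ℕ) :
    ContMDiff (IBlow n c) (IQ n) ∞ (fun b : BlowModel n c => b.1) :=
  contMDiff_fst

theorem contMDiff_blowModel_sphere (n c : ℕ) :
    ContMDiff (IBlow n c) 𝓘(ℝ, Euc (c + 1)) ∞ (fun b : BlowModel n c => (b.2.1 : Euc (c + 1))) := by
  have : Fact (Module.finrank ℝ (Euc (c + 1)) = c + 1) := ⟨finrank_euclideanSpace_fin⟩
  have h : ContMDiff (𝓡 c) 𝓘(ℝ, Euc (c + 1)) ∞ (fun z : USphere c => (z : Euc (c + 1))) :=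
    contMDiff_coe_sphere
  exact h.comp (contMDiff_fst.comp contMDiff_snd)

theorem contMDiff_blowModel_radius (n c : ℕ) :
    ContMDiff (IBlow n c) 𝓘(ℝ, ℝ) ∞ (fun b : BlowModel n c => b.2.2.1 0) :=
  (contMDiff_quadrant_coord 1 0).comp (contMDiff_snd.comp contMDiff_snd)

theorem contMDiff_blowModelDown (n c : ℕ) :
    ContMDiff (IBlow n c) (IQE n (c + 1)) ∞ (blowModelDown (n := n) (c := c)) :=
  contMDiffOn_univ.1 ((contMDiff_blowModel_fst n c).contMDiffOn.prodMk_model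
    ((contMDiff_blowModel_radius n c).smul (contMDiff_blowModel_sphere n c)).contMDiffOn)

theorem isClosed_setOf_forall_nonneg (n : ℕ) : IsClosed {x : Euc n | ∀ i, 0 ≤ x i} := by
  rw [show {x : Euc n | ∀ i, 0 ≤ x i} = ⋂ i, {x : Euc n | 0 ≤ x i} by ext; simp]
  exact isClosed_iInter fun i =>
    isClosed_le continuous_const (EuclideanSpace.proj i : Euc n →L[ℝ] ℝ).continuous

theorem isClosedEmbedding_quadrant (n : ℕ) :
    IsClosedEmbedding (Subtype.val : EuclideanQuadrant n → Euc n) :=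
  IsClosed.isClosedEmbedding_subtypeVal (isClosed_setOf_forall_nonneg n)

instance t2Space_quadrant (n : ℕ) : T2Space (EuclideanQuadrant n) := (isClosedEmbedding_quadrant n).isEmbedding.t2Space

/-- The model blow-down map is proper. -/
theorem isCompact_preimage_blowModelDown {n c : ℕ} {K : Set (EuclideanQuadrant n × Euc (c + 1))}
    (hK : IsCompact K) : IsCompact (blowModelDown (c := c) ⁻¹' K) := by
  obtain ⟨R, hR⟩ := (hK.image continuous_snd).isBounded.exists_norm_le
  have hS : IsCompact {s : EuclideanQuadrant 1 | s.1 0 ≤ R} := by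
    refine ((isClosedEmbedding_quadrant 1).isCompact_preimage
      (isCompact_closedBall (0 : Euc 1) |R|)).of_isClosed_subset
      (isClosed_le (contMDiff_quadrant_coord 1 0).continuous continuous_const) fun s hs => ?_
    have h0 : 0 ≤ s.1 0 := s.2 0
    rw [mem_preimage, mem_closedBall_zero_iff, EuclideanSpace.norm_eq]
    simp only [Finset.univ_unique, Fin.default_eq_zero, Finset.sum_singleton]
    rw [Real.sqrt_sq (norm_nonneg _), Real.norm_eq_abs]
    exact abs_le_abs_of_nonneg h0 hs
  have hall : IsCompact ((Prod.fst '' K) ×ˢ ((univ : Set (USphere c)) ×ˢ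
      {s : EuclideanQuadrant 1 | s.1 0 ≤ R})) :=
    (hK.image continuous_fst).prod (isCompact_univ.prod hS)
  refine hall.of_isClosed_subset
    (hK.isClosed.preimage (contMDiff_blowModelDown n c).continuous) fun b hb => ?_
  refine ⟨⟨_, hb, rfl⟩, mem_univ _, ?_⟩
  have h1 := hR _ ⟨_, hb, rfl⟩
  have h0 : 0 ≤ b.2.2.1 0 := b.2.2.2 0
  have h2 : ‖(b.2.1 : Euc (c + 1))‖ = 1 := by simp
  simp only [blowModelDown, norm_smul, h2, mul_one, Real.norm_eq_abs, abs_of_nonneg h0] at h1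
  exact h1

theorem radius_pos_of_isInteriorPoint {n c : ℕ} {b : BlowModel n c}
    (hb : (IBlow n c).IsInteriorPoint b) : 0 < b.2.2.1 0 := by
  have h1 : b ∈ (IBlow n c).interior (BlowModel n c) := hb
  rw [ModelWithCorners.interior_prod, ModelWithCorners.interior_prod] at h1
  have h2 : (IQ 1).IsInteriorPoint b.2.2 := h1.2.2
  have h3 : b.2.2.1 ∈ interior (range (IQ 1)) := h2
  have h4 : range (IQ 1) = {y : Euc 1 | ∀ i, 0 ≤ y i} := range_euclideanQuadrant 1
  rw [h4, interior_euclideanQuadrant] at h3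
  exact h3 0

variable {m : ℕ} {M P : Type*} [TopologicalSpace M] [ChartedSpace (EuclideanQuadrant m) M]
  [TopologicalSpace P] [ChartedSpace (EuclideanQuadrant m) P] {X : Set M} {β : P → M}

theorem IsBlowup.isLocalDiffeomorphAt (hβ : IsBlowup m X β) {p : P} (hp : β p ∉ X) :
    IsLocalDiffeomorphAt (IQ m) (IQ m) ∞ β p := by
  obtain ⟨Φ, h1, -, h3⟩ := hβ.away
  exact ⟨Φ, by rw [h1]; exact hp, fun q hq => (h3 q hq).symm⟩

theorem IsBlowup.contMDiff (hβ : IsBlowup m X β) : ContMDiff (IQ m) (IQ m) ∞ β := by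
  intro p
  by_cases hp : β p ∈ X
  · obtain ⟨n, c, φ, hx, -, Ψ, h1, h2, h3⟩ := hβ.near _ hp
    have hpΨ : p ∈ Ψ.source := by rw [h1]; exact hx
    have hm : ∀ q ∈ Ψ.source, blowModelDown (Ψ q) ∈ φ.target := fun q hq => by
      rw [← h3 q hq]
      exact φ.map_source (by rw [h1] at hq; exact hq)
    have h4 : ContMDiffOn (IQ m) (IQ m) ∞ (fun q => φ.symm (blowModelDown (Ψ q))) Ψ.source :=
      φ.symm.contMDiffOn.comp ((contMDiff_blowModelDown n c).comp_contMDiffOn Ψ.contMDiffOn) hm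
    refine (h4.contMDiffAt (Ψ.open_source.mem_nhds hpΨ)).congr_of_eventuallyEq ?_
    filter_upwards [Ψ.open_source.mem_nhds hpΨ] with q hq
    rw [← h3 q hq]
    exact (φ.left_inv (by rw [h1] at hq; exact hq)).symm
  · exact (hβ.isLocalDiffeomorphAt hp).contMDiffAt

/-- Every point of `M` has a neighbourhood with compact preimage: near `X` because the model
blow-down map is proper, elsewhere because `β` is a diffeomorphism there. -/
theorem IsBlowup.compactSpace [T2Space M] [CompactSpace M] (hβ : IsBlowup m X β) :
    CompactSpace P := by
  have : LocallyCompactSpace M := Manifold.locallyCompact_of_finiteDimensional (IQ m)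
  have hcont : Continuous β := hβ.contMDiff.continuous
  have key : ∀ x : M, ∃ K ∈ 𝓝 x, IsCompact (β ⁻¹' K) := by
    intro x
    by_cases hx : x ∈ X
    · obtain ⟨n, c, φ, hx, -, Ψ, h1, h2, h3⟩ := hβ.near _ hx
      obtain ⟨K, hK, hKφ, hKc⟩ := local_compact_nhds (φ.open_source.mem_nhds hx)
      refine ⟨K, hK, ?_⟩
      have h4 : IsCompact (φ '' K) :=
        hKc.image_of_continuousOn (φ.toOpenPartialHomeomorph.continuousOn.mono hKφ)
      have h5 := isCompact_preimage_blowModelDown h4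
      have h6 : blowModelDown (c := c) ⁻¹' (φ '' K) ⊆ Ψ.target := by
        rw [h2]
        refine preimage_mono ?_
        rintro _ ⟨z, hz, rfl⟩
        exact φ.map_source (hKφ hz)
      refine (h5.image_of_continuousOn
        (Ψ.toOpenPartialHomeomorph.continuousOn_symm.mono h6)).of_isClosed_subset
        (hKc.isClosed.preimage hcont) ?_
      intro p hp
      have hpΨ : p ∈ Ψ.source := by rw [h1]; exact hKφ hp
      refine ⟨Ψ p, ?_, Ψ.left_inv hpΨ⟩
      rw [mem_preimage, ← h3 p hpΨ]
      exact mem_image_of_mem _ hp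
    · obtain ⟨Φ, h1, h2, h3⟩ := hβ.away
      obtain ⟨K, hK, hKφ, hKc⟩ := local_compact_nhds (hβ.isClosed.isOpen_compl.mem_nhds hx)
      refine ⟨K, hK, ?_⟩
      refine (hKc.image_of_continuousOn
        (Φ.toOpenPartialHomeomorph.continuousOn_symm.mono (h2 ▸ hKφ))).of_isClosed_subset
        (hKc.isClosed.preimage hcont) ?_
      intro p hp
      have hpΨ : p ∈ Φ.source := by rw [h1]; exact hKφ hp
      refine ⟨β p, hp, ?_⟩
      rw [← h3 p hpΨ]
      exact Φ.left_inv hpΨ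
  choose K hK hKc using key
  obtain ⟨t, ht⟩ := CompactSpace.elim_nhds_subcover K hK
  refine ⟨?_⟩
  have : (univ : Set P) = ⋃ x ∈ t, β ⁻¹' K x := by
    rw [← preimage_iUnion₂, ht]
    simp
  rw [this]
  exact t.isCompact_biUnion fun x _ => hKc x

/-- Over `X` the product `s z` vanishes with `|z| = 1`, so `s = 0` and the point lies on the front
face, which belongs to the boundary. Density of the complement of the front face follows. -/
theorem IsBlowup.notMem_of_isInteriorPoint (hβ : IsBlowup m X β) {p : P}
    (hp : (IQ m).IsInteriorPoint p) : β p ∉ X := by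
  intro hx
  obtain ⟨n, c, φ, hx', hφ, Ψ, h1, h2, h3⟩ := hβ.near _ hx
  have hpΨ : p ∈ Ψ.source := by rw [h1]; exact hx'
  have h4 : (IBlow n c).IsInteriorPoint (Ψ p) :=
    ((Ψ.isLocalDiffeomorphAt _ _ _ hpΨ).isInteriorPoint_iff (by simp)).1 hp
  have h5 := radius_pos_of_isInteriorPoint h4
  have h6 := (hφ _ hx').1 hx
  rw [h3 p hpΨ] at h6
  rcases smul_eq_zero.1 h6 with h7 | h7
  · exact h5.ne' h7
  · have h8 : ‖((Ψ p).2.1 : Euc (c + 1))‖ = 1 := by simp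
    rw [h7] at h8
    simp at h8

theorem IsBlowup.isInteriorPoint_iff (hβ : IsBlowup m X β) {p : P} (hp : β p ∉ X) :
    (IQ m).IsInteriorPoint p ↔ (IQ m).IsInteriorPoint (β p) :=
  (hβ.isLocalDiffeomorphAt hp).isInteriorPoint_iff (by simp)

theorem IsBlowup.dense [IsManifold (IQ m) ∞ P] (hβ : IsBlowup m X β) : Dense (β ⁻¹' Xᶜ) :=
  dense_interior_quadrant.mono fun _ hp => hβ.notMem_of_isInteriorPoint hp

end BlowdownMap

/-! ### The smoothed distance function on the blow-up -/

section BlowupDistance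

open Set Filter Bundle Manifold Topology

variable {m : ℕ} {M P : Type*} [TopologicalSpace M] [ChartedSpace (EuclideanQuadrant m) M]

theorem contMDiffOn_chart_snd {n c : ℕ} (φ : CornerChart m M n c) :
    ContMDiffOn (IQ m) 𝓘(ℝ, Euc c) ∞ (fun x => (φ x).2) φ.source :=
  (contMDiff_snd_model (I₁ := IQ n) (I₂ := 𝓘(ℝ, Euc c))).comp_contMDiffOn φ.contMDiffOn

/-- The normal coordinates of two adapted charts differ by a linear map that depends smoothly on
the point. -/
theorem exists_normal_transition {X : Set M} {n c n' c' : ℕ} {φ : CornerChart m M n c}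
    {φ' : CornerChart m M n' c'} (hφ : IsAdaptedChart X φ) (hφ' : IsAdaptedChart X φ') {x : M}
    (hx : x ∈ φ.source) (hx' : x ∈ φ'.source) (hxX : x ∈ X) :
    ∃ V : Set M, IsOpen V ∧ x ∈ V ∧ V ⊆ φ.source ∩ φ'.source ∧ ∃ Λ : M → Euc c' →L[ℝ] Euc c,
      ContMDiffOn (IQ m) 𝓘(ℝ, Euc c' →L[ℝ] Euc c) ∞ Λ V ∧
        ∀ z ∈ V, (φ z).2 = Λ z (φ' z).2 := by
  have hy0 : (φ' x).2 = 0 := (hφ' _ hx').1 hxX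
  set T : Set (EuclideanQuadrant n' × Euc c') := φ'.target ∩ φ'.symm ⁻¹' φ.source with hT
  have hTo : IsOpen T := φ'.toOpenPartialHomeomorph.symm.continuousOn.isOpen_inter_preimage
    φ'.open_target φ.open_source
  have hxT : φ' x ∈ T := ⟨φ'.map_source hx', by
    have : φ'.symm (φ' x) = x := φ'.left_inv hx'
    rwa [mem_preimage, this]⟩
  obtain ⟨δ, hδ, hball⟩ : ∃ δ > 0, Metric.ball (φ' x).1.1 δ ×ˢ Metric.ball (0 : Euc c') δ ⊆
      (IQE n' c').symm ⁻¹' T := by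
    have ho : IsOpen ((IQE n' c').symm ⁻¹' T) := hTo.preimage (IQE n' c').continuous_symm
    have hm : ((φ' x).1.1, (0 : Euc c')) ∈ (IQE n' c').symm ⁻¹' T := by
      rw [mem_preimage, IQE_symm_mk (φ' x).1.2, ← hy0]
      exact hxT
    obtain ⟨δ, hδ, h⟩ := Metric.isOpen_iff.1 ho _ hm
    exact ⟨δ, hδ, by rwa [ball_prod_same]⟩
  set A : Set (Euc n') := {u | ∀ i, 0 ≤ u i} ∩ Metric.ball (φ' x).1.1 δ with hA
  have hAc : Convex ℝ A := (convex_quadrant n').inter (convex_ball _ _)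
  have hAu : UniqueDiffOn ℝ A := (uniqueDiffOn_quadrant n').inter Metric.isOpen_ball
  -- The normal coordinate of `φ` read in the chart `φ'`. Since both charts are adapted to `X`, it
  -- vanishes for `y' = 0`, so Hadamard's lemma applies on the convex set `A × ball`.
  set F : Euc n' × Euc c' → Euc c := fun q => (φ (φ'.symm ((IQE n' c').symm q))).2 with hF
  have hmem : ∀ q ∈ A ×ˢ Metric.ball (0 : Euc c') δ, (IQE n' c').symm q ∈ T :=
    fun q hq => hball ⟨hq.1.2, hq.2⟩
  have hFs : ContDiffOn ℝ ∞ F (A ×ˢ Metric.ball 0 δ) := by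
    have h1 : ContMDiffOn (IQE n' c') 𝓘(ℝ, Euc c) ∞ (fun p => (φ (φ'.symm p)).2) T :=
      (contMDiffOn_chart_snd φ).comp (φ'.symm.contMDiffOn.mono inter_subset_left) fun p hp => hp.2
    refine (h1.comp ((IQE n' c').contMDiffOn_symm.mono ?_) hmem).contDiffOn
    rw [range_IQE]
    exact fun q hq => ⟨hq.1.1, mem_univ _⟩
  have hF0 : ∀ a ∈ A, F (a, 0) = 0 := by
    intro a ha
    have h1 := hmem (a, 0) ⟨ha, Metric.mem_ball_self hδ⟩
    rw [IQE_symm_mk ha.1] at h1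
    have h2 : φ' (φ'.symm (⟨a, ha.1⟩, 0)) = (⟨a, ha.1⟩, 0) := φ'.right_inv h1.1
    have h3 : φ'.symm (⟨a, ha.1⟩, 0) ∈ X :=
      (hφ' _ (φ'.map_target h1.1)).2 (congrArg Prod.snd h2)
    have h4 := (hφ _ h1.2).1 h3
    simp only [hF]
    rw [IQE_symm_mk ha.1]
    exact h4
  obtain ⟨L, hL, hFL⟩ := exists_contDiffOn_clm_apply_eq hAc hAu hFs hF0
  set U := Metric.ball (φ' x).1.1 δ ×ˢ Metric.ball (0 : Euc c') δ with hUdef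
  have hU : IsOpen U := Metric.isOpen_ball.prod Metric.isOpen_ball
  have hq : ∀ z ∈ φ'.source ∩ φ' ⁻¹' (IQE n' c' ⁻¹' U),
      IQE n' c' (φ' z) ∈ A ×ˢ Metric.ball (0 : Euc c') δ := fun z hz =>
    ⟨⟨(φ' z).1.2, hz.2.1⟩, hz.2.2⟩
  refine ⟨φ'.source ∩ φ' ⁻¹' (IQE n' c' ⁻¹' U),
    φ'.toOpenPartialHomeomorph.continuousOn.isOpen_inter_preimage φ'.open_source
      (hU.preimage (IQE n' c').continuous), ⟨hx', Metric.mem_ball_self hδ, ?_⟩, ?_,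
    fun z => L (IQE n' c' (φ' z)), ?_, ?_⟩
  · change (φ' x).2 ∈ _
    rw [hy0]
    exact Metric.mem_ball_self hδ
  · intro z hz
    refine ⟨?_, hz.1⟩
    have h1 := hmem _ (hq z hz)
    rw [(IQE n' c').left_inv] at h1
    have h2 : φ'.symm (φ' z) = z := φ'.left_inv hz.1
    have h3 := h1.2
    rwa [mem_preimage, h2] at h3
  · exact hL.contMDiffOn.comp ((IQE n' c').contMDiff.comp_contMDiffOn
      (φ'.contMDiffOn.mono inter_subset_left)) hq
  · intro z hz
    have h1 := hFL _ (hq z hz)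
    simp only [hF] at h1
    rw [(IQE n' c').left_inv] at h1
    have h2 : φ'.symm (φ' z) = z := φ'.left_inv hz.1
    rw [h2] at h1
    exact h1

theorem hasFDerivAt_norm_of_ne_zero {F : Type*} [NormedAddCommGroup F] [InnerProductSpace ℝ F]
    {y : F} (hy : y ≠ 0) : HasFDerivAt (fun y : F => ‖y‖) (‖y‖⁻¹ • innerSL ℝ y) y := by
  have h0 : ‖y‖ ^ 2 ≠ 0 := by positivity
  have h1 := (hasStrictFDerivAt_norm_sq y).hasFDerivAt.sqrt h0
  simp only [Real.sqrt_sq (norm_nonneg _)] at h1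
  refine h1.congr_fderiv ?_
  ext w
  simp
  field_simp

theorem mfderiv_chart_snd_norm {n c : ℕ} (φ : CornerChart m M n c) {x : M} (hx : x ∈ φ.source)
    (hy : (φ x).2 ≠ 0) (v : TangentSpace (IQ m) x) :
    (mfderiv (IQ m) 𝓘(ℝ, ℝ) (fun z => ‖(φ z).2‖) x v : ℝ) =
      ‖(φ x).2‖⁻¹ * inner ℝ (φ x).2
        (show Euc c from mfderiv (IQ m) 𝓘(ℝ, Euc c) (fun z => (φ z).2) x v) := by
  have h1 : MDifferentiableAt (IQ m) 𝓘(ℝ, Euc c) (fun z => (φ z).2) x :=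
    ((contMDiffOn_chart_snd φ).contMDiffAt (φ.open_source.mem_nhds hx)).mdifferentiableAt (by simp)
  have h2 : HasMFDerivAt (IQ m) 𝓘(ℝ, ℝ) (fun z => ‖(φ z).2‖) x _ :=
    (hasFDerivAt_norm_of_ne_zero hy).hasMFDerivAt.comp x h1.hasMFDerivAt
  rw [h2.mfderiv]
  rfl

variable [IsManifold (IQ m) ∞ M]

/-- Close to `X`, a smoothed distance function is the length of the normal coordinate of an adapted
chart. -/
theorem IsSmoothedDistance.exists_chart [T2Space M] {X : Set M} {r : M → ℝ}
    (hr : IsSmoothedDistance m X r) {x : M} (hx : x ∈ X) :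
    ∃ (n c : ℕ) (φ : CornerChart m M n c), x ∈ φ.source ∧ IsAdaptedChart X φ ∧
      ∀ᶠ z in 𝓝 x, r z = ‖(φ z).2‖ := by
  obtain ⟨γ, hγ, U, hU, hXU, hd⟩ := hr.dist
  obtain ⟨n, c, φ, h1, h2, h3⟩ := hγ x hx
  refine ⟨n, c, φ, h1, h2, ?_⟩
  filter_upwards [h3.eventually_distTo_eq h2 h1 hx, hU.mem_nhds (hXU hx)] with z hz hzU
  rw [← hd z hzU] at hz
  exact (ENNReal.ofReal_eq_ofReal_iff (hr.nonneg z) (norm_nonneg _)).1 hz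

variable [TopologicalSpace P] [ChartedSpace (EuclideanQuadrant m) P] [IsManifold (IQ m) ∞ P]

/-- Close to the front face of a blow-up with polar coordinates `(u, z, s)`, the smoothed distance
function is the product of `s` with a positive smooth function, and its derivatives along vector
fields of `M` lift to smooth functions. -/
theorem IsBlowup.distance_near_front [T2Space M] {X : Set M} {β : P → M} {r : M → ℝ}
    (hβ : IsBlowup m X β) (hr : IsSmoothedDistance m X r) {n c : ℕ}
    {φ' : CornerChart m M n (c + 1)} (hφ' : IsAdaptedChart X φ')
    {Ψ : PartialDiffeomorph (IQ m) (IBlow n c) P (BlowModel n c) ∞}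
    (hΨ : Ψ.source = β ⁻¹' φ'.source) (hΨ' : ∀ p ∈ Ψ.source, φ' (β p) = blowModelDown (Ψ p))
    {p : P} (hp : p ∈ Ψ.source) (hpX : β p ∈ X) :
    ∃ U : Set P, IsOpen U ∧ p ∈ U ∧ U ⊆ Ψ.source ∧
      (∃ e : P → ℝ, ContMDiffOn (IQ m) 𝓘(ℝ, ℝ) ∞ e U ∧
        ∀ q ∈ U, 0 < e q ∧ r (β q) = (Ψ q).2.2.1 0 * e q) ∧
      ∀ V : SmoothVF m M, ∃ a : P → ℝ, ContMDiffOn (IQ m) 𝓘(ℝ, ℝ) ∞ a U ∧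
        ∀ q ∈ U, β q ∉ X → a q = dirDeriv V r (β q) := by
  have hpφ : β p ∈ φ'.source := by rwa [hΨ] at hp
  obtain ⟨n₂, c₂, φ, hpφ₂, hφ, hrφ⟩ := hr.exists_chart hpX
  obtain ⟨V₁, hV₁, hpV₁, hV₁s, Λ, hΛ, hΛe⟩ := exists_normal_transition hφ hφ' hpφ₂ hpφ hpX
  obtain ⟨V₂, hV₂, hpV₂, hV₂s, Λ', hΛ', hΛe'⟩ := exists_normal_transition hφ' hφ hpφ hpφ₂ hpX
  obtain ⟨V₃, hV₃s, hV₃, hpV₃⟩ := mem_nhds_iff.1 hrφ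
  have hcont : Continuous β := hβ.contMDiff.continuous
  set U : Set P := β ⁻¹' (V₁ ∩ V₂ ∩ V₃) with hUdef
  have hU : IsOpen U := ((hV₁.inter hV₂).inter hV₃).preimage hcont
  have hUΨ : U ⊆ Ψ.source := fun q hq => by
    rw [hΨ]
    exact (hV₁s hq.1.1).2
  set z : P → Euc (c + 1) := fun q => (Ψ q).2.1 with hz
  have hzs : ContMDiffOn (IQ m) 𝓘(ℝ, Euc (c + 1)) ∞ z U :=
    (contMDiff_blowModel_sphere n c).comp_contMDiffOn (Ψ.contMDiffOn.mono hUΨ)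
  have hz1 : ∀ q, ‖z q‖ = 1 := fun q => by simp [hz]
  have hs0 : ∀ q, 0 ≤ (Ψ q).2.2.1 0 := fun q => (Ψ q).2.2.2 0
  have hy' : ∀ q ∈ U, (φ' (β q)).2 = (Ψ q).2.2.1 0 • z q := fun q hq => by
    rw [hΨ' q (hUΨ hq)]
    rfl
  have hβU : ContMDiffOn (IQ m) (IQ m) ∞ β U := hβ.contMDiff.contMDiffOn
  -- By linearity of `Λ`, the normal coordinate for which `r = |y|` equals `s ζ`. Hence `r = s |ζ|`,
  -- and the claim about `e = |ζ|` reduces to `ζ ≠ 0`.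
  set ζ : P → Euc c₂ := fun q => Λ (β q) (z q) with hζ
  have hζs : ContMDiffOn (IQ m) 𝓘(ℝ, Euc c₂) ∞ ζ U :=
    (hΛ.comp hβU fun q hq => hq.1.1).clm_apply hzs
  have hy : ∀ q ∈ U, (φ (β q)).2 = (Ψ q).2.2.1 0 • ζ q := fun q hq => by
    rw [hΛe _ hq.1.1, hy' q hq, map_smul]
  -- Outside the front face one divides `s z = Λ' (s ζ)` by `s`, and the identity extends by
  -- density. It shows `ζ ≠ 0` on the front face too, although the codimensions of the two charts
  -- are not known to agree.
  have hinv : ∀ q ∈ U, Λ' (β q) (ζ q) = z q := by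
    intro q hq
    refine eqOn_of_dense (f := fun q => Λ' (β q) (ζ q)) (g := z) hβ.dense hU
      (((hΛ'.comp hβU fun q hq => hq.1.2).clm_apply hζs).continuousOn) hzs.continuousOn ?_ hq
    rintro q ⟨hqX, hqU⟩
    have h1 := hΛe' _ hqU.1.2
    rw [hy q hqU, hy' q hqU, map_smul] at h1
    refine (smul_right_injective _ (fun h0 => hqX ?_) h1).symm
    rw [hφ' _ (hV₁s hqU.1.1).2, hy' q hqU, h0, zero_smul]
  have hζ0 : ∀ q ∈ U, ζ q ≠ 0 := by
    intro q hq h0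
    have h1 := hinv q hq
    rw [h0, map_zero] at h1
    have := hz1 q
    rw [← h1, norm_zero] at this
    exact zero_ne_one this
  have hns : ContMDiffOn (IQ m) 𝓘(ℝ, ℝ) ∞ (fun q => ‖ζ q‖) U := fun q hq =>
    ContMDiffAt.comp_contMDiffWithinAt q (contDiffAt_norm ℝ (hζ0 q hq)).contMDiffAt (hζs q hq)
  have hrU : ∀ q ∈ U, r (β q) = (Ψ q).2.2.1 0 * ‖ζ q‖ := fun q hq => by
    rw [show r (β q) = _ from hV₃s hq.2, hy q hq, norm_smul, Real.norm_eq_abs,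
      abs_of_nonneg (hs0 q)]
  refine ⟨U, hU, ⟨⟨hpV₁, hpV₂⟩, hpV₃⟩, hUΨ,
    ⟨fun q => ‖ζ q‖, hns, fun q hq => ⟨norm_pos_iff.2 (hζ0 q hq), hrU q hq⟩⟩, fun V => ?_⟩
  have hbs : ContMDiffOn (IQ m) 𝓘(ℝ, Euc c₂) ∞ (fun q =>
      (show Euc c₂ from mfderiv (IQ m) 𝓘(ℝ, Euc c₂) (fun x => (φ x).2) (β q) (V (β q)))) U :=
    (contMDiffOn_chart_snd φ).mfderiv_apply φ.open_source (fun q hq => (hV₁s hq.1.1).1)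
      (V.contMDiff_mk.comp_contMDiffOn hβU)
  -- The derivative of `|y|` along `V` is `⟨y, dy(V)⟩ / |y|`. It is homogeneous of degree `0` in the
  -- base variable `y = s ζ`, so `y` may be replaced by `ζ`, which does not vanish at `s = 0`.
  refine ⟨fun q => ‖ζ q‖⁻¹ * inner ℝ (ζ q)
    (show Euc c₂ from mfderiv (IQ m) 𝓘(ℝ, Euc c₂) (fun x => (φ x).2) (β q) (V (β q))), ?_, ?_⟩
  · refine ContMDiffOn.mul (hns.inv₀ fun q hq => norm_ne_zero_iff.2 (hζ0 q hq)) ?_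
    exact (contDiff_inner (𝕜 := ℝ) (E := Euc c₂)).contMDiff.comp_contMDiffOn
      (hζs.prodMk_space hbs)
  · intro q hq hqX
    have hs : 0 < (Ψ q).2.2.1 0 := (hs0 q).lt_of_ne fun h0 => hqX (by
      rw [hφ' _ (hV₁s hq.1.1).2, hy' q hq, ← h0, zero_smul])
    have hyne : (φ (β q)).2 ≠ 0 := by
      rw [hy q hq]
      exact smul_ne_zero hs.ne' (hζ0 q hq)
    have hev : r =ᶠ[𝓝 (β q)] fun x => ‖(φ x).2‖ := by
      filter_upwards [hV₃.mem_nhds hq.2] with x hx using hV₃s hx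
    rw [dirDeriv_congr hev]
    unfold dirDeriv
    rw [mfderiv_chart_snd_norm φ (hV₁s hq.1.1).1 hyne, hy q hq, norm_smul, Real.norm_eq_abs,
      abs_of_nonneg (hs0 q), real_inner_smul_left]
    field_simp
    rfl

theorem IsBlowup.contMDiff_distance [T2Space M] {X : Set M} {β : P → M} {r : M → ℝ}
    (hβ : IsBlowup m X β) (hr : IsSmoothedDistance m X r) :
    ContMDiff (IQ m) 𝓘(ℝ, ℝ) ∞ (fun p => r (β p)) := by
  intro p
  by_cases hp : β p ∈ X
  · obtain ⟨n, c, φ, hx, hφ, Ψ, h1, h2, h3⟩ := hβ.near _ hp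
    have hpΨ : p ∈ Ψ.source := by rw [h1]; exact hx
    obtain ⟨U, hU, hpU, hUΨ, ⟨e, he, hre⟩, -⟩ := hβ.distance_near_front hr hφ h1 h3 hpΨ hp
    have h4 : ContMDiffOn (IQ m) 𝓘(ℝ, ℝ) ∞ (fun q => (Ψ q).2.2.1 0 * e q) U :=
      ((contMDiff_blowModel_radius n c).comp_contMDiffOn (Ψ.contMDiffOn.mono hUΨ)).mul he
    refine (h4.contMDiffAt (hU.mem_nhds hpU)).congr_of_eventuallyEq ?_
    filter_upwards [hU.mem_nhds hpU] with q hq using (hre q hq).2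
  · exact (hr.smooth.contMDiffAt (hβ.isClosed.isOpen_compl.mem_nhds hp)).comp p hβ.contMDiff.contMDiffAt

theorem IsBlowup.exists_dirDeriv_distance [T2Space M] {X : Set M} {β : P → M} {r : M → ℝ}
    (hβ : IsBlowup m X β) (hr : IsSmoothedDistance m X r) (V : SmoothVF m M) :
    ∃ a : SmoothFun m P, ∀ p, β p ∉ X → a p = dirDeriv V r (β p) := by
  refine exists_smoothFun_eqOn_dense hβ.dense _ fun p => ?_
  have hcont : Continuous β := hβ.contMDiff.continuous
  by_cases hp : β p ∈ X
  · obtain ⟨n, c, φ, hx, hφ, Ψ, h1, h2, h3⟩ := hβ.near _ hp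
    have hpΨ : p ∈ Ψ.source := by rw [h1]; exact hx
    obtain ⟨U, hU, hpU, -, -, hV⟩ := hβ.distance_near_front hr hφ h1 h3 hpΨ hp
    obtain ⟨a, ha, hae⟩ := hV V
    exact ⟨U, hU, hpU, a, ha, fun q hq => hae q hq.2 hq.1⟩
  · have hXo : IsOpen Xᶜ := hβ.isClosed.isOpen_compl
    exact ⟨β ⁻¹' Xᶜ, hXo.preimage hcont, hp, _,
      (contMDiffOn_dirDeriv hXo V.contMDiff_mk.contMDiffOn hr.smooth).comp
        hβ.contMDiff.contMDiffOn (fun q hq => hq), fun q _ => rfl⟩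

end BlowupDistance

/-! ### Lifting vector fields to a blow-up -/

section BlowupLift

open Set Filter Bundle Manifold Topology

/-- Replaces the identity by a nowhere vanishing map, so that `w y / ‖w y‖` is smooth on all of
`ℝ^k` and polar coordinates need no domain. -/
theorem exists_contDiff_ne_zero_eventually_eq {k : ℕ} {z₀ : Euc k} (hz₀ : ‖z₀‖ = 1) :
    ∃ w : Euc k → Euc k, ContDiff ℝ ∞ w ∧ (∀ y, w y ≠ 0) ∧ ∀ᶠ y in 𝓝 z₀, w y = y := by
  let f : ContDiffBump z₀ := ⟨1 / 4, 1 / 2, by norm_num, by norm_num⟩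
  refine ⟨fun y => z₀ + f y • (y - z₀), ?_, fun y h0 => ?_, ?_⟩
  · exact contDiff_const.add (f.contDiff.smul (contDiff_id.sub contDiff_const))
  -- The bump function vanishes at distance at least `1 / 2` from `z₀`, so the perturbation is too
  -- short to cancel the unit vector `z₀`.
  · have h1 : ‖f y • (y - z₀)‖ < 1 := by
      by_cases hy : dist y z₀ < 1 / 2
      · rw [norm_smul, Real.norm_eq_abs, abs_of_nonneg f.nonneg, ← dist_eq_norm]
        have h2 : f y ≤ 1 := f.le_one
        nlinarith [dist_nonneg (x := y) (y := z₀), f.nonneg (x := y)]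
      · have h2 : f y = 0 := f.zero_of_le_dist (not_lt.1 hy)
        rw [h2]
        simp
    have h2 : z₀ = -(f y • (y - z₀)) := eq_neg_of_add_eq_zero_left h0
    rw [h2, norm_neg] at hz₀
    linarith
  · filter_upwards [f.eventuallyEq_one] with y hy
    rw [hy]
    simp

theorem contMDiffOn_quadrant_mk {E' H' Q : Type*} [NormedAddCommGroup E'] [NormedSpace ℝ E']
    [TopologicalSpace H'] {J : ModelWithCorners ℝ E' H'} [TopologicalSpace Q] [ChartedSpace H' Q]
    {n : ℕ} {f : Q → EuclideanQuadrant n} {s : Set Q}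
    (h : ContMDiffOn J 𝓘(ℝ, Euc n) ∞ (fun q => (f q).1) s) : ContMDiffOn J (IQ n) ∞ f s := by
  have h1 := (IQ n).contMDiffOn_symm (n := ∞)
  refine (h1.comp h fun q _ => ⟨f q, rfl⟩).congr fun q _ => ?_
  exact ((IQ n).left_inv (f q)).symm

theorem tangentBundle_mk_congr {E H M : Type*} [NormedAddCommGroup E] [NormedSpace ℝ E]
    [TopologicalSpace H] {I : ModelWithCorners ℝ E H} [TopologicalSpace M] [ChartedSpace H M]
    {x x' : M} (h : x = x') (v : E) :
    (⟨x, (show TangentSpace I x from v)⟩ : TangentBundle I M) =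
      ⟨x', (show TangentSpace I x' from v)⟩ := by
  subst h
  rfl

/-- Transport along an equality of base points such as `F (b q) = q`. All tangent spaces are the
same vector space by definition, so the vector itself stays unchanged. -/
theorem mfderiv_apply_congr {E H M E' H' M' : Type*} [NormedAddCommGroup E] [NormedSpace ℝ E]
    [TopologicalSpace H] {I : ModelWithCorners ℝ E H} [TopologicalSpace M] [ChartedSpace H M]
    [NormedAddCommGroup E'] [NormedSpace ℝ E'] [TopologicalSpace H'] {I' : ModelWithCorners ℝ E' H'}
    [TopologicalSpace M'] [ChartedSpace H' M'] (f : M → M') {x x' : M} (h : x = x') (v : E) :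
    (show E' from mfderiv I I' f x (show TangentSpace I x from v)) =
      (show E' from mfderiv I I' f x' (show TangentSpace I x' from v)) := by
  subst h
  rfl

theorem HasMFDerivAt.smul_space {E H M F : Type*} [NormedAddCommGroup E] [NormedSpace ℝ E]
    [TopologicalSpace H] {I : ModelWithCorners ℝ E H} [TopologicalSpace M] [ChartedSpace H M]
    [NormedAddCommGroup F] [NormedSpace ℝ F] {x : M} {f : M → ℝ} {g : M → F}
    {f' : E →L[ℝ] ℝ} {g' : E →L[ℝ] F}
    (hf : HasMFDerivAt I 𝓘(ℝ, ℝ) f x f') (hg : HasMFDerivAt I 𝓘(ℝ, F) g x g') :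
    HasMFDerivAt I 𝓘(ℝ, F) (fun y => f y • g y) x (f x • g' + f'.smulRight (g x)) := by
  have h1 : HasFDerivWithinAt (fun q => f ((extChartAt I x).symm q)) f' (range I)
    (extChartAt I x x) := hf.2
  have h2 : HasFDerivWithinAt (fun q => g ((extChartAt I x).symm q)) g' (range I)
    (extChartAt I x x) := hg.2
  have h := h1.smul h2
  rw [extChartAt_to_inv] at h
  exact ⟨hf.1.smul hg.1, h⟩

/-- Polar coordinates: the lift of `((u, y), s) ↦ (u, s y)` to the model blow-up, for `y` in the
region where `w y = y`. -/
theorem exists_polar (n : ℕ) {c : ℕ} {w : Euc (c + 1) → Euc (c + 1)} (hw : ContDiff ℝ ∞ w)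
    (hw0 : ∀ y, w y ≠ 0) :
    ∃ τ : (EuclideanQuadrant n × Euc (c + 1)) × EuclideanQuadrant 1 → BlowModel n c,
      ContMDiff ((IQE n (c + 1)).selfProd (IQ 1)) (IBlow n c) ∞ τ ∧
      (∀ b, blowModelDown (τ b) = (b.1.1, b.2.1 0 • w b.1.2)) ∧
      ∀ b : BlowModel n c, w b.2.1 = b.2.1 → τ ((b.1, b.2.1), b.2.2) = b := by
  have : Fact (Module.finrank ℝ (Euc (c + 1)) = c + 1) := ⟨finrank_euclideanSpace_fin⟩
  have hR : ∀ y, ‖w y‖⁻¹ • w y ∈ Metric.sphere (0 : Euc (c + 1)) 1 := fun y => by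
    have := norm_pos_iff.2 (hw0 y)
    rw [mem_sphere_zero_iff_norm, norm_smul, norm_inv, norm_norm, inv_mul_cancel₀ this.ne']
  have hn : ContDiff ℝ ∞ (fun y => ‖w y‖) := hw.norm ℝ hw0
  have hRs : ContMDiff 𝓘(ℝ, Euc (c + 1)) (𝓡 c) ∞
      (codRestrict _ _ hR : Euc (c + 1) → USphere c) :=
    ((hn.inv fun y => norm_ne_zero_iff.2 (hw0 y)).smul hw).contMDiff.codRestrict_sphere hR
  -- The radius absorbs the factor `‖w y‖` lost when `w y` is projected to the sphere, so that
  -- radius times direction is `s w(y)`.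
  let σ : (EuclideanQuadrant n × Euc (c + 1)) × EuclideanQuadrant 1 → EuclideanQuadrant 1 :=
    fun b => ⟨‖w b.1.2‖ • b.2.1, fun i => mul_nonneg (norm_nonneg _) (b.2.2 i)⟩
  have hfst : ContMDiff ((IQE n (c + 1)).selfProd (IQ 1)) (IQE n (c + 1)) ∞
      (fun b : (EuclideanQuadrant n × Euc (c + 1)) × EuclideanQuadrant 1 => b.1) :=
    contMDiff_fst_model
  have hu : ContMDiff ((IQE n (c + 1)).selfProd (IQ 1)) (IQ n) ∞
      (fun b : (EuclideanQuadrant n × Euc (c + 1)) × EuclideanQuadrant 1 => b.1.1) :=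
    (contMDiff_fst_model (I₁ := IQ n) (I₂ := 𝓘(ℝ, Euc (c + 1)))).comp hfst
  have hy : ContMDiff ((IQE n (c + 1)).selfProd (IQ 1)) 𝓘(ℝ, Euc (c + 1)) ∞
      (fun b : (EuclideanQuadrant n × Euc (c + 1)) × EuclideanQuadrant 1 => b.1.2) :=
    (contMDiff_snd_model (I₁ := IQ n) (I₂ := 𝓘(ℝ, Euc (c + 1)))).comp hfst
  have hs : ContMDiff ((IQE n (c + 1)).selfProd (IQ 1)) (IQ 1) ∞
      (fun b : (EuclideanQuadrant n × Euc (c + 1)) × EuclideanQuadrant 1 => b.2) :=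
    contMDiff_snd_model
  have hσ : ContMDiff ((IQE n (c + 1)).selfProd (IQ 1)) (IQ 1) ∞ σ :=
    contMDiffOn_univ.1 (contMDiffOn_quadrant_mk
      ((hn.contMDiff.comp hy).smul ((IQ 1).contMDiff.comp hs)).contMDiffOn)
  refine ⟨fun b => (b.1.1, codRestrict _ _ hR b.1.2, σ b), ?_, fun b => ?_, fun b hb => ?_⟩
  · exact hu.prodMk ((hRs.comp hy).prodMk hσ)
  · refine Prod.ext rfl ?_
    change (‖w b.1.2‖ * b.2.1 0) • (‖w b.1.2‖⁻¹ • w b.1.2) = b.2.1 0 • w b.1.2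
    rw [smul_smul, mul_comm ‖w b.1.2‖, mul_assoc, mul_inv_cancel₀ (norm_ne_zero_iff.2 (hw0 _)),
      mul_one]
  · have h1 : ‖(b.2.1 : Euc (c + 1))‖ = 1 := by simp
    refine Prod.ext rfl (Prod.ext (Subtype.ext ?_) (Subtype.ext ?_))
    · change ‖w b.2.1‖⁻¹ • w b.2.1 = b.2.1
      rw [hb, h1]
      simp
    · change ‖w b.2.1‖ • b.2.2.1 = b.2.2.1
      rw [hb, h1, one_smul]

/-- The derivative of `((u, y), s) ↦ (u, s y)` in directions tangent to the slices. -/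
theorem mfderiv_polarDown {n c : ℕ} (b : (EuclideanQuadrant n × Euc (c + 1)) × EuclideanQuadrant 1)
    (a : Euc n) (v : Euc (c + 1)) :
    MDifferentiableAt ((IQE n (c + 1)).selfProd (IQ 1)) (IQE n (c + 1))
      (fun b : (EuclideanQuadrant n × Euc (c + 1)) × EuclideanQuadrant 1 =>
        ((b.1.1, b.2.1 0 • b.1.2) : EuclideanQuadrant n × Euc (c + 1))) b ∧
    mfderiv ((IQE n (c + 1)).selfProd (IQ 1)) (IQE n (c + 1))
      (fun b : (EuclideanQuadrant n × Euc (c + 1)) × EuclideanQuadrant 1 =>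
        ((b.1.1, b.2.1 0 • b.1.2) : EuclideanQuadrant n × Euc (c + 1))) b
      (((a, v), 0) : (Euc n × Euc (c + 1)) × Euc 1) = ((a, b.2.1 0 • v) : Euc n × Euc (c + 1)) := by
  have hfst : HasMFDerivAt ((IQE n (c + 1)).selfProd (IQ 1)) (IQE n (c + 1))
      (fun b : (EuclideanQuadrant n × Euc (c + 1)) × EuclideanQuadrant 1 => b.1) b _ :=
    hasMFDerivAt_fst_model b
  have hu := (hasMFDerivAt_fst_model (I₁ := IQ n) (I₂ := 𝓘(ℝ, Euc (c + 1))) b.1).comp b hfst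
  have hy := (hasMFDerivAt_snd_model (I₁ := IQ n) (I₂ := 𝓘(ℝ, Euc (c + 1))) b.1).comp b hfst
  have hs0 : HasMFDerivAt (IQ 1) 𝓘(ℝ, ℝ) (fun u : EuclideanQuadrant 1 => u.1 0) b.2 _ :=
    ((contMDiff_quadrant_coord 1 0).mdifferentiableAt (by simp)).hasMFDerivAt
  have hs := hs0.comp b (hasMFDerivAt_snd_model (I₁ := IQE n (c + 1)) (I₂ := IQ 1) b)
  have hsy := hs.smul_space hy
  have h := hu.prodMk_model hsy
  refine ⟨h.mdifferentiableAt, ?_⟩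
  rw [show mfderiv ((IQE n (c + 1)).selfProd (IQ 1)) (IQE n (c + 1))
      (fun b : (EuclideanQuadrant n × Euc (c + 1)) × EuclideanQuadrant 1 =>
        ((b.1.1, b.2.1 0 • b.1.2) : EuclideanQuadrant n × Euc (c + 1))) b = _ from h.mfderiv]
  refine Prod.ext rfl ?_
  change b.2.1 0 • v + (show ℝ from mfderiv (IQ 1) 𝓘(ℝ, ℝ)
    (fun u : EuclideanQuadrant 1 => u.1 0) b.2 (0 : Euc 1)) • b.1.2 = b.2.1 0 • v
  have h0 : (show ℝ from mfderiv (IQ 1) 𝓘(ℝ, ℝ)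
    (fun u : EuclideanQuadrant 1 => u.1 0) b.2 (0 : Euc 1)) = 0 :=
    map_zero (mfderiv (IQ 1) 𝓘(ℝ, ℝ) (fun u : EuclideanQuadrant 1 => u.1 0) b.2)
  rw [h0, zero_smul, add_zero]

variable {m : ℕ} {M P : Type*} [TopologicalSpace M] [ChartedSpace (EuclideanQuadrant m) M]
  [TopologicalSpace P] [ChartedSpace (EuclideanQuadrant m) P]

theorem IsLocalDiffeomorphAt.mfderiv_injective {β : P → M} {p : P}
    (h : IsLocalDiffeomorphAt (IQ m) (IQ m) ∞ β p) :
    Function.Injective (mfderiv (IQ m) (IQ m) β p) :=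
  (h.mfderivToContinuousLinearEquiv (by simp)).injective

/-- Tangency to the faces is invariant under local diffeomorphisms. -/
theorem IsLocalDiffeomorphAt.tangent_to_faces {β : P → M} {p : P}
    (h : IsLocalDiffeomorphAt (IQ m) (IQ m) ∞ β p) {v : TangentSpace (IQ m) p}
    (hv : ∀ f : M → ℝ, MDifferentiableAt (IQ m) 𝓘(ℝ, ℝ) f (β p) → (∀ᶠ y in 𝓝 (β p), 0 ≤ f y) →
      f (β p) = 0 → (mfderiv (IQ m) 𝓘(ℝ, ℝ) f (β p) (mfderiv (IQ m) (IQ m) β p v) : ℝ) = 0)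
    (f : P → ℝ) (hf : MDifferentiableAt (IQ m) 𝓘(ℝ, ℝ) f p) (hpos : ∀ᶠ y in 𝓝 p, 0 ≤ f y)
    (hf0 : f p = 0) : (mfderiv (IQ m) 𝓘(ℝ, ℝ) f p v : ℝ) = 0 := by
  obtain ⟨Φ, hpΦ, hΦ⟩ := h
  have hΦp : Φ p = β p := (hΦ hpΦ).symm
  have hinv : Φ.symm (β p) = p := by
    rw [← hΦp]
    exact Φ.left_inv hpΦ
  have hβt : β p ∈ Φ.target := by
    rw [← hΦp]
    exact Φ.map_source hpΦ
  have hsd : MDifferentiableAt (IQ m) (IQ m) Φ.symm (β p) := Φ.symm.mdifferentiableAt (by simp) hβt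
  have hf' : HasMFDerivAt (IQ m) 𝓘(ℝ, ℝ) f (Φ.symm (β p))
      (mfderiv (IQ m) 𝓘(ℝ, ℝ) f (Φ.symm (β p))) := by
    rw [← hinv] at hf
    exact hf.hasMFDerivAt
  have hcomp := hf'.comp (β p) hsd.hasMFDerivAt
  have hcont : Tendsto Φ.symm (𝓝 (β p)) (𝓝 p) := by
    have := hsd.continuousAt.tendsto
    rwa [hinv] at this
  have h1 := hv (f ∘ Φ.symm) hcomp.mdifferentiableAt (hcont.eventually hpos)
    (by simp only [Function.comp, hinv, hf0])
  rw [hcomp.mfderiv] at h1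
  have hev : β =ᶠ[𝓝 p] Φ := by
    filter_upwards [Φ.open_source.mem_nhds hpΦ] with y hy using hΦ hy
  have h2 : (show Euc m from mfderiv (IQ m) (IQ m) Φ.symm (β p) (mfderiv (IQ m) (IQ m) β p v))
      = v := by
    rw [hev.mfderiv_eq]
    refine (mfderiv_apply_congr Φ.symm hΦp.symm _).trans ?_
    exact Φ.mfderiv_symm_mfderiv hpΦ v
  refine (mfderiv_apply_congr (I := IQ m) (I' := 𝓘(ℝ, ℝ)) f hinv v).symm.trans ?_
  refine Eq.trans ?_ h1
  exact congrArg (fun x : Euc m => (show ℝ from mfderiv (IQ m) 𝓘(ℝ, ℝ) f (Φ.symm (β p)) x)) h2.symm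

variable [IsManifold (IQ m) ∞ M] [IsManifold (IQ m) ∞ P]

/-- Close to the front face, `r V` lifts to a smooth vector field that is tangent to the front
face. -/
theorem IsBlowup.exists_lift_near_front [T2Space M] {X : Set M} {β : P → M} {r : M → ℝ}
    (hβ : IsBlowup m X β) (hr : IsSmoothedDistance m X r) (V : SmoothVF m M) {p : P}
    (hp : β p ∈ X) :
    ∃ U : Set P, IsOpen U ∧ p ∈ U ∧ ∃ W : ∀ q : P, TangentSpace (IQ m) q,
      ContMDiffOn (IQ m) (IQ m).tangent ∞ (fun q => (⟨q, W q⟩ : TangentBundle (IQ m) P)) U ∧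
      ∀ q ∈ U, mfderiv (IQ m) (IQ m) β q (W q) = r (β q) • V (β q) ∧
        (β q ∈ X → ∀ f : P → ℝ, MDifferentiableAt (IQ m) 𝓘(ℝ, ℝ) f q →
          (∀ᶠ y in 𝓝 q, 0 ≤ f y) → f q = 0 →
            (mfderiv (IQ m) 𝓘(ℝ, ℝ) f q (W q) : ℝ) = 0) := by
  obtain ⟨n, c, φ, hx, hφ, Ψ, hΨs, hΨt, hΨ⟩ := hβ.near _ hp
  have hpΨ : p ∈ Ψ.source := by rw [hΨs]; exact hx
  obtain ⟨U₁, hU₁, hpU₁, hU₁Ψ, ⟨e, he, hre⟩, -⟩ := hβ.distance_near_front hr hφ hΨs hΨ hpΨ hp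
  have hcont : Continuous β := hβ.contMDiff.continuous
  obtain ⟨w, hw, hw0, hwe⟩ := exists_contDiff_ne_zero_eventually_eq
    (z₀ := ((Ψ p).2.1 : Euc (c + 1))) (by simp)
  obtain ⟨τ, hτ, hτd, hτb⟩ := exists_polar n hw hw0
  obtain ⟨Ω, hΩw, hΩ, hpΩ⟩ := mem_nhds_iff.1 hwe
  set z : P → Euc (c + 1) := fun q => (Ψ q).2.1 with hz
  have hzs : ContMDiffOn (IQ m) 𝓘(ℝ, Euc (c + 1)) ∞ z U₁ :=
    (contMDiff_blowModel_sphere n c).comp_contMDiffOn (Ψ.contMDiffOn.mono hU₁Ψ)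
  set U : Set P := U₁ ∩ z ⁻¹' Ω with hUdef
  have hU : IsOpen U := hzs.continuousOn.isOpen_inter_preimage hU₁ hΩ
  have hUU : U ⊆ U₁ := inter_subset_left
  have hUΨ : U ⊆ Ψ.source := hUU.trans hU₁Ψ
  set b : P → (EuclideanQuadrant n × Euc (c + 1)) × EuclideanQuadrant 1 :=
    fun q => (((Ψ q).1, z q), (Ψ q).2.2) with hb
  have hbs : ContMDiffOn (IQ m) ((IQE n (c + 1)).selfProd (IQ 1)) ∞ b U := by
    have h1 : ContMDiffOn (IQ m) (IQ n) ∞ (fun q => (Ψ q).1) U :=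
      (contMDiff_blowModel_fst n c).comp_contMDiffOn (Ψ.contMDiffOn.mono hUΨ)
    have h2 : ContMDiffOn (IQ m) (IQ 1) ∞ (fun q => (Ψ q).2.2) U :=
      ((contMDiff_snd.comp contMDiff_snd :
        ContMDiff (IBlow n c) (IQ 1) ∞ (fun b : BlowModel n c => b.2.2))).comp_contMDiffOn
        (Ψ.contMDiffOn.mono hUΨ)
    exact (h1.prodMk_model (hzs.mono hUU)).prodMk_model h2
  have hτΨ : ∀ q ∈ U, τ (b q) = Ψ q := fun q hq => hτb (Ψ q) (hΩw hq.2)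
  set T : Set ((EuclideanQuadrant n × Euc (c + 1)) × EuclideanQuadrant 1) := τ ⁻¹' Ψ.target with hT
  have hTo : IsOpen T := Ψ.open_target.preimage hτ.continuous
  have hbT : MapsTo b U T := fun q hq => by
    rw [hT, mem_preimage, hτΨ q hq]
    exact Ψ.map_source (hUΨ hq)
  -- `F` parametrises `P` with one redundant variable, the length of `y`, and `b` is a right inverse
  -- of it on `U`. Where `w y = y`, the map `β ∘ F` is `φ⁻¹ (u, s y)`.
  set F : (EuclideanQuadrant n × Euc (c + 1)) × EuclideanQuadrant 1 → P := fun t => Ψ.symm (τ t)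
    with hF
  have hFs : ContMDiffOn ((IQE n (c + 1)).selfProd (IQ 1)) (IQ m) ∞ F T :=
    Ψ.symm.contMDiffOn.comp hτ.contMDiffOn fun t ht => ht
  have hFb : ∀ q ∈ U, F (b q) = q := fun q hq => by
    simp only [hF]
    rw [hτΨ q hq]
    exact Ψ.left_inv (hUΨ hq)
  -- the vector field in the polar coordinates
  set D : P → Euc n × Euc (c + 1) := fun q => mfderiv (IQ m) (IQE n (c + 1)) φ (β q) (V (β q))
    with hD
  have hβU : ContMDiffOn (IQ m) (IQ m) ∞ β U := hβ.contMDiff.contMDiffOn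
  have hβφ : MapsTo β U φ.source := fun q hq => by
    have := hUΨ hq
    rwa [hΨs] at this
  have hDs : ContMDiffOn (IQ m) 𝓘(ℝ, Euc n × Euc (c + 1)) ∞ D U :=
    ContMDiffOn.snd_modelSpace (φ.contMDiffOn.mfderiv_section φ.open_source hβφ
      (V.contMDiff_mk.comp_contMDiffOn hβU))
  -- The differential of `(u, y, s) ↦ (u, s y)` maps `(s D₁, D₂, 0)` to `s D`. Multiplication by `e`
  -- turns this into `r D`, because `r = s e`.
  set ξ : P → (Euc n × Euc (c + 1)) × Euc 1 := fun q => (((Ψ q).2.2.1 0 • (D q).1, (D q).2), 0)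
    with hξ
  have hξs : ContMDiffOn (IQ m) 𝓘(ℝ, (Euc n × Euc (c + 1)) × Euc 1) ∞ ξ U := by
    have h1 := (contMDiff_blowModel_radius n c).comp_contMDiffOn (Ψ.contMDiffOn.mono hUΨ)
    have h2 : ContMDiffOn (IQ m) 𝓘(ℝ, Euc n) ∞ (fun q => (D q).1) U :=
      (ContinuousLinearMap.fst ℝ (Euc n) (Euc (c + 1))).contDiff.contMDiff.comp_contMDiffOn hDs
    have h3 : ContMDiffOn (IQ m) 𝓘(ℝ, Euc (c + 1)) ∞ (fun q => (D q).2) U :=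
      (ContinuousLinearMap.snd ℝ (Euc n) (Euc (c + 1))).contDiff.contMDiff.comp_contMDiffOn hDs
    exact ((h1.smul h2).prodMk_space h3).prodMk_space contMDiffOn_const
  have hsec := hFs.mfderiv_section hTo hbT (hbs.section_modelSpace
    ((he.mono hUU).smul hξs))
  set W : ∀ q : P, TangentSpace (IQ m) q := fun q => (show Euc m from
    mfderiv ((IQE n (c + 1)).selfProd (IQ 1)) (IQ m) F (b q) (show TangentSpace _ _ from e q • ξ q))
    with hW
  have hβF : ∀ t ∈ T, β (F t) = φ.symm (t.1.1, t.2.1 0 • w t.1.2) := by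
    intro t ht
    have h1 : F t ∈ Ψ.source := Ψ.map_target ht
    have h2 : β (F t) ∈ φ.source := by
      have := h1
      rwa [hΨs] at this
    have h3 : Ψ (F t) = τ t := Ψ.right_inv ht
    have h4 := hΨ _ h1
    rw [h3, hτd] at h4
    rw [← h4]
    exact (φ.left_inv h2).symm
  refine ⟨U, hU, ⟨hpU₁, hpΩ⟩, W, ?_, fun q hq => ⟨?_, ?_⟩⟩
  · exact hsec.congr fun q hq => (tangentBundle_mk_congr (hFb q hq) _).symm
  · set κ : (EuclideanQuadrant n × Euc (c + 1)) × EuclideanQuadrant 1 →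
        EuclideanQuadrant n × Euc (c + 1) := fun t => (t.1.1, t.2.1 0 • t.1.2) with hκ
    have hκb : κ (b q) = φ (β q) := (hΨ q (hUΨ hq)).symm
    have hev : β ∘ F =ᶠ[𝓝 (b q)] φ.symm ∘ κ := by
      have hΩ' : IsOpen ((fun t : (EuclideanQuadrant n × Euc (c + 1)) × EuclideanQuadrant 1 =>
        t.1.2) ⁻¹' Ω) := hΩ.preimage (continuous_snd.comp continuous_fst)
      filter_upwards [hTo.mem_nhds (hbT hq), hΩ'.mem_nhds hq.2] with t ht htΩ
      simp only [Function.comp, hκ, hβF t ht]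
      rw [show w t.1.2 = t.1.2 from hΩw htΩ]
    have hFd : MDifferentiableAt ((IQE n (c + 1)).selfProd (IQ 1)) (IQ m) F (b q) :=
      (hFs.contMDiffAt (hTo.mem_nhds (hbT hq))).mdifferentiableAt (by simp)
    have hβd : MDifferentiableAt (IQ m) (IQ m) β (F (b q)) :=
      hβ.contMDiff.mdifferentiableAt (by simp)
    obtain ⟨hκd, hκe⟩ := mfderiv_polarDown (b q) ((Ψ q).2.2.1 0 • (D q).1) (D q).2
    have hφd : MDifferentiableAt (IQE n (c + 1)) (IQ m) φ.symm (κ (b q)) :=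
      φ.symm.mdifferentiableAt (by simp) (by
        rw [hκb]
        exact φ.map_source (hβφ hq))
    have h1 := mfderiv_comp (b q) hβd hFd
    rw [hev.mfderiv_eq, mfderiv_comp (b q) hφd hκd] at h1
    have h2 : (show Euc m from mfderiv (IQ m) (IQ m) β q (W q)) =
        (show Euc m from mfderiv (IQ m) (IQ m) β (F (b q))
          (mfderiv ((IQE n (c + 1)).selfProd (IQ 1)) (IQ m) F (b q) (show TangentSpace _ _ from
            e q • ξ q))) := (mfderiv_apply_congr β (hFb q hq) _).symm
    have h3 := DFunLike.congr_fun h1 (show TangentSpace _ _ from e q • ξ q)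
    have h4 : (show Euc n × Euc (c + 1) from
        mfderiv ((IQE n (c + 1)).selfProd (IQ 1)) (IQE n (c + 1)) κ (b q)
          (show TangentSpace _ _ from e q • ξ q)) = (e q * (Ψ q).2.2.1 0) • D q := by
      refine (map_smul (mfderiv ((IQE n (c + 1)).selfProd (IQ 1)) (IQE n (c + 1)) κ (b q)) (e q)
        (show TangentSpace _ _ from ξ q)).trans ?_
      refine (congrArg (fun x : Euc n × Euc (c + 1) => e q • x) hκe).trans ?_
      rw [mul_smul]
      rfl
    refine h2.trans (h3.symm.trans ?_)
    refine (congrArg (fun x : Euc n × Euc (c + 1) => (show Euc m from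
      mfderiv (IQE n (c + 1)) (IQ m) φ.symm (κ (b q)) x)) h4).trans ?_
    refine (mfderiv_apply_congr φ.symm hκb _).trans ?_
    refine (map_smul (mfderiv (IQE n (c + 1)) (IQ m) φ.symm (φ (β q))) _
      (show TangentSpace _ _ from D q)).trans ?_
    rw [(hre q (hUU hq)).2, mul_comm (e q)]
    exact congrArg (fun x : Euc m => ((Ψ q).2.2.1 0 * e q) • x)
      (φ.mfderiv_symm_mfderiv (hβφ hq) (V (β q)))
  · intro hqX f hf hpos hf0
    have hs : (Ψ q).2.2.1 0 = 0 := by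
      have h1 := (hφ _ (hβφ hq)).1 hqX
      rw [hΨ q (hUΨ hq)] at h1
      refine (smul_eq_zero.1 h1).resolve_right fun h2 => ?_
      have h3 : ‖((Ψ q).2.1 : Euc (c + 1))‖ = 1 := by simp
      rw [h2, norm_zero] at h3
      exact zero_ne_one h3
    have hFd : MDifferentiableAt ((IQE n (c + 1)).selfProd (IQ 1)) (IQ m) F (b q) :=
      (hFs.contMDiffAt (hTo.mem_nhds (hbT hq))).mdifferentiableAt (by simp)
    -- At `s = 0` the vector `ξ` is `(0, D₂, 0)`, the velocity of this line. It keeps `u` and `s`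
    -- fixed and is defined for both signs of `t`, so a nonnegative function vanishing at `q` has a
    -- minimum at `t = 0`.
    set ℓ : ℝ → (EuclideanQuadrant n × Euc (c + 1)) × EuclideanQuadrant 1 :=
      fun t => (((Ψ q).1, z q + t • (D q).2), (Ψ q).2.2) with hℓ
    have hℓ0 : ℓ 0 = b q := by simp [hℓ, hb]
    have hline : HasDerivAt (fun t : ℝ => z q + t • (D q).2) (D q).2 0 := by
      have := ((hasDerivAt_id (0 : ℝ)).smul_const (D q).2).const_add (z q)
      simpa using this
    have hℓd := ((hasMFDerivAt_const (I := 𝓘(ℝ, ℝ)) (I' := IQ n) (Ψ q).1 (0 : ℝ)).prodMk_model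
      (hline.hasFDerivAt.hasMFDerivAt)).prodMk_model
        (hasMFDerivAt_const (I := 𝓘(ℝ, ℝ)) (I' := IQ 1) (Ψ q).2.2 (0 : ℝ))
    have hf' : HasMFDerivAt (IQ m) 𝓘(ℝ, ℝ) f (F (b q))
        (mfderiv (IQ m) 𝓘(ℝ, ℝ) f (F (b q))) := by
      rw [← hFb q hq] at hf
      exact hf.hasMFDerivAt
    have hfF := hf'.comp (b q) hFd.hasMFDerivAt
    rw [← hℓ0] at hfF
    have hcomp := hfF.comp (0 : ℝ) hℓd
    have hder : HasFDerivAt (fun t : ℝ => f (F (ℓ t))) _ 0 := hcomp.hasFDerivAt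
    have hmin : IsLocalMin (fun t : ℝ => f (F (ℓ t))) 0 := by
      have h1 : Tendsto (fun t : ℝ => F (ℓ t)) (𝓝 0) (𝓝 q) := by
        have h2 : ContinuousAt (fun t : ℝ => F (ℓ t)) 0 := by
          refine ContinuousAt.comp (g := F) ?_ hℓd.continuousAt
          rw [hℓ0]
          exact hFd.continuousAt
        have h3 := h2.tendsto
        simp only [hℓ0, hFb q hq] at h3
        exact h3
      filter_upwards [h1.eventually hpos] with t ht
      simp only [hℓ0, hFb q hq, hf0]
      exact ht
    have hz0 := DFunLike.congr_fun (hmin.hasFDerivAt_eq_zero hder) (1 : ℝ)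
    have hξq : ξ q = ((((0 : Euc n), (1 : ℝ) • (D q).2), (0 : Euc 1)) :
        (Euc n × Euc (c + 1)) × Euc 1) := by
      simp only [hξ, hs, zero_smul, one_smul]
    have h1 : (show ℝ from mfderiv (IQ m) 𝓘(ℝ, ℝ) f (F (b q)) (show TangentSpace _ _ from
        mfderiv ((IQE n (c + 1)).selfProd (IQ 1)) (IQ m) F (b q)
          (show TangentSpace _ _ from ξ q))) = 0 := by
      rw [hξq]
      have hk : ∀ t, t = b q → ∀ v : (Euc n × Euc (c + 1)) × Euc 1,
          (show ℝ from mfderiv (IQ m) 𝓘(ℝ, ℝ) f (F (b q)) (show TangentSpace _ _ from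
            mfderiv ((IQE n (c + 1)).selfProd (IQ 1)) (IQ m) F (b q)
              (show TangentSpace _ _ from v))) =
          (show ℝ from mfderiv (IQ m) 𝓘(ℝ, ℝ) f (F t) (show TangentSpace _ _ from
            mfderiv ((IQE n (c + 1)).selfProd (IQ 1)) (IQ m) F t
              (show TangentSpace _ _ from v))) := by
        intro t ht v
        subst ht
        rfl
      exact (hk (ℓ 0) hℓ0 _).trans hz0
    refine (mfderiv_apply_congr (I := IQ m) (I' := 𝓘(ℝ, ℝ)) f (hFb q hq) (W q)).symm.trans ?_
    refine (congrArg (fun x : Euc m => (show ℝ from mfderiv (IQ m) 𝓘(ℝ, ℝ) f (F (b q)) x))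
      (map_smul (mfderiv ((IQE n (c + 1)).selfProd (IQ 1)) (IQ m) F (b q)) (e q)
        (show TangentSpace _ _ from ξ q))).trans ?_
    refine (map_smul (mfderiv (IQ m) 𝓘(ℝ, ℝ) f (F (b q))) (e q) _).trans ?_
    exact (congrArg (fun x : ℝ => e q * x) h1).trans (mul_zero _)

/-- For a smoothed distance function `r`, the vector fields `r V` with `V` tangent to the faces
lift to vector fields on the blow-up that are tangent to the faces. -/
theorem IsBlowup.exists_lift [T2Space M] {X : Set M} {β : P → M} {r : M → ℝ}
    (hβ : IsBlowup m X β) (hr : IsSmoothedDistance m X r) {V : SmoothVF m M}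
    (hV : IsTangentToFaces V) :
    ∃ W : SmoothVF m P, IsTangentToFaces W ∧
      ∀ p, mfderiv (IQ m) (IQ m) β p (W p) = r (β p) • V (β p) := by
  classical
  have hcont : Continuous β := hβ.contMDiff.continuous
  have hXo : IsOpen Xᶜ := hβ.isClosed.isOpen_compl
  -- Off the front face the lift is forced, because `dβ` is invertible there. The local lifts near
  -- the front face agree with it and therefore glue.
  set G : ∀ p : P, TangentSpace (IQ m) p := fun p => if h : β p ∉ X then
    ((hβ.isLocalDiffeomorphAt h).mfderivToContinuousLinearEquiv (by simp)).symm (r (β p) • V (β p))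
    else 0 with hG
  have hGe : ∀ p, β p ∉ X → mfderiv (IQ m) (IQ m) β p (G p) = r (β p) • V (β p) := by
    intro p hp
    simp only [hG, dif_pos hp]
    exact ((hβ.isLocalDiffeomorphAt hp).mfderivToContinuousLinearEquiv
      (by simp)).apply_symm_apply (r (β p) • V (β p))
  have hGeq : ∀ p, β p ∉ X → ∀ w : TangentSpace (IQ m) p,
      mfderiv (IQ m) (IQ m) β p w = r (β p) • V (β p) → w = G p := fun p hp w hw =>
    (hβ.isLocalDiffeomorphAt hp).mfderiv_injective (hw.trans (hGe p hp).symm)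
  obtain ⟨W, hW⟩ : ∃ W : SmoothVF m P, ∀ q ∈ β ⁻¹' Xᶜ, W q = G q := by
    refine exists_smoothVF_eqOn_dense hβ.dense _ fun p => ?_
    by_cases hp : β p ∈ X
    · obtain ⟨U, hU, hpU, W, hWs, hW⟩ := hβ.exists_lift_near_front hr V hp
      exact ⟨U, hU, hpU, W, hWs, fun q hq => hGeq q hq.1 _ (hW q hq.2).1⟩
    · obtain ⟨Φ, h1, h2, h3⟩ := hβ.away
      have hsrc : Φ.source = β ⁻¹' Xᶜ := h1
      have hrV : ContMDiffOn (IQ m) (IQ m).tangent ∞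
          (fun x => (⟨x, r x • V x⟩ : TangentBundle (IQ m) M)) Xᶜ :=
        hr.smooth.smul_section V.contMDiff_mk.contMDiffOn
      have hs := Φ.symm.contMDiffOn.mfderiv_section Φ.open_target
        (s := β ⁻¹' Xᶜ) (b := β) (fun q hq => by rw [h2]; exact hq)
        (hrV.comp hβ.contMDiff.contMDiffOn fun q hq => hq)
      have hinv : ∀ q ∈ β ⁻¹' Xᶜ, Φ.symm (β q) = q := fun q hq => by
        rw [← h3 q (by rw [h1]; exact hq)]
        exact Φ.left_inv (by rw [h1]; exact hq)
      refine ⟨β ⁻¹' Xᶜ, hXo.preimage hcont, hp, fun q => (show Euc m from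
        mfderiv (IQ m) (IQ m) Φ.symm (β q) (r (β q) • V (β q))),
        hs.congr fun q hq => (tangentBundle_mk_congr (hinv q hq) _).symm, fun q hq => ?_⟩
      have hqΦ : q ∈ Φ.source := by rw [h1]; exact hq.1
      have hev : β =ᶠ[𝓝 q] Φ := by
        filter_upwards [Φ.open_source.mem_nhds hqΦ] with y hy using (h3 y hy).symm
      have h4 := Φ.mfderiv_symm_mfderiv hqΦ (G q)
      have h5 : r (β q) • V (β q) = (show Euc m from mfderiv (IQ m) (IQ m) Φ q (G q)) := by
        rw [← hGe q hq.1, hev.mfderiv_eq]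
        rfl
      refine (congrArg (fun x : Euc m => (show Euc m from
        mfderiv (IQ m) (IQ m) Φ.symm (β q) x)) h5).trans ?_
      exact (mfderiv_apply_congr Φ.symm (h3 q hqΦ).symm _).trans h4
  refine ⟨W, fun p => ?_, ?_⟩
  · refine (tangent_to_faces_iff p (W p)).2 ?_
    by_cases hp : β p ∈ X
    · obtain ⟨U, hU, hpU, W', hWs, hW'⟩ := hβ.exists_lift_near_front hr V hp
      have h1 : W p = W' p := vectorField_eq_of_dense hβ.dense hU W.contMDiff_mk.contMDiffOn hWs
        (fun q hq => (hW q hq.1).trans (hGeq q hq.1 _ (hW' q hq.2).1).symm) hpU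
      rw [h1]
      exact (hW' p hpU).2 hp
    · refine (hβ.isLocalDiffeomorphAt hp).tangent_to_faces fun f hf hpos hf0 => ?_
      rw [hW p hp, hGe p hp]
      have h1 := (tangent_to_faces_iff (β p) (V (β p))).1 (hV (β p)) f hf hpos hf0
      refine (map_smul (mfderiv (IQ m) 𝓘(ℝ, ℝ) f (β p)) (r (β p)) (V (β p))).trans ?_
      exact (congrArg (fun x : ℝ => r (β p) * x) h1).trans (mul_zero _)
  · intro p
    by_cases hp : β p ∈ X
    · obtain ⟨U, hU, hpU, W', hWs, hW'⟩ := hβ.exists_lift_near_front hr V hp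
      have h1 : W p = W' p := vectorField_eq_of_dense hβ.dense hU W.contMDiff_mk.contMDiffOn hWs
        (fun q hq => (hW q hq.1).trans (hGeq q hq.1 _ (hW' q hq.2).1).symm) hpU
      rw [h1]
      exact (hW' p hpU).1
    · rw [hW p hp, hGe p hp]

end BlowupLift

/-! ### Iterated blow-ups -/

section IteratedBlowup

open Set Filter Bundle Manifold Topology

/-- The map `β` is a local diffeomorphism outside `S`, and after multiplication by `ρ` the vector
fields in `𝒱` lift to vector fields `W` tangent to the faces such that `W ρ` is a multiple of
`ρ`. -/
structure IsConformalLift {m : ℕ} {M P : Type*} [TopologicalSpace M]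
    [ChartedSpace (EuclideanQuadrant m) M] [IsManifold (IQ m) ∞ M] [TopologicalSpace P]
    [ChartedSpace (EuclideanQuadrant m) P] [IsManifold (IQ m) ∞ P]
    (𝒱 : Submodule (SmoothFun m M) (SmoothVF m M)) (β : P → M) (S : Set M) (ρ : P → ℝ) : Prop where
  compact : CompactSpace P
  isClosed : IsClosed S
  smooth : ContMDiff (IQ m) (IQ m) ∞ β
  localDiffeo : ∀ p, β p ∉ S → IsLocalDiffeomorphAt (IQ m) (IQ m) ∞ β p
  interior : ∀ p, (IQ m).IsInteriorPoint p → β p ∉ S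
  smooth_factor : ContMDiff (IQ m) 𝓘(ℝ, ℝ) ∞ ρ
  factor_ne_zero : ∀ p, β p ∉ S → ρ p ≠ 0
  lift : ∀ V ∈ 𝒱, ∃ W : SmoothVF m P, IsTangentToFaces W ∧
    (∀ p, mfderiv (IQ m) (IQ m) β p (W p) = ρ p • V (β p)) ∧
    ∃ a : SmoothFun m P, ∀ p, dirDeriv W ρ p = a p * ρ p

theorem dirDeriv_comp {m : ℕ} {M P : Type*} [TopologicalSpace M]
    [ChartedSpace (EuclideanQuadrant m) M] [TopologicalSpace P]
    [ChartedSpace (EuclideanQuadrant m) P] {β : P → M} {u : M → ℝ} {p : P}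
    {W : ∀ p : P, TangentSpace (IQ m) p} {V : ∀ x : M, TangentSpace (IQ m) x} {s : ℝ}
    (hβ : MDifferentiableAt (IQ m) (IQ m) β p)
    (hu : MDifferentiableAt (IQ m) 𝓘(ℝ, ℝ) u (β p))
    (h : mfderiv (IQ m) (IQ m) β p (W p) = s • V (β p)) :
    dirDeriv W (fun q => u (β q)) p = s * dirDeriv V u (β p) := by
  unfold dirDeriv
  have h1 := mfderiv_comp p hu hβ
  have h2 : mfderiv (IQ m) 𝓘(ℝ, ℝ) (fun q => u (β q)) p (W p) = _ := DFunLike.congr_fun h1 (W p)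
  rw [h2]
  refine (congrArg (fun x : Euc m => (show ℝ from mfderiv (IQ m) 𝓘(ℝ, ℝ) u (β p) x)) h).trans ?_
  exact map_smul (mfderiv (IQ m) 𝓘(ℝ, ℝ) u (β p)) s (V (β p))

variable {m : ℕ} {N : ℕ → Type*} [∀ l, TopologicalSpace (N l)]

/-- By induction, a lift is the closure of a subset of the preimage of `X i`, and this preimage is
closed. -/
theorem blowdown_mem_of_mem_liftFamily {k : ℕ} {β : ∀ l, N (l + 1) → N l} {X : ℕ → Set (N 0)}
    (hX : ∀ i < k, IsClosed (X i)) : ∀ l ≤ k, (∀ j < l, Continuous (β j)) → ∀ i < k,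
      ∀ p ∈ liftFamily β X l i, blowdown β l p ∈ X i := by
  intro l
  induction l with
  | zero => exact fun _ _ i _ p hp => hp
  | succ l ih =>
    intro hl hβ i hi p hp
    have hc : ∀ j ≤ l + 1, Continuous (blowdown β j) := by
      intro j
      induction j with
      | zero => exact fun _ => continuous_id
      | succ j ih => exact fun hj => (ih (by omega)).comp (hβ j (by omega))
    have hsub : β l ⁻¹' (liftFamily β X l i \ liftFamily β X l l) ⊆
        blowdown β (l + 1) ⁻¹' X i := fun q hq =>
      ih (by omega) (fun j hj => hβ j (by omega)) i hi _ hq.1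
    exact closure_minimal hsub ((hX i hi).preimage (hc _ le_rfl)) hp

/-- A point whose image avoids the earlier members has never met a centre, so nothing was removed
near it and it lies in the lift before closures are taken. This shows that interior points of `P` do
not lie over the singular set. -/
theorem mem_liftFamily_of_blowdown_mem {k : ℕ} {β : ∀ l, N (l + 1) → N l} {X : ℕ → Set (N 0)}
    (hX : ∀ i < k, IsClosed (X i)) : ∀ l ≤ k, (∀ j < l, Continuous (β j)) → ∀ i,
      ∀ p, blowdown β l p ∉ ⋃ j ∈ Iio l, X j → blowdown β l p ∈ X i → p ∈ liftFamily β X l i := by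
  intro l
  induction l with
  | zero => exact fun _ _ i p _ hp => hp
  | succ l ih =>
    intro hl hβ i p hp hpi
    simp only [mem_iUnion, mem_Iio, not_exists] at hp
    refine subset_closure ⟨ih (by omega) (fun j hj => hβ j (by omega)) i (β l p) ?_ hpi, fun h => ?_⟩
    · simp only [mem_iUnion, mem_Iio, not_exists]
      exact fun j hj => hp j (by omega)
    · exact hp l (by omega) (blowdown_mem_of_mem_liftFamily hX l (by omega)
        (fun j hj => hβ j (by omega)) l (by omega) _ h)

variable [∀ l, T2Space (N l)] [∀ l, ChartedSpace (EuclideanQuadrant m) (N l)]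
  [∀ l, IsManifold (IQ m) ∞ (N l)]

/-- Induction on the number of blow-ups, each step lifting `r_l W` for a lift `W` of `ρ V` found
before. Tangency of `W` to the faces is part of the induction, since `IsBlowup.exists_lift` requires
it. -/
theorem isConformalLift_blowdown {k : ℕ} (𝒱 : Submodule (SmoothFun m (N 0)) (SmoothVF m (N 0)))
    (hc : CompactSpace (N 0)) (h𝒱 : ∀ V ∈ 𝒱, IsTangentToFaces V)
    {X : ℕ → Set (N 0)} (hX : ∀ i < k, IsClosed (X i)) {β : ∀ l, N (l + 1) → N l}
    (hβ : ∀ l < k, IsBlowup m (liftFamily β X l l) (β l)) {r : ∀ l, N l → ℝ}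
    (hr : ∀ l < k, IsSmoothedDistance m (liftFamily β X l l) (r l)) :
    ∀ l ≤ k, IsConformalLift 𝒱 (blowdown β l) (⋃ i ∈ Iio l, X i) (rhoFun β r l) := by
  have hβc : ∀ l < k, Continuous (β l) := fun l hl => (hβ l hl).contMDiff.continuous
  intro l
  induction l with
  | zero =>
    intro _
    exact
      { compact := hc
        isClosed := by simp
        smooth := contMDiff_id
        localDiffeo := fun p _ => (Diffeomorph.refl (IQ m) (N 0) ∞).isLocalDiffeomorph p
        interior := by simp
        smooth_factor := contMDiff_const
        factor_ne_zero := fun p _ => one_ne_zero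
        lift := fun V hV => ⟨V, h𝒱 V hV, fun p => by
          change mfderiv (IQ m) (IQ m) id p (V p) = (1 : ℝ) • V p
          rw [mfderiv_id, one_smul]
          rfl, 0, fun p => by
            rw [show (0 : SmoothFun m (N 0)) p = 0 from rfl, zero_mul]
            exact dirDeriv_const _ 1 p⟩ }
  | succ l ih =>
    intro hl
    have hlk : l < k := hl
    have H := ih hlk.le
    have hB := hβ l hlk
    have hR := hr l hlk
    have hcl : ∀ j < l, Continuous (β j) := fun j hj => hβc j (hj.trans hlk)
    have hout : ∀ p : N (l + 1), blowdown β (l + 1) p ∉ ⋃ i ∈ Iio (l + 1), X i →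
        blowdown β l (β l p) ∉ (⋃ i ∈ Iio l, X i) ∧ β l p ∉ liftFamily β X l l := by
      intro p hp
      simp only [mem_iUnion, mem_Iio, not_exists] at hp ⊢
      exact ⟨fun j hj => hp j (by omega), fun h => hp l (by omega)
        (blowdown_mem_of_mem_liftFamily hX l hlk.le hcl l hlk _ h)⟩
    have := H.compact
    have hβd : ∀ p, MDifferentiableAt (IQ m) (IQ m) (β l) p :=
      fun p => hB.contMDiff.mdifferentiableAt (by simp)
    have hρs : ContMDiff (IQ m) 𝓘(ℝ, ℝ) ∞ (rhoFun β r (l + 1)) :=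
      (H.smooth_factor.comp hB.contMDiff).mul (hB.contMDiff_distance hR)
    refine
      { compact := hB.compactSpace
        isClosed := (finite_Iio (l + 1)).isClosed_biUnion fun i hi => hX i (by
          have := mem_Iio.1 hi; omega)
        smooth := H.smooth.comp hB.contMDiff
        localDiffeo := fun p hp => (hB.isLocalDiffeomorphAt (hout p hp).2).comp (IQ m) (N 0)
          (H.localDiffeo _ (hout p hp).1)
        interior := fun p hp => ?_
        smooth_factor := hρs
        factor_ne_zero := fun p hp => mul_ne_zero (H.factor_ne_zero _ (hout p hp).1)
          fun h0 => (hout p hp).2 ((hR.zero_iff _).1 h0)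
        lift := fun V hV => ?_ }
    · have h1 := hB.notMem_of_isInteriorPoint hp
      have h2 := H.interior _ ((hB.isInteriorPoint_iff h1).1 hp)
      intro h3
      simp only [mem_iUnion, mem_Iio, exists_prop] at h3
      obtain ⟨j, hj, hjX⟩ := h3
      rcases Nat.lt_succ_iff_lt_or_eq.1 hj with h4 | rfl
      · exact h2 (by
          simp only [mem_iUnion, mem_Iio, exists_prop]
          exact ⟨j, h4, hjX⟩)
      · exact h1 (mem_liftFamily_of_blowdown_mem hX j hlk.le hcl j _ h2 hjX)
    · obtain ⟨W, hWt, hW, a, ha⟩ := H.lift V hV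
      obtain ⟨W', hWt', hW'⟩ := hB.exists_lift hR hWt
      obtain ⟨a', ha'⟩ := hB.exists_dirDeriv_distance hR W
      refine ⟨W', hWt', fun p => ?_, ?_⟩
      · have h1 := mfderiv_comp p (H.smooth.mdifferentiableAt (by simp) (x := β l p)) (hβd p)
        refine (DFunLike.congr_fun h1 (W' p)).trans ?_
        refine (congrArg (fun x : Euc m => (show Euc m from
          mfderiv (IQ m) (IQ m) (blowdown β l) (β l p) x)) (hW' p)).trans ?_
        refine (map_smul (mfderiv (IQ m) (IQ m) (blowdown β l) (β l p)) (r l (β l p))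
          (W (β l p))).trans ?_
        refine (congrArg (fun x : Euc m => r l (β l p) • x) (hW (β l p))).trans ?_
        refine (smul_smul _ _ _).trans ?_
        rw [mul_comm]
        rfl
      · let B : C^∞⟮IQ m, N (l + 1); IQ m, N l⟯ := ⟨β l, hB.contMDiff⟩
        let R : SmoothFun m (N (l + 1)) := ⟨fun p => r l (β l p), hB.contMDiff_distance hR⟩
        let A : SmoothFun m (N (l + 1)) := ⟨fun p => a (β l p), a.contMDiff.comp hB.contMDiff⟩
        -- The product rule: `W' (ρ r) = ρ (r W r) + r (r W ρ)` with `W ρ = a ρ`, hence the quotient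
        -- `W r + r a`. It is checked off the front face, where `r` is differentiable on the base,
        -- and extended by density.
        refine ⟨R * A + a', fun p => ?_⟩
        refine eqOn_of_dense (f := dirDeriv W' (rhoFun β r (l + 1)))
          (g := fun p => (R * A + a') p * rhoFun β r (l + 1) p) hB.dense isOpen_univ
          (contMDiffOn_dirDeriv isOpen_univ W'.contMDiff_mk.contMDiffOn
            hρs.contMDiffOn).continuousOn
          (((R * A + a').contMDiff.continuous.mul hρs.continuous).continuousOn) ?_ (mem_univ p)
        rintro q ⟨hq, -⟩
        have hd1 : MDifferentiableAt (IQ m) 𝓘(ℝ, ℝ) (rhoFun β r l) (β l q) :=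
          H.smooth_factor.mdifferentiableAt (by simp)
        have hd2 : MDifferentiableAt (IQ m) 𝓘(ℝ, ℝ) (r l) (β l q) :=
          (hR.smooth.contMDiffAt (hB.isClosed.isOpen_compl.mem_nhds hq)).mdifferentiableAt (by simp)
        have h1 : dirDeriv W' (fun p => rhoFun β r l (β l p) * r l (β l p)) q = _ :=
          dirDeriv_mul (hd1.comp q (hβd q)) (hd2.comp q (hβd q))
        change dirDeriv W' (fun p => rhoFun β r l (β l p) * r l (β l p)) q = _
        rw [h1]
        change rhoFun β r l (β l q) * dirDeriv W' (fun p => r l (β l p)) q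
          + r l (β l q) * dirDeriv W' (fun p => rhoFun β r l (β l p)) q =
          (r l (β l q) * a (β l q) + a' q) * (rhoFun β r l (β l q) * r l (β l q))
        rw [dirDeriv_comp (hβd q) hd2 (hW' q), dirDeriv_comp (hβd q) hd1 (hW' q), ha, ha' q hq]
        ring

end IteratedBlowup

/-! ### The fibres of the bundle of a module of vector fields -/

section Fibres

open Set

variable {m : ℕ} {M : Type*} [TopologicalSpace M] [ChartedSpace (EuclideanQuadrant m) M]
  [IsManifold (IQ m) ∞ M] {𝒱 : Submodule (SmoothFun m M) (SmoothVF m M)}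

theorem SmoothVF.real_smul_eq (c : ℝ) (v : 𝒱) :
    c • v = (algebraMap ℝ (SmoothFun m M) c) • v := by
  rw [algebraMap_smul]

theorem AFiber.mk_smul (f : SmoothFun m M) (v : 𝒱) (x : M) :
    AFiber.mk 𝒱 x (f • v) = f x • AFiber.mk 𝒱 x v := by
  rw [← map_smul, ← sub_eq_zero, ← map_sub]
  refine (Submodule.Quotient.mk_eq_zero _).2 ?_
  rw [Submodule.restrictScalars_mem, SmoothVF.real_smul_eq]
  have h : f • v - algebraMap ℝ (SmoothFun m M) (f x) • v
      = (f - algebraMap ℝ (SmoothFun m M) (f x)) • v := (sub_smul _ _ _).symm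
  rw [h]
  refine Submodule.smul_mem_smul ?_ Submodule.mem_top
  change f x - algebraMap ℝ (SmoothFun m M) (f x) x = 0
  exact sub_self (f x)

theorem AFiber.mk_surjective (x : M) : Function.Surjective (AFiber.mk 𝒱 x) :=
  Submodule.mkQ_surjective _

@[simp] theorem anchor_mk (v : 𝒱) (x : M) : anchor 𝒱 x (AFiber.mk 𝒱 x v) = (v : SmoothVF m M) x :=
  rfl

/-- Maps out of a fibre, given on sections. -/
def AFiber.lift {F : Type*} [AddCommGroup F] [Module ℝ F] (x : M) (φ : 𝒱 →ₗ[ℝ] F)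
    (hφ : ∀ (f : SmoothFun m M) (v : 𝒱), f x = 0 → φ (f • v) = 0) : AFiber 𝒱 x →ₗ[ℝ] F :=
  Submodule.liftQ _ φ <| by
    intro V hV
    rw [Submodule.restrictScalars_mem] at hV
    rw [LinearMap.mem_ker]
    induction hV using Submodule.smul_induction_on' with
    | smul f hf W _ => exact hφ f W hf
    | add V _ W _ hV hW => rw [map_add, hV, hW, add_zero]

/-- A finite family of generators `V_i` of a projective module with coordinate functions `coord i`
such that `v = ∑ i, coord i v • V_i`. -/
structure DualFrame (𝒱 : Submodule (SmoothFun m M) (SmoothVF m M)) (n : ℕ) where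
  vec : Fin n → 𝒱
  coord : Fin n → 𝒱 →ₗ[SmoothFun m M] SmoothFun m M
  sum_coord_smul : ∀ v, ∑ i, coord i v • vec i = v

/-- The dual basis lemma: a projection of a finite free module onto `𝒱` is split. These global,
redundant generators replace local frames of the bundle in everything that follows. -/
theorem exists_dualFrame (hf : Module.Finite (SmoothFun m M) 𝒱)
    (hp : Module.Projective (SmoothFun m M) 𝒱) : ∃ n, Nonempty (DualFrame 𝒱 n) := by
  obtain ⟨n, f, g, -, -, hfg⟩ :=
    Module.Finite.exists_comp_eq_id_of_projective (SmoothFun m M) 𝒱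
  refine ⟨n, ⟨fun i => f (Pi.single i 1), fun i => (LinearMap.proj i).comp g, fun v => ?_⟩⟩
  have := LinearMap.congr_fun hfg v
  simp only [LinearMap.comp_apply, LinearMap.id_apply] at this
  conv_rhs => rw [← this, ← Finset.univ_sum_single (g v), map_sum]
  refine Finset.sum_congr rfl fun i _ => ?_
  rw [LinearMap.comp_apply, ← map_smul]
  congr 1
  ext j
  by_cases h : j = i
  · subst h; simp
  · simp [h]

namespace DualFrame

variable {n : ℕ} (E : DualFrame 𝒱 n)

theorem finite (E : DualFrame 𝒱 n) : Module.Finite (SmoothFun m M) 𝒱 := by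
  refine Module.Finite.of_surjective
    (Fintype.linearCombination (SmoothFun m M) E.vec) fun v => ⟨fun i => E.coord i v, ?_⟩
  rw [Fintype.linearCombination_apply]
  exact E.sum_coord_smul v

theorem projective (E : DualFrame 𝒱 n) : Module.Projective (SmoothFun m M) 𝒱 := by
  refine Module.Projective.of_split (LinearMap.pi E.coord)
    (Fintype.linearCombination (SmoothFun m M) E.vec) (LinearMap.ext fun v => ?_)
  rw [LinearMap.comp_apply, Fintype.linearCombination_apply]
  exact E.sum_coord_smul v

theorem sum_coord_smul_mk (v : 𝒱) (x : M) :
    ∑ i, E.coord i v x • AFiber.mk 𝒱 x (E.vec i) = AFiber.mk 𝒱 x v := by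
  conv_rhs => rw [← E.sum_coord_smul v, map_sum]
  exact Finset.sum_congr rfl fun i _ => (AFiber.mk_smul _ _ _).symm

theorem sum_coord_smul_apply (v : 𝒱) (x : M) :
    ∑ i, E.coord i v x • (E.vec i : SmoothVF m M) x = (v : SmoothVF m M) x := by
  have := congrArg (anchor 𝒱 x) (E.sum_coord_smul_mk v x)
  rw [map_sum] at this
  simpa only [map_smul, anchor_mk] using this

/-- The coordinate functions on a fibre. -/
def fibreCoord (i : Fin n) (x : M) : AFiber 𝒱 x →ₗ[ℝ] ℝ :=
  AFiber.lift x
    { toFun := fun v => E.coord i v x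
      map_add' := fun v w => by rw [map_add]; rfl
      map_smul' := fun c v => by
        rw [SmoothVF.real_smul_eq, map_smul]
        rfl }
    fun f v hf => by
      change E.coord i (f • v) x = 0
      rw [map_smul]
      change f x * _ = 0
      rw [hf, zero_mul]

@[simp] theorem fibreCoord_mk (i : Fin n) (x : M) (v : 𝒱) :
    E.fibreCoord i x (AFiber.mk 𝒱 x v) = E.coord i v x := rfl

theorem sum_fibreCoord_smul (x : M) (a : AFiber 𝒱 x) :
    ∑ i, E.fibreCoord i x a • AFiber.mk 𝒱 x (E.vec i) = a := by
  obtain ⟨v, rfl⟩ := AFiber.mk_surjective x a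
  exact E.sum_coord_smul_mk v x

theorem eq_zero_of_fibreCoord {x : M} {a : AFiber 𝒱 x} (h : ∀ i, E.fibreCoord i x a = 0) :
    a = 0 := by
  rw [← E.sum_fibreCoord_smul x a]
  exact Finset.sum_eq_zero fun i _ => by rw [h i, zero_smul]

end DualFrame

end Fibres

/-! ### Brackets of sections -/

section Brackets

open Set

variable {m : ℕ} {M : Type*} [TopologicalSpace M] [ChartedSpace (EuclideanQuadrant m) M]
  [IsManifold (IQ m) ∞ M]

theorem SmoothVF.bracket_swap (V W : SmoothVF m M) : V.bracket W = -W.bracket V := by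
  ext1 x
  exact VectorField.mlieBracket_swap_apply

theorem SmoothVF.bracket_add (V W W' : SmoothVF m M) :
    V.bracket (W + W') = V.bracket W + V.bracket W' := by
  ext1 x
  exact VectorField.mlieBracket_add_right (W.mdifferentiableAt_mk x) (W'.mdifferentiableAt_mk x)

theorem SmoothVF.bracket_smul (V W : SmoothVF m M) (f : SmoothFun m M) :
    V.bracket (f • W) = V.deriv f • W + f • V.bracket W := by
  ext1 x
  exact VectorField.mlieBracket_smul_right f.mdifferentiableAt (W.mdifferentiableAt_mk x)

theorem SmoothVF.bracket_zero (V : SmoothVF m M) : V.bracket 0 = 0 := by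
  ext1 x
  exact congrFun VectorField.mlieBracket_zero_right x

/-- A module is closed under brackets if the brackets of its generators belong to it. -/
theorem SmoothVF.bracket_mem_span {s : Set (SmoothVF m M)}
    (hs : ∀ V ∈ s, ∀ W ∈ s, V.bracket W ∈ Submodule.span (SmoothFun m M) s)
    {V W : SmoothVF m M} (hV : V ∈ Submodule.span (SmoothFun m M) s)
    (hW : W ∈ Submodule.span (SmoothFun m M) s) :
    V.bracket W ∈ Submodule.span (SmoothFun m M) s := by
  have key : ∀ V : SmoothVF m M, (∀ W ∈ s, V.bracket W ∈ Submodule.span (SmoothFun m M) s) →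
      ∀ W ∈ Submodule.span (SmoothFun m M) s, V.bracket W ∈ Submodule.span (SmoothFun m M) s := by
    intro V hV W hW
    induction hW using Submodule.span_induction with
    | mem W hW => exact hV W hW
    | zero => rw [SmoothVF.bracket_zero]; exact zero_mem _
    | add W W' _ _ h h' => rw [SmoothVF.bracket_add]; exact add_mem h h'
    | smul f W hW h =>
      rw [SmoothVF.bracket_smul]
      exact add_mem (Submodule.smul_mem _ _ hW) (Submodule.smul_mem _ _ h)
  refine key V (fun W hW => ?_) W hW
  rw [SmoothVF.bracket_swap]
  exact neg_mem (key W (hs W hW) V hV)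

end Brackets

/-! ### The lifted module -/

namespace IsConformalLift

open Set

variable {m : ℕ} {M P : Type*} [TopologicalSpace M] [ChartedSpace (EuclideanQuadrant m) M]
  [IsManifold (IQ m) ∞ M] [TopologicalSpace P] [ChartedSpace (EuclideanQuadrant m) P]
  [IsManifold (IQ m) ∞ P] {𝒱 : Submodule (SmoothFun m M) (SmoothVF m M)} {β : P → M} {S : Set M}
  {ρ : P → ℝ} (H : IsConformalLift 𝒱 β S ρ) {n : ℕ} (E : DualFrame 𝒱 n)

theorem dense (H : IsConformalLift 𝒱 β S ρ) : Dense {p : P | β p ∉ S} :=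
  dense_interior_quadrant.mono fun p hp => H.interior p hp

theorem isOpen (H : IsConformalLift 𝒱 β S ρ) : IsOpen {p : P | β p ∉ S} :=
  H.isClosed.isOpen_compl.preimage H.smooth.continuous

theorem isInteriorPoint_iff (H : IsConformalLift 𝒱 β S ρ) {p : P} (hp : β p ∉ S) :
    (IQ m).IsInteriorPoint p ↔ (IQ m).IsInteriorPoint (β p) :=
  (H.localDiffeo p hp).isInteriorPoint_iff (by simp)

theorem mfderiv_injective (H : IsConformalLift 𝒱 β S ρ) {p : P} (hp : β p ∉ S) :
    Function.Injective (mfderiv (IQ m) (IQ m) β p) :=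
  (H.localDiffeo p hp).mfderiv_injective

theorem ext (H : IsConformalLift 𝒱 β S ρ) {W W' : SmoothVF m P}
    (h : ∀ p, β p ∉ S → mfderiv (IQ m) (IQ m) β p (W p) = mfderiv (IQ m) (IQ m) β p (W' p)) :
    W = W' :=
  SmoothVF.ext_of_dense H.dense fun p hp => H.mfderiv_injective hp (h p hp)

/-- Pull-back of functions. -/
def pull (f : SmoothFun m M) : SmoothFun m P :=
  ⟨fun p => f (β p), f.contMDiff.comp H.smooth⟩

@[simp] theorem pull_apply (f : SmoothFun m M) (p : P) : H.pull f p = f (β p) := rfl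

/-- The lift of `ρ V`. -/
def upVF (v : 𝒱) : SmoothVF m P := (H.lift v v.2).choose

theorem upVF_tangent (v : 𝒱) : IsTangentToFaces (H.upVF v) := (H.lift v v.2).choose_spec.1

theorem mfderiv_upVF (v : 𝒱) (p : P) :
    mfderiv (IQ m) (IQ m) β p (H.upVF v p) = ρ p • (v : SmoothVF m M) (β p) :=
  (H.lift v v.2).choose_spec.2.1 p

/-- The quotient of the derivative of `ρ` along the lift of `ρ V` and of `ρ`. -/
def logDeriv (v : 𝒱) : SmoothFun m P := (H.lift v v.2).choose_spec.2.2.choose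

theorem dirDeriv_upVF_factor (v : 𝒱) (p : P) :
    dirDeriv (H.upVF v) ρ p = H.logDeriv v p * ρ p :=
  (H.lift v v.2).choose_spec.2.2.choose_spec p

/-- The lift of `ρ V` as an element of the lifted module. -/
def up (v : 𝒱) : blownUpModule 𝒱 β S ρ :=
  ⟨H.upVF v, Submodule.subset_span ⟨v, v.2, fun p _ => H.mfderiv_upVF v p⟩⟩

@[simp] theorem coe_up (v : 𝒱) : (H.up v : SmoothVF m P) = H.upVF v := rfl

/-- Lifts are unique, since they are determined on a dense set where `dβ` is injective. So the
generators in the definition are exactly the fields `upVF v`. -/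
theorem blownUpModule_eq_span :
    blownUpModule 𝒱 β S ρ = Submodule.span (SmoothFun m P) (range H.upVF) := by
  unfold blownUpModule
  congr 1
  ext W
  constructor
  · rintro ⟨V, hV, h⟩
    exact ⟨⟨V, hV⟩, H.ext fun p hp => (H.mfderiv_upVF ⟨V, hV⟩ p).trans (h p hp).symm⟩
  · rintro ⟨v, rfl⟩
    exact ⟨v, v.2, fun p _ => H.mfderiv_upVF v p⟩

theorem mfderiv_sum_smul_upVF (c : Fin n → SmoothFun m P) (v : Fin n → 𝒱) (p : P) :
    mfderiv (IQ m) (IQ m) β p ((∑ j, c j • H.upVF (v j)) p) =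
      ρ p • ∑ j, c j p • (v j : SmoothVF m M) (β p) := by
  have h1 : (∑ j, c j • H.upVF (v j)) p = ∑ j, c j p • H.upVF (v j) p := by
    have := map_sum (evalVF (⊤ : Submodule (SmoothFun m P) (SmoothVF m P)) p)
      (fun j => (⟨c j • H.upVF (v j), trivial⟩ : (⊤ : Submodule (SmoothFun m P) (SmoothVF m P))))
      Finset.univ
    refine Eq.trans ?_ this
    change _ = ((_ : (⊤ : Submodule (SmoothFun m P) (SmoothVF m P))) : SmoothVF m P) p
    rw [Submodule.coe_sum]
  rw [h1, map_sum, Finset.smul_sum]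
  refine Finset.sum_congr rfl fun j _ => ?_
  rw [smul_comm (ρ p), ← H.mfderiv_upVF (v j) p]
  exact map_smul (mfderiv (IQ m) (IQ m) β p) (c j p) (H.upVF (v j) p)

theorem upVF_eq_sum (v : 𝒱) :
    ∑ i, H.pull (E.coord i v) • H.upVF (E.vec i) = H.upVF v := by
  refine H.ext fun p _ => ?_
  rw [H.mfderiv_sum_smul_upVF, H.mfderiv_upVF, ← E.sum_coord_smul_apply v (β p)]
  rfl

theorem exists_eq_sum (W : blownUpModule 𝒱 β S ρ) :
    ∃ c : Fin n → SmoothFun m P, ∑ j, c j • H.up (E.vec j) = W := by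
  have h : (W : SmoothVF m P) ∈ Submodule.span (SmoothFun m P)
      (range fun i => H.upVF (E.vec i)) := by
    refine Submodule.span_le.2 ?_ (H.blownUpModule_eq_span.le W.2)
    rintro _ ⟨v, rfl⟩
    rw [← H.upVF_eq_sum E v]
    exact Submodule.sum_mem _ fun i _ =>
      Submodule.smul_mem _ _ (Submodule.subset_span (mem_range_self i))
  obtain ⟨c, hc⟩ := Submodule.mem_span_range_iff_exists_fun _ |>.1 h
  refine ⟨c, Subtype.ext ?_⟩
  rw [Submodule.coe_sum]
  exact hc

/-- Over the interior `ρ ≠ 0` and the anchor is injective, so a relation among the lifts is a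
relation among the `V_j` in `A`, to which the coordinates can be applied. Density gives it on all of
`P`. Thus coordinates on the lifted module do not depend on the representation of an element. -/
theorem sum_mul_pull_eq_zero (hinj : ∀ x ∈ (IQ m).interior M, Function.Injective (anchor 𝒱 x))
    {c : Fin n → SmoothFun m P} (hc : ∑ j, c j • H.up (E.vec j) = 0) (i : Fin n) :
    ∑ j, c j * H.pull (E.coord i (E.vec j)) = 0 := by
  refine SmoothFun.ext_of_dense (dense_interior_quadrant (m := m)) fun p hp => ?_
  have hpS := H.interior p hp
  have h1 := H.mfderiv_sum_smul_upVF c E.vec p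
  have h2 : (∑ j, c j • H.upVF (E.vec j)) = 0 := by
    have := congrArg (fun W : blownUpModule 𝒱 β S ρ => (W : SmoothVF m P)) hc
    rw [Submodule.coe_sum] at this
    exact this
  rw [h2] at h1
  have h3 : ∑ j, c j p • AFiber.mk 𝒱 (β p) (E.vec j) = 0 := by
    apply hinj _ ((H.isInteriorPoint_iff hpS).1 hp)
    rw [map_zero, map_sum]
    have h4 : ρ p • ∑ j, c j p • (E.vec j : SmoothVF m M) (β p) = 0 :=
      h1.symm.trans (map_zero (mfderiv (IQ m) (IQ m) β p))
    simpa only [map_smul, anchor_mk] using (smul_eq_zero.1 h4).resolve_left (H.factor_ne_zero p hpS)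
  have h5 := congrArg (E.fibreCoord i (β p)) h3
  rw [map_zero, map_sum] at h5
  simp only [map_smul, E.fibreCoord_mk, smul_eq_mul] at h5
  have h6 : ∀ (s : Finset (Fin n)) (F : Fin n → SmoothFun m P), (∑ j ∈ s, F j) p = ∑ j ∈ s, F j p :=
    fun s F => map_sum (ContMDiffMap.evalRingHom p : SmoothFun m P →+* ℝ) F s
  rw [h6]
  exact h5

theorem sum_mul_pull_eq (hinj : ∀ x ∈ (IQ m).interior M, Function.Injective (anchor 𝒱 x))
    {c c' : Fin n → SmoothFun m P}
    (hc : ∑ j, c j • H.up (E.vec j) = ∑ j, c' j • H.up (E.vec j)) (i : Fin n) :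
    ∑ j, c j * H.pull (E.coord i (E.vec j)) = ∑ j, c' j * H.pull (E.coord i (E.vec j)) := by
  rw [← sub_eq_zero, ← Finset.sum_sub_distrib]
  rw [← sub_eq_zero, ← Finset.sum_sub_distrib] at hc
  have h : ∑ j, (c - c') j • H.up (E.vec j) = 0 := by
    rw [← hc]
    exact Finset.sum_congr rfl fun j _ => sub_smul (c j) (c' j) (H.up (E.vec j))
  rw [← H.sum_mul_pull_eq_zero E hinj h i]
  exact Finset.sum_congr rfl fun j _ => (sub_mul _ _ _).symm

/-- The lifts of `ρ V_i` with their coordinate functions. -/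
def dualFrame (hinj : ∀ x ∈ (IQ m).interior M, Function.Injective (anchor 𝒱 x)) :
    DualFrame (blownUpModule 𝒱 β S ρ) n where
  vec i := H.up (E.vec i)
  coord i :=
    -- An arbitrary representation `W = ∑ c_j W_j` is chosen and the pulled back coordinates are
    -- extended linearly. Additivity and linearity hold since the result is independent of the
    -- choice.
    { toFun := fun W => ∑ j, (H.exists_eq_sum E W).choose j * H.pull (E.coord i (E.vec j))
      map_add' := fun W W' => by
        rw [← Finset.sum_add_distrib, H.sum_mul_pull_eq E hinj (c' :=
          (H.exists_eq_sum E W).choose + (H.exists_eq_sum E W').choose)]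
        · exact Finset.sum_congr rfl fun j _ => add_mul _ _ _
        · rw [(H.exists_eq_sum E (W + W')).choose_spec]
          conv_lhs => rw [← (H.exists_eq_sum E W).choose_spec, ← (H.exists_eq_sum E W').choose_spec]
          rw [← Finset.sum_add_distrib]
          exact Finset.sum_congr rfl fun j _ => (add_smul _ _ _).symm
      map_smul' := fun f W => by
        rw [H.sum_mul_pull_eq E hinj (c' := f • (H.exists_eq_sum E W).choose)]
        · rw [RingHom.id_apply, Finset.smul_sum]
          exact Finset.sum_congr rfl fun j _ => mul_assoc f _ _
        · rw [(H.exists_eq_sum E (f • W)).choose_spec]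
          conv_lhs => rw [← (H.exists_eq_sum E W).choose_spec]
          rw [Finset.smul_sum]
          exact Finset.sum_congr rfl fun j _ => (smul_assoc _ _ _).symm }
  sum_coord_smul W := by
    change ∑ i, (∑ j, (H.exists_eq_sum E W).choose j * H.pull (E.coord i (E.vec j))) •
      H.up (E.vec i) = W
    conv_rhs => rw [← (H.exists_eq_sum E W).choose_spec]
    simp only [Finset.sum_smul]
    rw [Finset.sum_comm]
    refine Finset.sum_congr rfl fun j _ => ?_
    have h1 : ∑ i, H.pull (E.coord i (E.vec j)) • H.up (E.vec i) = H.up (E.vec j) :=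
      Subtype.ext (by rw [Submodule.coe_sum]; exact H.upVF_eq_sum E (E.vec j))
    conv_rhs => rw [← h1, Finset.smul_sum]
    exact Finset.sum_congr rfl fun i _ => mul_smul _ _ _

theorem dualFrame_vec (hinj : ∀ x ∈ (IQ m).interior M, Function.Injective (anchor 𝒱 x))
    (i : Fin n) : (H.dualFrame E hinj).vec i = H.up (E.vec i) := rfl

theorem dualFrame_coord_up (hinj : ∀ x ∈ (IQ m).interior M, Function.Injective (anchor 𝒱 x))
    (i : Fin n) (v : 𝒱) : (H.dualFrame E hinj).coord i (H.up v) = H.pull (E.coord i v) := by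
  change ∑ j, (H.exists_eq_sum E (H.up v)).choose j * H.pull (E.coord i (E.vec j)) = _
  rw [H.sum_mul_pull_eq E hinj (c' := fun j => H.pull (E.coord j v))]
  · have h := congrArg (E.coord i) (E.sum_coord_smul v)
    rw [map_sum] at h
    rw [← h]
    ext p
    have h6 : ∀ (F : Fin n → SmoothFun m P), (∑ j, F j) p = ∑ j, F j p :=
      fun F => map_sum (ContMDiffMap.evalRingHom p : SmoothFun m P →+* ℝ) F _
    have h7 : ∀ (F : Fin n → SmoothFun m M), (∑ j, F j) (β p) = ∑ j, F j (β p) :=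
      fun F => map_sum (ContMDiffMap.evalRingHom (β p) : SmoothFun m M →+* ℝ) F _
    rw [h6, H.pull_apply, h7]
    refine Finset.sum_congr rfl fun j _ => ?_
    rw [map_smul]
    rfl
  · rw [(H.exists_eq_sum E (H.up v)).choose_spec]
    refine Subtype.ext ?_
    rw [Submodule.coe_sum]
    exact (H.upVF_eq_sum E v).symm

/-! ### The isomorphism of the fibres of `B` and `β^* A`. -/

section FibreMap

variable (hinj : ∀ x ∈ (IQ m).interior M, Function.Injective (anchor 𝒱 x))

/-- The isomorphism of the fibres that takes the lift of `ρ V` to `V`. -/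
def fibreMap (p : P) : AFiber (blownUpModule 𝒱 β S ρ) p →ₗ[ℝ] AFiber 𝒱 (β p) :=
  ∑ i, ((H.dualFrame E hinj).fibreCoord i p).smulRight (AFiber.mk 𝒱 (β p) (E.vec i))

theorem fibreMap_mk_up (p : P) (v : 𝒱) :
    H.fibreMap E hinj p (AFiber.mk _ p (H.up v)) = AFiber.mk 𝒱 (β p) v := by
  unfold fibreMap
  rw [LinearMap.sum_apply]
  simp only [LinearMap.smulRight_apply, DualFrame.fibreCoord_mk, dualFrame_coord_up, pull_apply]
  exact E.sum_coord_smul_mk v (β p)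

theorem fibreMap_surjective (p : P) : Function.Surjective (H.fibreMap E hinj p) := fun b => by
  obtain ⟨v, rfl⟩ := AFiber.mk_surjective _ b
  exact ⟨_, H.fibreMap_mk_up E hinj p v⟩

theorem fibreCoord_fibreMap (p : P) (a : AFiber (blownUpModule 𝒱 β S ρ) p) (i : Fin n) :
    E.fibreCoord i (β p) (H.fibreMap E hinj p a) = (H.dualFrame E hinj).fibreCoord i p a := by
  conv_lhs => rw [← (H.dualFrame E hinj).sum_fibreCoord_smul p a]
  conv_rhs => rw [← (H.dualFrame E hinj).sum_fibreCoord_smul p a]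
  simp only [map_sum, map_smul, dualFrame_vec, fibreMap_mk_up, DualFrame.fibreCoord_mk,
    dualFrame_coord_up, pull_apply]

theorem fibreMap_injective (p : P) : Function.Injective (H.fibreMap E hinj p) := by
  rw [injective_iff_map_eq_zero]
  intro a ha
  refine (H.dualFrame E hinj).eq_zero_of_fibreCoord fun i => ?_
  rw [← H.fibreCoord_fibreMap, ha, map_zero]

/-- Under `B ≅ β^* A` the anchor of `B` is `ρ` times that of `A`. This is the origin of the factor
`ρ⁻²` in the metric, and it makes the anchor of `B` bijective over the interior. -/
theorem mfderiv_anchor (p : P) (a : AFiber (blownUpModule 𝒱 β S ρ) p) :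
    mfderiv (IQ m) (IQ m) β p (anchor _ p a) = ρ p • anchor 𝒱 (β p) (H.fibreMap E hinj p a) := by
  rw [← (H.dualFrame E hinj).sum_fibreCoord_smul p a]
  simp only [map_sum, map_smul, dualFrame_vec, fibreMap_mk_up, anchor_mk, Finset.smul_sum, coe_up]
  refine Finset.sum_congr rfl fun i _ => ?_
  rw [smul_comm (ρ p)]
  exact congrArg (fun t : Euc m => (H.dualFrame E hinj).fibreCoord i p a • t)
    (H.mfderiv_upVF (E.vec i) p)

end FibreMap

theorem anchor_bijective (H : IsConformalLift 𝒱 β S ρ) (E : DualFrame 𝒱 n)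
    (hbij : ∀ x ∈ (IQ m).interior M, Function.Bijective (anchor 𝒱 x))
    {p : P} (hp : p ∈ (IQ m).interior P) :
    Function.Bijective (anchor (blownUpModule 𝒱 β S ρ) p) := by
  have hinj := fun x hx => (hbij x hx).1
  have hpS := H.interior p hp
  have hb := hbij (β p) ((H.isInteriorPoint_iff hpS).1 hp)
  have hρ := H.factor_ne_zero p hpS
  constructor
  · rw [injective_iff_map_eq_zero]
    intro a ha
    have h1 := H.mfderiv_anchor E hinj p a
    have h2 : ρ p • anchor 𝒱 (β p) (H.fibreMap E hinj p a) = 0 := by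
      rw [← h1, ha, map_zero]
    have h3 := (smul_eq_zero.1 h2).resolve_left hρ
    apply H.fibreMap_injective E hinj p
    rw [map_zero]
    exact hb.1 (h3.trans (map_zero _).symm)
  · intro t
    obtain ⟨b, hb⟩ := hb.2 ((ρ p)⁻¹ • mfderiv (IQ m) (IQ m) β p t)
    obtain ⟨a, rfl⟩ := H.fibreMap_surjective E hinj p b
    refine ⟨a, H.mfderiv_injective hpS ?_⟩
    rw [H.mfderiv_anchor E hinj p a, hb, smul_smul, mul_inv_cancel₀ hρ, one_smul]

theorem isTangentToFaces (H : IsConformalLift 𝒱 β S ρ) {W : SmoothVF m P}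
    (hW : W ∈ blownUpModule 𝒱 β S ρ) :
    IsTangentToFaces W := by
  rw [H.blownUpModule_eq_span] at hW
  induction hW using Submodule.span_induction with
  | mem W hW => obtain ⟨v, rfl⟩ := hW; exact H.upVF_tangent v
  | zero => intro x i _; rfl
  | add W W' _ _ h h' =>
    intro x i hi
    change (show Euc m from W x) i + (show Euc m from W' x) i = 0
    rw [h x i hi, h' x i hi, add_zero]
  | smul f W _ h =>
    intro x i hi
    change f x * (show Euc m from W x) i = 0
    rw [h x i hi, mul_zero]

end IsConformalLift

/-! ### The lifted Lie manifold -/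

namespace IsConformalLift

open Set Filter Topology

variable {m : ℕ} {M P : Type*} [TopologicalSpace M] [ChartedSpace (EuclideanQuadrant m) M]
  [IsManifold (IQ m) ∞ M] [TopologicalSpace P] [ChartedSpace (EuclideanQuadrant m) P]
  [IsManifold (IQ m) ∞ P] {𝒱 : Submodule (SmoothFun m M) (SmoothVF m M)} {β : P → M} {S : Set M}
  {ρ : P → ℝ}

theorem eq_smul_mpullback (H : IsConformalLift 𝒱 β S ρ) (v : 𝒱) {p : P} (hp : β p ∉ S) :
    H.upVF v p = ρ p • VectorField.mpullback (IQ m) (IQ m) β (v : SmoothVF m M) p := by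
  have e := (H.localDiffeo p hp).mfderivToContinuousLinearEquiv (by simp)
  refine H.mfderiv_injective hp ?_
  rw [H.mfderiv_upVF, map_smul, VectorField.mpullback_apply]
  congr 1
  have hinv : (mfderiv (IQ m) (IQ m) β p).IsInvertible :=
    ⟨(H.localDiffeo p hp).mfderivToContinuousLinearEquiv (by simp), rfl⟩
  exact (hinv.self_apply_inverse _).symm

/-- The conformal factor as a smooth function. -/
def factor (H : IsConformalLift 𝒱 β S ρ) : SmoothFun m P := ⟨ρ, H.smooth_factor⟩

/-- On the dense set where `dβ` is invertible this is `[ρ V, ρ V'] = ρ² [V, V'] + ρ (V ρ) V' - ρ (V'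
ρ) V`. There the logarithmic derivative of `ρ` along the lift of `ρ V` is `V ρ`. -/
theorem bracket_upVF (H : IsConformalLift 𝒱 β S ρ) (v v' w : 𝒱)
    (hw : ∀ x, (w : SmoothVF m M) x =
      VectorField.mlieBracket (IQ m) (v : SmoothVF m M) (v' : SmoothVF m M) x) :
    (H.upVF v).bracket (H.upVF v') = H.factor • H.upVF w
      + H.logDeriv v • H.upVF v' - H.logDeriv v' • H.upVF v := by
  refine SmoothVF.ext_of_dense H.dense fun p hp => ?_
  set V := VectorField.mpullback (IQ m) (IQ m) β (v : SmoothVF m M) with hV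
  set V' := VectorField.mpullback (IQ m) (IQ m) β (v' : SmoothVF m M) with hV'
  have hnear : ∀ u : 𝒱, ∀ᶠ q in 𝓝 p, H.upVF u q =
      (ρ • VectorField.mpullback (IQ m) (IQ m) β (u : SmoothVF m M)) q := fun u => by
    filter_upwards [H.isOpen.mem_nhds hp] with q hq using H.eq_smul_mpullback u hq
  -- The pull-back of the field is `ρ⁻¹` times its smooth lift, and `ρ` does not vanish near `p`.
  have hsm : ∀ u : 𝒱, MDifferentiableAt (IQ m) (IQ m).tangent (fun q =>
      (⟨q, VectorField.mpullback (IQ m) (IQ m) β (u : SmoothVF m M) q⟩ : TangentBundle (IQ m) P)) p := by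
    intro u
    have h1 : ContMDiffOn (IQ m) (IQ m).tangent ∞
        (fun q => (⟨q, (ρ q)⁻¹ • H.upVF u q⟩ : TangentBundle (IQ m) P)) {q | β q ∉ S} := by
      refine ContMDiffOn.smul_section ?_ (H.upVF u).contMDiff_mk.contMDiffOn
      exact H.smooth_factor.contMDiffOn.inv₀ fun q hq => H.factor_ne_zero q hq
    refine ((h1.contMDiffAt (H.isOpen.mem_nhds hp)).mdifferentiableAt (by simp)).congr_of_eventuallyEq ?_
    filter_upwards [H.isOpen.mem_nhds hp] with q hq
    rw [H.eq_smul_mpullback u hq, smul_smul, inv_mul_cancel₀ (H.factor_ne_zero q hq), one_smul]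
  have hρ : MDifferentiableAt (IQ m) 𝓘(ℝ, ℝ) ρ p := H.smooth_factor.mdifferentiableAt (by simp)
  have h1 : VectorField.mlieBracket (IQ m) (H.upVF v) (H.upVF v') p =
      VectorField.mlieBracket (IQ m) (ρ • V) (ρ • V') p :=
    Filter.EventuallyEq.mlieBracket_vectorField_eq (hnear v) (hnear v')
  have h2 : VectorField.mlieBracket (IQ m) V V' p =
      VectorField.mpullback (IQ m) (IQ m) β (w : SmoothVF m M) p := by
    rw [hV, hV', ← VectorField.mpullback_mlieBracket (n := ∞) ((v : SmoothVF m M).mdifferentiableAt_mk _)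
      ((v' : SmoothVF m M).mdifferentiableAt_mk _) H.smooth.contMDiffAt (by
        rw [minSmoothness_of_isRCLikeNormedField]
        exact WithTop.coe_le_coe.2 le_top)]
    rw [VectorField.mpullback_apply, VectorField.mpullback_apply, hw]
  have h3 : ∀ u : 𝒱, ρ p * dirDeriv (VectorField.mpullback (IQ m) (IQ m) β (u : SmoothVF m M)) ρ p
      = H.logDeriv u p * ρ p := fun u => by
    rw [← H.dirDeriv_upVF_factor, ← dirDeriv_smul_left]
    exact (dirDeriv_congr_left (H.eq_smul_mpullback u hp)).symm
  have h4 : VectorField.mlieBracket (IQ m) (ρ • V) (ρ • V') p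
      = - (dirDeriv (ρ • V') ρ p) • V p
        + ρ p • ((dirDeriv V ρ p) • V' p + ρ p • VectorField.mlieBracket (IQ m) V V' p) := by
    rw [VectorField.mlieBracket_smul_left hρ (hsm v), VectorField.mlieBracket_smul_right hρ (hsm v')]
    rfl
  change VectorField.mlieBracket (IQ m) (H.upVF v) (H.upVF v') p = ρ p • H.upVF w p +
    H.logDeriv v p • H.upVF v' p - H.logDeriv v' p • H.upVF v p
  rw [h1, h4, h2]
  have h5 : dirDeriv (ρ • V') ρ p = H.logDeriv v' p * ρ p :=
    (dirDeriv_smul_left ρ V' ρ p).trans (h3 v')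
  rw [h5, H.eq_smul_mpullback w hp, H.eq_smul_mpullback v hp, H.eq_smul_mpullback v' hp, smul_add,
    smul_smul, h3 v, smul_smul, smul_smul, smul_smul]
  module

theorem isLieManifold (H : IsConformalLift 𝒱 β S ρ) (h𝒱 : IsLieManifold 𝒱) :
    IsLieManifold (blownUpModule 𝒱 β S ρ) := by
  obtain ⟨n, ⟨E⟩⟩ := exists_dualFrame h𝒱.finite h𝒱.projective
  have hinj := fun x hx => (h𝒱.anchor_iso x hx).1
  refine ⟨H.compact, fun W hW => H.isTangentToFaces hW, fun W hW W' hW' => ?_,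
    (H.dualFrame E hinj).finite, (H.dualFrame E hinj).projective,
    fun p hp => H.anchor_bijective E h𝒱.anchor_iso hp⟩
  refine ⟨W.bracket W', ?_, fun p => rfl⟩
  rw [H.blownUpModule_eq_span] at hW hW' ⊢
  refine SmoothVF.bracket_mem_span ?_ hW hW'
  rintro _ ⟨v, rfl⟩ _ ⟨v', rfl⟩
  obtain ⟨U, hU, h⟩ := h𝒱.bracket v v.2 v' v'.2
  rw [H.bracket_upVF v v' ⟨U, hU⟩ h]
  have hmem : ∀ u : 𝒱, H.upVF u ∈ Submodule.span (SmoothFun m P) (range H.upVF) :=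
    fun u => Submodule.subset_span (mem_range_self u)
  exact sub_mem (add_mem (Submodule.smul_mem _ _ (hmem _)) (Submodule.smul_mem _ _ (hmem _)))
    (Submodule.smul_mem _ _ (hmem _))

/-! ### The lifted metric. -/

section Metric

variable (H : IsConformalLift 𝒱 β S ρ) {n : ℕ} (E : DualFrame 𝒱 n)
  (hinj : ∀ x ∈ (IQ m).interior M, Function.Injective (anchor 𝒱 x)) (g : VMetric 𝒱)

/-- The lifted metric on a fibre. -/
def fibreInner (p : P) : AFiber (blownUpModule 𝒱 β S ρ) p →ₗ[ℝ]
    AFiber (blownUpModule 𝒱 β S ρ) p →ₗ[ℝ] ℝ :=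
  (g.inner (β p)).compl₁₂ (H.fibreMap E hinj p) (H.fibreMap E hinj p)

theorem fibreInner_apply (p : P) (a b : AFiber (blownUpModule 𝒱 β S ρ) p) :
    H.fibreInner E hinj g p a b =
      g.inner (β p) (H.fibreMap E hinj p a) (H.fibreMap E hinj p b) := rfl

/-- The lifted metric: the extension of `ρ⁻² g`. -/
def metric : VMetric (blownUpModule 𝒱 β S ρ) where
  inner := H.fibreInner E hinj g
  symm p a b := by
    rw [fibreInner_apply, fibreInner_apply, g.symm]
  pos p a ha := by
    rw [fibreInner_apply]
    refine g.pos _ _ fun h => ha (H.fibreMap_injective E hinj p ?_)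
    rw [h, map_zero]
  smooth W W' := by
    have h : ∀ p, g.inner (β p) (H.fibreMap E hinj p (AFiber.mk _ p W))
        (H.fibreMap E hinj p (AFiber.mk _ p W')) = ∑ i, ∑ j,
        (H.dualFrame E hinj).coord i W p * ((H.dualFrame E hinj).coord j W' p *
          g.inner (β p) (AFiber.mk 𝒱 (β p) (E.vec i)) (AFiber.mk 𝒱 (β p) (E.vec j))) := by
      intro p
      simp only [fibreMap, LinearMap.sum_apply, LinearMap.smulRight_apply, map_sum, map_smul,
        LinearMap.smul_apply, smul_eq_mul, DualFrame.fibreCoord_mk]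
      rw [Finset.sum_comm]
      refine Finset.sum_congr rfl fun i _ => ?_
      rw [Finset.mul_sum]
      exact Finset.sum_congr rfl fun j _ => mul_left_comm _ _ _
    simp only [fibreInner_apply, h]
    refine contMDiff_finsetSum fun i _ => contMDiff_finsetSum fun j _ => ?_
    exact ((H.dualFrame E hinj).coord i W).contMDiff.mul (((H.dualFrame E hinj).coord j W').contMDiff.mul
      ((g.smooth (E.vec i) (E.vec j)).comp H.smooth))

theorem metric_inner (p : P) (a b : AFiber (blownUpModule 𝒱 β S ρ) p) :
    (H.metric E hinj g).inner p a b =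
      g.inner (β p) (H.fibreMap E hinj p a) (H.fibreMap E hinj p b) := rfl

end Metric

/-- On the interior, the lifted metric is `ρ⁻² g`. -/
theorem metric_riem (H : IsConformalLift 𝒱 β S ρ) {n : ℕ} (E : DualFrame 𝒱 n)
    (hbij : ∀ x ∈ (IQ m).interior M, Function.Bijective (anchor 𝒱 x)) (g : VMetric 𝒱) {p : P}
    (hp : p ∈ (IQ m).interior P) (v w : TangentSpace (IQ m) p) :
    (H.metric E (fun x hx => (hbij x hx).1) g).riem p v w = (ρ p ^ 2)⁻¹ * g.riem (β p)
      (mfderiv (IQ m) (IQ m) β p v) (mfderiv (IQ m) (IQ m) β p w) := by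
  set hinj := fun x hx => (hbij x hx).1
  have hpS := H.interior p hp
  have hβp := (H.isInteriorPoint_iff hpS).1 hp
  have hρ := H.factor_ne_zero p hpS
  have hsurj := (H.anchor_bijective E hbij hp).2
  -- Inverting the relation between the anchors produces one factor `ρ` in each argument of `g`,
  -- hence `ρ²`.
  have key : ∀ t : TangentSpace (IQ m) p,
      Function.invFun (anchor 𝒱 (β p)) (mfderiv (IQ m) (IQ m) β p t) =
        ρ p • H.fibreMap E hinj p (Function.invFun (anchor (blownUpModule 𝒱 β S ρ) p) t) := by
    intro t
    apply (hbij _ hβp).1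
    rw [Function.invFun_eq ((hbij _ hβp).2 _), map_smul, ← H.mfderiv_anchor E hinj,
      Function.invFun_eq (hsurj t)]
  unfold VMetric.riem
  rw [key, key, metric_inner]
  simp only [map_smul, LinearMap.smul_apply, smul_eq_mul]
  field_simp

end IsConformalLift

/-! ### Local expansions of vector fields and the induced Riemannian metric -/

section Expansion

open Set Filter Topology

variable {m : ℕ} {M : Type*} [TopologicalSpace M] [ChartedSpace (EuclideanQuadrant m) M]

theorem MDifferentiableAt.finsetSum {F : Type*} [NormedAddCommGroup F] [NormedSpace ℝ F]
    {ι : Type*} {s : Finset ι} {f : ι → M → F} {x : M}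
    (hf : ∀ i ∈ s, MDifferentiableAt (IQ m) 𝓘(ℝ, F) (f i) x) :
    MDifferentiableAt (IQ m) 𝓘(ℝ, F) (fun y => ∑ i ∈ s, f i y) x := by
  classical
  induction s using Finset.induction_on with
  | empty => simpa using mdifferentiableAt_const
  | insert a s ha ih =>
    simp only [Finset.sum_insert ha]
    exact (hf a (Finset.mem_insert_self a s)).add (ih fun i hi => hf i (Finset.mem_insert_of_mem hi))

variable [IsManifold (IQ m) ∞ M]

/-- The vector field `X`, defined on `M`, is differentiable at `x`. -/
abbrev DiffVFAt (X : ∀ y : M, TangentSpace (IQ m) y) (x : M) : Prop :=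
  MDifferentiableAt (IQ m) (IQ m).tangent (fun y => (⟨y, X y⟩ : TangentBundle (IQ m) M)) x

/-- Vector fields that span the tangent space at `x` generate all vector fields near `x`. -/
theorem exists_eventuallyEq_sum_smul {n : ℕ} {V : Fin n → ∀ y : M, TangentSpace (IQ m) y} {x : M}
    (hV : ∀ a, DiffVFAt (V a) x)
    (hspan : ∀ t : TangentSpace (IQ m) x, ∃ c : Fin n → ℝ, ∑ a, c a • V a x = t)
    {Y : ∀ y : M, TangentSpace (IQ m) y} (hY : DiffVFAt Y x) :
    ∃ f : Fin n → M → ℝ, (∀ a, MDifferentiableAt (IQ m) 𝓘(ℝ, ℝ) (f a) x) ∧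
      ∀ᶠ y in 𝓝 x, Y y = ∑ a, f a y • V a y := by
  set e := trivializationAt (Euc m) (TangentSpace (IQ m) (M := M)) x with he
  have hx : x ∈ e.baseSet := FiberBundle.mem_baseSet_trivializationAt' x
  have hA : ∀ {Z : ∀ y : M, TangentSpace (IQ m) y}, DiffVFAt Z x →
      MDifferentiableAt (IQ m) 𝓘(ℝ, Euc m) (fun y => (e ⟨y, Z y⟩).2) x := fun {Z} hZ =>
    (mdifferentiableAt_section (IQ m) Z).1 hZ
  set A : Fin n → M → Euc m := fun a y => (e ⟨y, V a y⟩).2 with hAdef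
  have hlin : ∀ y ∈ e.baseSet, ∀ c : Fin n → ℝ,
      (e ⟨y, ∑ a, c a • V a y⟩).2 = ∑ a, c a • A a y := by
    intro y hy c
    have h1 : ∀ v : TangentSpace (IQ m) y, (e ⟨y, v⟩).2 = e.continuousLinearEquivAt ℝ y hy v :=
      fun v => rfl
    rw [h1, map_sum]
    exact Finset.sum_congr rfl fun a _ => by rw [map_smul, ← h1]
  have hinj : ∀ y ∈ e.baseSet, ∀ v w : TangentSpace (IQ m) y,
      (e ⟨y, v⟩).2 = (e ⟨y, w⟩).2 → v = w := fun y hy v w h =>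
    (e.continuousLinearEquivAt ℝ y hy).injective h
  obtain ⟨R, hR⟩ := (Fintype.linearCombination ℝ (fun a => A a x)).exists_rightInverse_of_surjective
    (LinearMap.range_eq_top.2 fun w => by
      obtain ⟨c, hc⟩ := hspan ((e.continuousLinearEquivAt ℝ x hx).symm w)
      refine ⟨c, ?_⟩
      rw [Fintype.linearCombination_apply, ← hlin x hx c, hc]
      exact (e.continuousLinearEquivAt ℝ x hx).apply_symm_apply w)
  set R' : Fin n → (Euc m →L[ℝ] ℝ) := fun a =>
    LinearMap.toContinuousLinearMap ((LinearMap.proj a).comp R) with hR'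
  -- `R` picks coefficients at `x` with respect to the possibly redundant fields `V_a`. Applying
  -- them with the fields at `y` gives `Φ y`, the identity at `y = x` and so invertible nearby. The
  -- coefficients of `Y` are `R (Φ y)⁻¹ Y`.
  set Φ : M → (Euc m →L[ℝ] Euc m) := fun y => ∑ a, (R' a).smulRight (A a y) with hΦ
  have hΦ1 : Φ x = ContinuousLinearEquiv.refl ℝ (Euc m) := by
    ext1 w
    have := LinearMap.congr_fun hR w
    rw [hΦ]
    simp only [_root_.sum_apply, ContinuousLinearMap.smulRight_apply]
    exact this
  have hΦd : MDifferentiableAt (IQ m) 𝓘(ℝ, Euc m →L[ℝ] Euc m) Φ x := by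
    refine MDifferentiableAt.finsetSum fun a _ => ?_
    exact (ContinuousLinearMap.smulRightL ℝ (Euc m) (Euc m) (R' a)).mdifferentiableAt.comp x (hA (hV a))
  have hinvd : MDifferentiableAt (IQ m) 𝓘(ℝ, Euc m →L[ℝ] Euc m)
      (fun y => ContinuousLinearMap.inverse (Φ y)) x := by
    have h1 : DifferentiableAt ℝ ContinuousLinearMap.inverse (Φ x) := by
      rw [hΦ1]
      exact (contDiffAt_map_inverse (n := 1) (ContinuousLinearEquiv.refl ℝ (Euc m))).differentiableAt
        (by simp)
    exact h1.mdifferentiableAt.comp x hΦd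
  refine ⟨fun a y => R' a (ContinuousLinearMap.inverse (Φ y) (e ⟨y, Y y⟩).2), fun a => ?_, ?_⟩
  · exact (R' a).mdifferentiableAt.comp x (hinvd.clm_apply (hA hY))
  · have h1 := hΦd.continuousAt.preimage_mem_nhds
      (hΦ1 ▸ ContinuousLinearEquiv.nhds (ContinuousLinearEquiv.refl ℝ (Euc m)))
    filter_upwards [h1, e.open_baseSet.mem_nhds hx] with y hy hyb
    apply hinj y hyb
    rw [hlin y hyb]
    have hi : (Φ y).IsInvertible := hy
    have h2 := hi.self_apply_inverse (e ⟨y, Y y⟩).2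
    conv_lhs => rw [← h2]
    rw [hΦ]
    simp only [_root_.sum_apply, ContinuousLinearMap.smulRight_apply]

variable {𝒱 : Submodule (SmoothFun m M) (SmoothVF m M)}

/-- The Riemannian metric of a `𝒱`-metric, as a bilinear form, where the anchor is bijective. -/
def VMetric.riemForm (g : VMetric 𝒱) {x : M} (hx : Function.Bijective (anchor 𝒱 x)) :
    TangentSpace (IQ m) x →ₗ[ℝ] TangentSpace (IQ m) x →ₗ[ℝ] ℝ :=
  (g.inner x).compl₁₂ (LinearEquiv.ofBijective (anchor 𝒱 x) hx).symm.toLinearMap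
    (LinearEquiv.ofBijective (anchor 𝒱 x) hx).symm.toLinearMap

theorem VMetric.riem_eq (g : VMetric 𝒱) {x : M} (hx : Function.Bijective (anchor 𝒱 x))
    (v w : TangentSpace (IQ m) x) : g.riem x v w = g.riemForm hx v w := by
  have h : ∀ t, Function.invFun (anchor 𝒱 x) t =
      (LinearEquiv.ofBijective (anchor 𝒱 x) hx).symm t := fun t => by
    apply hx.1
    rw [Function.invFun_eq (hx.2 t)]
    exact ((LinearEquiv.ofBijective (anchor 𝒱 x) hx).apply_symm_apply t).symm
  unfold VMetric.riem
  rw [h, h]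
  rfl

theorem VMetric.riem_anchor (g : VMetric 𝒱) {x : M} (hx : Function.Bijective (anchor 𝒱 x))
    (a b : AFiber 𝒱 x) : g.riem x (anchor 𝒱 x a) (anchor 𝒱 x b) = g.inner x a b := by
  unfold VMetric.riem
  rw [Function.leftInverse_invFun hx.1 a, Function.leftInverse_invFun hx.1 b]

theorem VMetric.riem_symm (g : VMetric 𝒱) (x : M) (v w : TangentSpace (IQ m) x) :
    g.riem x v w = g.riem x w v := g.symm _ _ _

theorem VMetric.riem_pos (g : VMetric 𝒱) {x : M} (hx : Function.Bijective (anchor 𝒱 x))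
    {v : TangentSpace (IQ m) x} (hv : v ≠ 0) : 0 < g.riem x v v := by
  obtain ⟨a, rfl⟩ := hx.2 v
  rw [g.riem_anchor hx]
  refine g.pos x a fun h => hv ?_
  rw [h, map_zero]

theorem VMetric.riem_mk (g : VMetric 𝒱) {x : M} (hx : Function.Bijective (anchor 𝒱 x)) (v w : 𝒱) :
    g.riem x ((v : SmoothVF m M) x) ((w : SmoothVF m M) x) =
      g.inner x (AFiber.mk 𝒱 x v) (AFiber.mk 𝒱 x w) :=
  g.riem_anchor hx (AFiber.mk 𝒱 x v) (AFiber.mk 𝒱 x w)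

theorem interior_quadrant_mem_nhds {x : M} (hx : x ∈ (IQ m).interior M) :
    (IQ m).interior M ∈ 𝓝 x :=
  (ModelWithCorners.isOpen_interior (n := ∞) (by simp)).mem_nhds hx

theorem DualFrame.span_apply {n : ℕ} (E : DualFrame 𝒱 n) {x : M}
    (hx : Function.Bijective (anchor 𝒱 x)) (t : TangentSpace (IQ m) x) :
    ∃ c : Fin n → ℝ, ∑ a, c a • (E.vec a : SmoothVF m M) x = t := by
  obtain ⟨a, rfl⟩ := hx.2 t
  refine ⟨fun i => E.fibreCoord i x a, ?_⟩
  conv_rhs => rw [← E.sum_fibreCoord_smul x a, map_sum]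
  exact Finset.sum_congr rfl fun i _ => by rw [map_smul, anchor_mk]

/-- Inner products of differentiable vector fields are differentiable. -/
theorem VMetric.mdifferentiableAt_riem {n : ℕ} (E : DualFrame 𝒱 n) (g : VMetric 𝒱)
    (hbij : ∀ x ∈ (IQ m).interior M, Function.Bijective (anchor 𝒱 x)) {x : M}
    (hx : x ∈ (IQ m).interior M) {Y Z : ∀ y : M, TangentSpace (IQ m) y} (hY : DiffVFAt Y x)
    (hZ : DiffVFAt Z x) :
    MDifferentiableAt (IQ m) 𝓘(ℝ, ℝ) (fun y => g.riem y (Y y) (Z y)) x := by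
  have hV : ∀ a, DiffVFAt (E.vec a : SmoothVF m M) x := fun a =>
    (E.vec a : SmoothVF m M).mdifferentiableAt_mk x
  obtain ⟨f, hf, hfY⟩ := exists_eventuallyEq_sum_smul hV (E.span_apply (hbij x hx)) hY
  obtain ⟨f', hf', hfZ⟩ := exists_eventuallyEq_sum_smul hV (E.span_apply (hbij x hx)) hZ
  have h1 : MDifferentiableAt (IQ m) 𝓘(ℝ, ℝ) (fun y => ∑ a, ∑ b, f a y * (f' b y *
      g.inner y (AFiber.mk 𝒱 y (E.vec a)) (AFiber.mk 𝒱 y (E.vec b)))) x := by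
    refine MDifferentiableAt.finsetSum fun a _ => MDifferentiableAt.finsetSum fun b _ => ?_
    exact (hf a).mul ((hf' b).mul ((g.smooth _ _).mdifferentiableAt (by simp)))
  refine h1.congr_of_eventuallyEq ?_
  filter_upwards [hfY, hfZ, interior_quadrant_mem_nhds hx] with y h2 h3 h4
  have hy := hbij y h4
  rw [h2, h3, g.riem_eq hy, LinearMap.map_sum₂]
  refine Finset.sum_congr rfl fun a _ => ?_
  rw [map_sum]
  refine Finset.sum_congr rfl fun b _ => ?_
  rw [map_smul, LinearMap.map_smul₂, ← g.riem_eq hy, g.riem_mk hy, smul_eq_mul, smul_eq_mul,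
    mul_left_comm]

/-- Derivatives of smooth functions along differentiable vector fields are differentiable. -/
theorem DualFrame.mdifferentiableAt_dirDeriv {n : ℕ} (E : DualFrame 𝒱 n) {x : M}
    (hx : Function.Bijective (anchor 𝒱 x)) {Y : ∀ y : M, TangentSpace (IQ m) y} (hY : DiffVFAt Y x)
    {u : M → ℝ} {U : Set M} (hU : IsOpen U) (hxU : x ∈ U)
    (hu : ContMDiffOn (IQ m) 𝓘(ℝ, ℝ) ∞ u U) :
    MDifferentiableAt (IQ m) 𝓘(ℝ, ℝ) (dirDeriv Y u) x := by
  have hV : ∀ a, DiffVFAt (E.vec a : SmoothVF m M) x := fun a =>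
    (E.vec a : SmoothVF m M).mdifferentiableAt_mk x
  obtain ⟨f, hf, hfY⟩ := exists_eventuallyEq_sum_smul hV (E.span_apply hx) hY
  have h1 : MDifferentiableAt (IQ m) 𝓘(ℝ, ℝ)
      (fun y => ∑ a, f a y * dirDeriv (E.vec a : SmoothVF m M) u y) x := by
    refine MDifferentiableAt.finsetSum fun a _ => (hf a).mul ?_
    exact (((E.vec a : SmoothVF m M).contMDiffOn_dirDeriv hU hu).contMDiffAt
      (hU.mem_nhds hxU)).mdifferentiableAt (by simp)
  refine h1.congr_of_eventuallyEq ?_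
  filter_upwards [hfY] with y h2
  rw [← dirDeriv_sum_smul_left]
  exact dirDeriv_congr_left h2

end Expansion

/-! ### Tensoriality of Koszul's formula -/

section Koszul

open Set Filter Topology

variable {m : ℕ} {M : Type*} [TopologicalSpace M] [ChartedSpace (EuclideanQuadrant m) M]
  [IsManifold (IQ m) ∞ M] {𝒱 : Submodule (SmoothFun m M) (SmoothVF m M)}

theorem VMetric.riem_add_left (g : VMetric 𝒱) {x : M} (hx : Function.Bijective (anchor 𝒱 x))
    (v v' w : TangentSpace (IQ m) x) :
    g.riem x (v + v') w = g.riem x v w + g.riem x v' w := by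
  rw [g.riem_eq hx, map_add, g.riem_eq hx, g.riem_eq hx]
  rfl

theorem VMetric.riem_smul_left (g : VMetric 𝒱) {x : M} (hx : Function.Bijective (anchor 𝒱 x))
    (c : ℝ) (v w : TangentSpace (IQ m) x) : g.riem x (c • v) w = c * g.riem x v w := by
  rw [g.riem_eq hx, map_smul, g.riem_eq hx]
  rfl

theorem VMetric.riem_add_right (g : VMetric 𝒱) {x : M} (hx : Function.Bijective (anchor 𝒱 x))
    (v w w' : TangentSpace (IQ m) x) :
    g.riem x v (w + w') = g.riem x v w + g.riem x v w' := by
  rw [g.riem_symm, g.riem_add_left hx, g.riem_symm x w, g.riem_symm x w']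

theorem VMetric.riem_smul_right (g : VMetric 𝒱) {x : M} (hx : Function.Bijective (anchor 𝒱 x))
    (c : ℝ) (v w : TangentSpace (IQ m) x) : g.riem x v (c • w) = c * g.riem x v w := by
  rw [g.riem_symm, g.riem_smul_left hx, g.riem_symm]

theorem mlieBracket_smul_right_apply {f : M → ℝ} {V W : ∀ y : M, TangentSpace (IQ m) y} {x : M}
    (hf : MDifferentiableAt (IQ m) 𝓘(ℝ, ℝ) f x) (hW : DiffVFAt W x) :
    VectorField.mlieBracket (IQ m) V (f • W) x =
      dirDeriv V f x • W x + f x • VectorField.mlieBracket (IQ m) V W x :=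
  VectorField.mlieBracket_smul_right hf hW

theorem mlieBracket_smul_left_apply {f : M → ℝ} {V W : ∀ y : M, TangentSpace (IQ m) y} {x : M}
    (hf : MDifferentiableAt (IQ m) 𝓘(ℝ, ℝ) f x) (hV : DiffVFAt V x) :
    VectorField.mlieBracket (IQ m) (f • V) W x =
      (-dirDeriv W f x) • V x + f x • VectorField.mlieBracket (IQ m) V W x :=
  VectorField.mlieBracket_smul_left hf hV

variable {n : ℕ} (E : DualFrame 𝒱 n) (g : VMetric 𝒱)
  (hbij : ∀ x ∈ (IQ m).interior M, Function.Bijective (anchor 𝒱 x)) {x : M}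
  (hx : x ∈ (IQ m).interior M) {f : M → ℝ} (hf : MDifferentiableAt (IQ m) 𝓘(ℝ, ℝ) f x)
  (D : ∀ y : M, TangentSpace (IQ m) y)
  {X X' Y Z : ∀ y : M, TangentSpace (IQ m) y} (hX : DiffVFAt X x) (hX' : DiffVFAt X' x)
  (hY : DiffVFAt Y x) (hZ : DiffVFAt Z x)

include E hbij hx hf hX hY in
theorem VMetric.dirDeriv_riem_smul_left : dirDeriv D (fun y => g.riem y ((f • X) y) (Y y)) x =
    f x * dirDeriv D (fun y => g.riem y (X y) (Y y)) x + g.riem x (X x) (Y x) * dirDeriv D f x := by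
  rw [← dirDeriv_mul hf (g.mdifferentiableAt_riem E hbij hx hX hY)]
  refine dirDeriv_congr ?_
  filter_upwards [interior_quadrant_mem_nhds hx] with y hy
  exact g.riem_smul_left (hbij y hy) _ _ _

include E hbij hx hf hX hY in
theorem VMetric.dirDeriv_riem_smul_right : dirDeriv D (fun y => g.riem y (Y y) ((f • X) y)) x =
    f x * dirDeriv D (fun y => g.riem y (Y y) (X y)) x + g.riem x (Y x) (X x) * dirDeriv D f x := by
  simp only [g.riem_symm _ (Y _)]
  exact g.dirDeriv_riem_smul_left E hbij hx hf D hX hY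

include E hbij hx hX hX' hY in
theorem VMetric.dirDeriv_riem_add_left : dirDeriv D (fun y => g.riem y ((X + X') y) (Y y)) x =
    dirDeriv D (fun y => g.riem y (X y) (Y y)) x + dirDeriv D (fun y => g.riem y (X' y) (Y y)) x := by
  rw [← dirDeriv_add (g.mdifferentiableAt_riem E hbij hx hX hY)
    (g.mdifferentiableAt_riem E hbij hx hX' hY)]
  refine dirDeriv_congr ?_
  filter_upwards [interior_quadrant_mem_nhds hx] with y hy
  exact g.riem_add_left (hbij y hy) _ _ _

include E hbij hx hX hX' hY in
theorem VMetric.dirDeriv_riem_add_right : dirDeriv D (fun y => g.riem y (Y y) ((X + X') y)) x =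
    dirDeriv D (fun y => g.riem y (Y y) (X y)) x + dirDeriv D (fun y => g.riem y (Y y) (X' y)) x := by
  simp only [g.riem_symm _ (Y _)]
  exact g.dirDeriv_riem_add_left E hbij hx D hX hX' hY

include E hbij hx hf hX hY hZ in
-- The derivatives of `f` arising from the metric terms cancel those arising from the brackets.
theorem VMetric.koszul_smul_fst :
    koszul g.riem (f • X) Y Z x = f x * koszul g.riem X Y Z x := by
  have hb := hbij x hx
  unfold koszul
  rw [g.dirDeriv_riem_smul_left E hbij hx hf Y hX hZ, g.dirDeriv_riem_smul_left E hbij hx hf Z hX hY,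
    mlieBracket_smul_left_apply hf hX, mlieBracket_smul_left_apply hf hX, g.riem_add_left hb,
    g.riem_add_left hb, g.riem_smul_left hb, g.riem_smul_left hb, g.riem_smul_left hb,
    g.riem_smul_left hb]
  have h1 : dirDeriv (f • X) (fun z => g.riem z (Y z) (Z z)) x =
    f x * dirDeriv X (fun z => g.riem z (Y z) (Z z)) x := dirDeriv_smul_left f X _ x
  have h2 : g.riem x (VectorField.mlieBracket (IQ m) Y Z x) ((f • X) x) =
    f x * g.riem x (VectorField.mlieBracket (IQ m) Y Z x) (X x) := g.riem_smul_right hb _ _ _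
  rw [h1, h2]
  ring

include E hbij hx hf hX hY hZ in
-- The Leibniz rule of a connection: the terms with `Z f` cancel, while the two terms with `Y f`,
-- one from the metric and one from the bracket, add up and absorb the factor `1 / 2`.
theorem VMetric.koszul_smul_snd :
    koszul g.riem Y (f • X) Z x = f x * koszul g.riem Y X Z x +
      dirDeriv Y f x * g.riem x (X x) (Z x) := by
  have hb := hbij x hx
  unfold koszul
  rw [g.dirDeriv_riem_smul_left E hbij hx hf Y hX hZ, g.dirDeriv_riem_smul_right E hbij hx hf Z hX hY,
    mlieBracket_smul_left_apply hf hX, mlieBracket_smul_right_apply hf hX, g.riem_add_left hb,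
    g.riem_add_left hb, g.riem_smul_left hb, g.riem_smul_left hb, g.riem_smul_left hb,
    g.riem_smul_left hb]
  have h1 : dirDeriv (f • X) (fun z => g.riem z (Y z) (Z z)) x =
    f x * dirDeriv X (fun z => g.riem z (Y z) (Z z)) x := dirDeriv_smul_left f X _ x
  have h2 : g.riem x (VectorField.mlieBracket (IQ m) Y Z x) ((f • X) x) =
    f x * g.riem x (VectorField.mlieBracket (IQ m) Y Z x) (X x) := g.riem_smul_right hb _ _ _
  rw [h1, h2, g.riem_symm x (Y x) (X x)]
  ring

include E hbij hx hf hX hY hZ in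
theorem VMetric.koszul_smul_thd :
    koszul g.riem Y Z (f • X) x = f x * koszul g.riem Y Z X x := by
  have hb := hbij x hx
  unfold koszul
  rw [g.dirDeriv_riem_smul_right E hbij hx hf Y hX hZ,
    g.dirDeriv_riem_smul_right E hbij hx hf Z hX hY,
    mlieBracket_smul_right_apply hf hX, mlieBracket_smul_right_apply hf hX, g.riem_add_left hb,
    g.riem_add_left hb, g.riem_smul_left hb, g.riem_smul_left hb, g.riem_smul_left hb,
    g.riem_smul_left hb]
  have h1 : dirDeriv (f • X) (fun z => g.riem z (Y z) (Z z)) x =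
    f x * dirDeriv X (fun z => g.riem z (Y z) (Z z)) x := dirDeriv_smul_left f X _ x
  have h2 : g.riem x (VectorField.mlieBracket (IQ m) Y Z x) ((f • X) x) =
    f x * g.riem x (VectorField.mlieBracket (IQ m) Y Z x) (X x) := g.riem_smul_right hb _ _ _
  rw [h1, h2, g.riem_symm x (Z x) (X x), g.riem_symm x (Y x) (X x)]
  ring

include E hbij hx hX hX' hY hZ in
theorem VMetric.koszul_add_fst :
    koszul g.riem (X + X') Y Z x = koszul g.riem X Y Z x + koszul g.riem X' Y Z x := by
  have hb := hbij x hx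
  unfold koszul
  rw [g.dirDeriv_riem_add_left E hbij hx Y hX hX' hZ, g.dirDeriv_riem_add_left E hbij hx Z hX hX' hY,
    VectorField.mlieBracket_add_left hX hX', VectorField.mlieBracket_add_left hX hX',
    g.riem_add_left hb, g.riem_add_left hb]
  have h1 : dirDeriv (X + X') (fun z => g.riem z (Y z) (Z z)) x =
    dirDeriv X (fun z => g.riem z (Y z) (Z z)) x + dirDeriv X' (fun z => g.riem z (Y z) (Z z)) x :=
    dirDeriv_add_left X X' _ x
  have h2 : g.riem x (VectorField.mlieBracket (IQ m) Y Z x) ((X + X') x) =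
    g.riem x (VectorField.mlieBracket (IQ m) Y Z x) (X x) +
    g.riem x (VectorField.mlieBracket (IQ m) Y Z x) (X' x) := g.riem_add_right hb _ _ _
  rw [h1, h2]
  ring

include E hbij hx hX hX' hY hZ in
theorem VMetric.koszul_add_snd :
    koszul g.riem Y (X + X') Z x = koszul g.riem Y X Z x + koszul g.riem Y X' Z x := by
  have hb := hbij x hx
  unfold koszul
  rw [g.dirDeriv_riem_add_left E hbij hx Y hX hX' hZ, g.dirDeriv_riem_add_right E hbij hx Z hX hX' hY,
    VectorField.mlieBracket_add_left hX hX', VectorField.mlieBracket_add_right hX hX',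
    g.riem_add_left hb, g.riem_add_left hb]
  have h1 : dirDeriv (X + X') (fun z => g.riem z (Y z) (Z z)) x =
    dirDeriv X (fun z => g.riem z (Y z) (Z z)) x + dirDeriv X' (fun z => g.riem z (Y z) (Z z)) x :=
    dirDeriv_add_left X X' _ x
  have h2 : g.riem x (VectorField.mlieBracket (IQ m) Y Z x) ((X + X') x) =
    g.riem x (VectorField.mlieBracket (IQ m) Y Z x) (X x) +
    g.riem x (VectorField.mlieBracket (IQ m) Y Z x) (X' x) := g.riem_add_right hb _ _ _
  rw [h1, h2]
  ring

include E hbij hx hX hX' hY hZ in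
theorem VMetric.koszul_add_thd :
    koszul g.riem Y Z (X + X') x = koszul g.riem Y Z X x + koszul g.riem Y Z X' x := by
  have hb := hbij x hx
  unfold koszul
  rw [g.dirDeriv_riem_add_right E hbij hx Y hX hX' hZ,
    g.dirDeriv_riem_add_right E hbij hx Z hX hX' hY,
    VectorField.mlieBracket_add_right hX hX', VectorField.mlieBracket_add_right hX hX',
    g.riem_add_left hb, g.riem_add_left hb]
  have h1 : dirDeriv (X + X') (fun z => g.riem z (Y z) (Z z)) x =
    dirDeriv X (fun z => g.riem z (Y z) (Z z)) x + dirDeriv X' (fun z => g.riem z (Y z) (Z z)) x :=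
    dirDeriv_add_left X X' _ x
  have h2 : g.riem x (VectorField.mlieBracket (IQ m) Y Z x) ((X + X') x) =
    g.riem x (VectorField.mlieBracket (IQ m) Y Z x) (X x) +
    g.riem x (VectorField.mlieBracket (IQ m) Y Z x) (X' x) := g.riem_add_right hb _ _ _
  rw [h1, h2]
  ring

end Koszul

/-! ### The Laplacian in terms of generators -/

section LinearAlgebra

variable {T : Type*} [AddCommGroup T] [Module ℝ T]

theorem sum_smul_eq_of_orthonormal [FiniteDimensional ℝ T] {m : ℕ} (hT : Module.finrank ℝ T = m)
    (G : T →ₗ[ℝ] T →ₗ[ℝ] ℝ) {e : Fin m → T} (he : ∀ i j, G (e i) (e j) = if i = j then 1 else 0)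
    (t : T) : ∑ i, G t (e i) • e i = t := by
  have hcoef : ∀ (c : Fin m → ℝ) j, G (∑ i, c i • e i) (e j) = c j := fun c j => by
    rw [LinearMap.map_sum₂]
    simp only [LinearMap.map_smul₂, he, smul_eq_mul, mul_ite, mul_one, mul_zero, Finset.sum_ite_eq',
      Finset.mem_univ, if_true]
  have hli : LinearIndependent ℝ e := by
    rw [Fintype.linearIndependent_iff]
    intro c hc i
    rw [← hcoef c i, hc, map_zero, LinearMap.zero_apply]
  have hspan := hli.span_eq_top_of_card_eq_finrank' (by rw [Fintype.card_fin, hT])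
  obtain ⟨c, rfl⟩ := (Submodule.mem_span_range_iff_exists_fun ℝ).1
    (hspan ▸ Submodule.mem_top : t ∈ Submodule.span ℝ (Set.range e))
  simp only [hcoef]

theorem exists_orthonormal {m : ℕ} [FiniteDimensional ℝ T] (hT : Module.finrank ℝ T = m)
    (G : T →ₗ[ℝ] T →ₗ[ℝ] ℝ) (hsymm : ∀ v w, G v w = G w v) (hpos : ∀ v, v ≠ 0 → 0 < G v v) :
    ∃ e : Fin m → T, ∀ i j, G (e i) (e j) = if i = j then 1 else 0 := by
  obtain ⟨v, hv⟩ := LinearMap.BilinForm.exists_orthogonal_basis (B := G)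
    ⟨fun x y => hsymm x y⟩
  set w := v.reindex (finCongr hT) with hw
  have hw0 : ∀ i, 0 < G (w i) (w i) := fun i => hpos _ (w.ne_zero i)
  refine ⟨fun i => (Real.sqrt (G (w i) (w i)))⁻¹ • w i, fun i j => ?_⟩
  rw [map_smul, LinearMap.map_smul₂, smul_eq_mul, smul_eq_mul]
  split_ifs with h
  · subst h
    rw [← mul_assoc, ← mul_inv, Real.mul_self_sqrt (hw0 i).le, inv_mul_cancel₀ (hw0 i).ne']
  · have h1 : G (w i) (w j) = 0 := by
      rw [hw, Module.Basis.reindex_apply, Module.Basis.reindex_apply]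
      exact hv (fun h' => h ((finCongr hT).symm.injective h'))
    rw [h1, mul_zero, mul_zero]

/-- Two computations of the trace of `B` with respect to `G`, by an orthonormal basis and by
redundant generators with a dual metric. Expand one argument `e_i` in the generators, then resum
`V_a = ∑ G(V_a, e_i) e_i`. -/
theorem sum_diag_eq_sum {m n : ℕ} (G : T →ₗ[ℝ] T →ₗ[ℝ] ℝ) (hsymm : ∀ v w, G v w = G w v)
    {e : Fin m → T} (he : ∀ t, ∑ i, G t (e i) • e i = t) {V : Fin n → T} {k : Fin n → Fin n → ℝ}
    (hk : ∀ t, ∑ a, ∑ b, (k a b * G t (V a)) • V b = t) (B : T →ₗ[ℝ] T →ₗ[ℝ] ℝ) :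
    ∑ i, B (e i) (e i) = ∑ a, ∑ b, k a b * B (V a) (V b) := by
  have h1 : ∀ i, B (e i) (e i) = ∑ a, ∑ b, k a b * (G (V a) (e i) * B (e i) (V b)) := fun i => by
    rw [← congrArg (B (e i)) (hk (e i))]
    simp only [map_sum, map_smul, smul_eq_mul]
    refine Finset.sum_congr rfl fun a _ => Finset.sum_congr rfl fun b _ => ?_
    rw [hsymm (e i) (V a), mul_assoc]
  simp only [h1]
  rw [Finset.sum_comm]
  refine Finset.sum_congr rfl fun a _ => ?_
  rw [Finset.sum_comm]
  refine Finset.sum_congr rfl fun b _ => ?_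
  rw [← Finset.mul_sum]
  congr 1
  conv_rhs => rw [← he (V a), LinearMap.map_sum₂]
  exact Finset.sum_congr rfl fun i _ => by rw [LinearMap.map_smul₂, smul_eq_mul]

end LinearAlgebra

/-! ### The Hessian and its trace. -/

section Laplacian

open Set Filter Topology

variable {m : ℕ} {M : Type*} [TopologicalSpace M] [ChartedSpace (EuclideanQuadrant m) M]

theorem finrank_tangentSpace_quadrant (x : M) :
    Module.finrank ℝ (TangentSpace (IQ m) x) = m :=
  finrank_euclideanSpace_fin (𝕜 := ℝ) (n := m)

instance finiteDimensional_tangentSpace_quadrant (x : M) :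
    FiniteDimensional ℝ (TangentSpace (IQ m) x) :=
  inferInstanceAs (FiniteDimensional ℝ (Euc m))

variable [IsManifold (IQ m) ∞ M] {𝒱 : Submodule (SmoothFun m M) (SmoothVF m M)}

/-- The functions `K_ij` are coefficients of the dual metric with respect to the generators `V_i`. -/
structure IsDualMetric {n : ℕ} (V : Fin n → 𝒱) (K : Fin n → Fin n → SmoothFun m M)
    (g : VMetric 𝒱) : Prop where
  sum_smul : ∀ x (a : AFiber 𝒱 x), ∑ i, ∑ j,
    (K i j x * g.inner x a (AFiber.mk 𝒱 x (V i))) • AFiber.mk 𝒱 x (V j) = a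
  pos : ∀ x (c : Fin n → ℝ), c ≠ 0 → 0 < ∑ i, ∑ j, K i j x * (c i * c j)

theorem IsDualMetric.sum_smul_riem {n : ℕ} {V : Fin n → 𝒱} {K : Fin n → Fin n → SmoothFun m M}
    {g : VMetric 𝒱} (hK : IsDualMetric V K g) {x : M} (hx : Function.Bijective (anchor 𝒱 x))
    (t : TangentSpace (IQ m) x) : ∑ i, ∑ j, (K i j x * g.riem x t ((V i : SmoothVF m M) x)) •
      (V j : SmoothVF m M) x = t := by
  obtain ⟨a, rfl⟩ := hx.2 t
  conv_rhs => rw [← hK.sum_smul x a, map_sum]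
  refine Finset.sum_congr rfl fun i _ => ?_
  rw [map_sum]
  refine Finset.sum_congr rfl fun j _ => ?_
  rw [map_smul, anchor_mk, ← anchor_mk (V i) x, g.riem_anchor hx]

variable {n : ℕ} (E : DualFrame 𝒱 n) (g : VMetric 𝒱)
  (hbij : ∀ x ∈ (IQ m).interior M, Function.Bijective (anchor 𝒱 x)) {x : M}
  (hx : x ∈ (IQ m).interior M)

include E hbij hx in
theorem VMetric.tensorialAt_koszul {X Y : ∀ y : M, TangentSpace (IQ m) y} (hX : DiffVFAt X x)
    (hY : DiffVFAt Y x) :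
    TensorialAt (IQ m) (Euc m) (fun Z : ∀ y : M, TangentSpace (IQ m) y => koszul g.riem X Y Z x) x where
  smul hf hZ := g.koszul_smul_thd E hbij hx hf hZ hX hY
  add hZ hZ' := g.koszul_add_thd E hbij hx hZ hZ' hX hY

/-- The Hessian `X Y u - (∇_X Y) u`, computed with vector fields `e` that are orthonormal at `x`. -/
def frameHessian (G : ∀ x : M, TangentSpace (IQ m) x → TangentSpace (IQ m) x → ℝ)
    (e : Fin m → SmoothVF m M) (u : M → ℝ) (x : M) (X Y : ∀ y : M, TangentSpace (IQ m) y) : ℝ :=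
  dirDeriv X (dirDeriv Y u) x - ∑ j, koszul G X Y (e j) x * dirDeriv (e j) u x

include E hbij hx in
theorem VMetric.tensorialAt_frameHessian_left (e : Fin m → SmoothVF m M) (u : M → ℝ)
    {Y : ∀ y : M, TangentSpace (IQ m) y} (hY : DiffVFAt Y x) :
    TensorialAt (IQ m) (Euc m) (fun X : ∀ y : M, TangentSpace (IQ m) y =>
      frameHessian g.riem e u x X Y) x where
  smul {f X} hf hX := by
    have h1 : dirDeriv (f • X) (dirDeriv Y u) x = f x * dirDeriv X (dirDeriv Y u) x :=
      dirDeriv_smul_left f X _ x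
    have h2 := fun j => g.koszul_smul_fst E hbij hx hf hX hY ((e j).mdifferentiableAt_mk x)
    simp only [frameHessian, h1, h2, smul_eq_mul, mul_sub, Finset.mul_sum, mul_assoc]
  add {X X'} hX hX' := by
    have h1 : dirDeriv (X + X') (dirDeriv Y u) x =
      dirDeriv X (dirDeriv Y u) x + dirDeriv X' (dirDeriv Y u) x := dirDeriv_add_left X X' _ x
    have h2 := fun j => g.koszul_add_fst E hbij hx hX hX' hY ((e j).mdifferentiableAt_mk x)
    simp only [frameHessian, h1, h2, add_mul, Finset.sum_add_distrib]
    ring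

include E hbij hx in
theorem VMetric.tensorialAt_frameHessian_right {e : Fin m → SmoothVF m M}
    (he : ∀ i j, g.riem x (e i x) (e j x) = if i = j then 1 else 0) {u : M → ℝ} {U : Set M}
    (hU : IsOpen U) (hxU : x ∈ U) (hu : ContMDiffOn (IQ m) 𝓘(ℝ, ℝ) ∞ u U)
    {X : ∀ y : M, TangentSpace (IQ m) y} (hX : DiffVFAt X x) :
    TensorialAt (IQ m) (Euc m) (frameHessian g.riem e u x X) x where
  smul {f Y} hf hY := by
    have hYu := E.mdifferentiableAt_dirDeriv (hbij x hx) hY hU hxU hu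
    have h0 : dirDeriv (f • Y) u = fun y => f y * dirDeriv Y u y :=
      funext fun y => dirDeriv_smul_left f Y u y
    have h2 := fun j => g.koszul_smul_snd E hbij hx hf hY hX ((e j).mdifferentiableAt_mk x)
    -- The Leibniz term of Koszul's formula is recombined through the orthonormal expansion of `Y`.
    -- It then cancels the term `(X f) (Y u)` of the second derivative.
    have h3 : ∑ j, g.riem x (Y x) (e j x) * dirDeriv (e j) u x = dirDeriv Y u x := by
      have h4 := sum_smul_eq_of_orthonormal (finrank_tangentSpace_quadrant x)
        (g.riemForm (hbij x hx)) (e := fun j => e j x)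
        (fun i j => (g.riem_eq (hbij x hx) _ _).symm.trans (he i j)) (Y x)
      have h5 := congrArg (fun t : Euc m => (show ℝ from mfderiv (IQ m) 𝓘(ℝ, ℝ) u x t)) h4
      refine Eq.trans ?_ h5
      refine Eq.trans ?_ (map_sum (mfderiv (IQ m) 𝓘(ℝ, ℝ) u x) _ _).symm
      refine Finset.sum_congr rfl fun j _ => ?_
      rw [g.riem_eq (hbij x hx)]
      exact (map_smul (mfderiv (IQ m) 𝓘(ℝ, ℝ) u x) _ (e j x)).symm
    simp only [frameHessian, h0, h2, smul_eq_mul]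
    rw [dirDeriv_mul hf hYu, ← h3]
    simp only [add_mul, Finset.sum_add_distrib, mul_sub, Finset.mul_sum, Finset.sum_mul]
    have h6 : ∀ j, g.riem x (Y x) (e j x) * dirDeriv (e j) u x * dirDeriv X f x =
        dirDeriv X f x * g.riem x (Y x) (e j x) * dirDeriv (e j) u x := fun j => by ring
    simp only [h6, mul_assoc]
    ring
  add {Y Y'} hY hY' := by
    have hYu := E.mdifferentiableAt_dirDeriv (hbij x hx) hY hU hxU hu
    have hYu' := E.mdifferentiableAt_dirDeriv (hbij x hx) hY' hU hxU hu
    have h0 : dirDeriv (Y + Y') u = fun y => dirDeriv Y u y + dirDeriv Y' u y :=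
      funext fun y => dirDeriv_add_left Y Y' u y
    have h2 := fun j => g.koszul_add_snd E hbij hx hY hY' hX ((e j).mdifferentiableAt_mk x)
    simp only [frameHessian, h0, h2, add_mul, Finset.sum_add_distrib]
    rw [dirDeriv_add hYu hYu']
    ring

include hbij hx in
theorem VMetric.exists_orthonormal_at (g : VMetric 𝒱) : ∃ e : Fin m → SmoothVF m M,
    ∀ i j, g.riem x (e i x) (e j x) = if i = j then 1 else 0 := by
  obtain ⟨e, he⟩ := exists_orthonormal (finrank_tangentSpace_quadrant x) (g.riemForm (hbij x hx))
    (fun v w => by rw [← g.riem_eq, ← g.riem_eq, g.riem_symm])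
    (fun v hv => by rw [← g.riem_eq]; exact g.riem_pos (hbij x hx) hv)
  have h1 : ∀ i, ∃ v : 𝒱, (v : SmoothVF m M) x = e i := fun i => by
    obtain ⟨a, ha⟩ := (hbij x hx).2 (e i)
    obtain ⟨v, rfl⟩ := AFiber.mk_surjective x a
    exact ⟨v, ha⟩
  choose v hv using h1
  refine ⟨fun i => v i, fun i j => ?_⟩
  rw [hv, hv, g.riem_eq (hbij x hx), he]

include E hbij hx in
/-- The Laplacian in terms of generators and of the dual metric. -/
theorem VMetric.laplacian_eq {V : Fin n → 𝒱} {K : Fin n → Fin n → SmoothFun m M}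
    (hK : IsDualMetric V K g) {u : M → ℝ} {U : Set M} (hU : IsOpen U) (hxU : x ∈ U)
    (hu : ContMDiffOn (IQ m) 𝓘(ℝ, ℝ) ∞ u U) :
    laplacian g.riem u x = ∑ a, ∑ b, K a b x *
      (dirDeriv (V a : SmoothVF m M) (dirDeriv (V b : SmoothVF m M) u) x -
        ∑ c, ∑ d, K c d x * (koszul g.riem (V a : SmoothVF m M) (V b : SmoothVF m M)
          (V c : SmoothVF m M) x * dirDeriv (V d : SmoothVF m M) u x)) := by
  have hb := hbij x hx
  have hex := g.exists_orthonormal_at hbij hx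
  unfold laplacian
  rw [dif_pos hex]
  set e := hex.choose with he_def
  have he : ∀ i j, g.riem x (e i x) (e j x) = if i = j then 1 else 0 := hex.choose_spec
  set G := g.riemForm hb
  have hG : ∀ v w, g.riem x v w = G v w := g.riem_eq hb
  have hsymm : ∀ v w, G v w = G w v := fun v w => by rw [← hG, ← hG, g.riem_symm]
  have hexp := sum_smul_eq_of_orthonormal (finrank_tangentSpace_quadrant x) G (e := fun j => e j x)
    (fun i j => (hG _ _).symm.trans (he i j))
  have hk : ∀ t, ∑ a, ∑ b, (K a b x * G t ((V a : SmoothVF m M) x)) • (V b : SmoothVF m M) x = t :=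
    fun t => by simpa only [hG] using hK.sum_smul_riem hb t
  have h1 := fun (Y : ∀ y : M, TangentSpace (IQ m) y) (hY : DiffVFAt Y x) =>
    g.tensorialAt_frameHessian_left E hbij hx e u hY
  have h2 := fun (X : ∀ y : M, TangentSpace (IQ m) y) (hX : DiffVFAt X x) =>
    g.tensorialAt_frameHessian_right E hbij hx he hU hxU hu hX
  -- By tensoriality the Hessian descends to a bilinear form on `T_x M`, so its trace may be taken
  -- with the generators instead of the orthonormal fields chosen in `laplacian`.
  set H := TensorialAt.mkHom₂ (frameHessian g.riem e u x) x h1 h2 with hH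
  have hHapp : ∀ X Y : SmoothVF m M, H (X x) (Y x) = frameHessian g.riem e u x X Y := fun X Y =>
    TensorialAt.mkHom₂_apply h1 h2 (X.mdifferentiableAt_mk x) (Y.mdifferentiableAt_mk x)
  have h3 := sum_diag_eq_sum G hsymm hexp hk
    ((ContinuousLinearMap.coeLM ℝ).comp H.toLinearMap)
  have h4 : frameLaplacian g.riem e u x = ∑ i, H (e i x) (e i x) :=
    Finset.sum_congr rfl fun i _ => (hHapp (e i) (e i)).symm
  rw [h4]
  refine Eq.trans h3 (Finset.sum_congr rfl fun a _ => Finset.sum_congr rfl fun b _ => ?_)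
  congr 1
  refine (hHapp (V a) (V b)).trans ?_
  unfold frameHessian
  congr 1
  have h5 := g.tensorialAt_koszul E hbij hx ((V a : SmoothVF m M).mdifferentiableAt_mk x)
    ((V b : SmoothVF m M).mdifferentiableAt_mk x)
  have h6 := fun X : SmoothVF m M => TensorialAt.mkHom_apply h5 (X.mdifferentiableAt_mk x)
  let du : TangentSpace (IQ m) x →ₗ[ℝ] ℝ := (mfderiv (IQ m) 𝓘(ℝ, ℝ) u x).toLinearMap
  -- The same trace identity is used for the form `(t, t') ↦ ⟨∇_{V_a} V_b, t⟩ du(t')`, to remove the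
  -- orthonormal fields from the first order term.
  have h7 := sum_diag_eq_sum G hsymm hexp hk
    ((LinearMap.mul ℝ ℝ).compl₁₂ (TensorialAt.mkHom _ x h5).toLinearMap du)
  refine Eq.trans (Finset.sum_congr rfl fun j _ => ?_) (h7.trans (Finset.sum_congr rfl fun c _ =>
    Finset.sum_congr rfl fun d _ => ?_))
  · rw [← h6 (e j)]; rfl
  · rw [← h6 (V c)]; rfl

end Laplacian

/-! ### The dual metric and the Laplacian modulo first order terms -/

section DualMetric

open Set Filter Topology

variable {m : ℕ} {M : Type*} [TopologicalSpace M] [ChartedSpace (EuclideanQuadrant m) M]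

theorem SmoothFun.isUnit_of_ne_zero {f : SmoothFun m M} (hf : ∀ x, f x ≠ 0) : IsUnit f := by
  refine IsUnit.of_mul_eq_one ⟨fun x => (f x)⁻¹, f.contMDiff.inv₀ hf⟩ ?_
  ext x
  exact mul_inv_cancel₀ (hf x)

theorem SmoothFun.sum_apply {ι : Type*} (s : Finset ι) (F : ι → SmoothFun m M) (x : M) :
    (∑ i ∈ s, F i) x = ∑ i ∈ s, F i x :=
  map_sum (ContMDiffMap.evalRingHom x : SmoothFun m M →+* ℝ) F s

variable [IsManifold (IQ m) ∞ M] {𝒱 : Submodule (SmoothFun m M) (SmoothVF m M)}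

/-- The inner product of two sections as a smooth function. -/
def VMetric.innerFun (g : VMetric 𝒱) (v w : 𝒱) : SmoothFun m M :=
  ⟨fun x => g.inner x (AFiber.mk 𝒱 x v) (AFiber.mk 𝒱 x w), g.smooth v w⟩

variable {n : ℕ} (E : DualFrame 𝒱 n) (g : VMetric 𝒱)

/-- The Gram matrix of the generators, made invertible on the kernel of `ℝ^n → A_x`. -/
def DualFrame.gram : Matrix (Fin n) (Fin n) (SmoothFun m M) :=
  Matrix.of fun a b => g.innerFun (E.vec a) (E.vec b) +
    ∑ c, ((if c = a then 1 else 0) - E.coord c (E.vec a)) *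
      ((if c = b then 1 else 0) - E.coord c (E.vec b))

/-- The value of the Gram matrix at a point. -/
def DualFrame.gramAt (x : M) : Matrix (Fin n) (Fin n) ℝ :=
  (E.gram g).map (ContMDiffMap.evalRingHom x : SmoothFun m M →+* ℝ)

theorem DualFrame.gramAt_apply (x : M) (a b : Fin n) : E.gramAt g x a b =
    g.inner x (AFiber.mk 𝒱 x (E.vec a)) (AFiber.mk 𝒱 x (E.vec b)) +
    ∑ c, ((if c = a then 1 else 0) - E.coord c (E.vec a) x) *
      ((if c = b then 1 else 0) - E.coord c (E.vec b) x) := by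
  have h1 : ∀ c d : Fin n, (if c = d then (1 : SmoothFun m M) else 0) x = if c = d then 1 else 0 :=
    fun c d => by split_ifs <;> rfl
  change g.inner x _ _ + (∑ c, ((if c = a then (1 : SmoothFun m M) else 0) - E.coord c (E.vec a)) *
      ((if c = b then 1 else 0) - E.coord c (E.vec b))) x = _
  rw [SmoothFun.sum_apply]
  congr 1
  refine Finset.sum_congr rfl fun c _ => ?_
  rw [← h1, ← h1]
  rfl

theorem DualFrame.gramAt_mulVec (x : M) (c : Fin n → ℝ) (a : Fin n) :
    (E.gramAt g x).mulVec c a =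
      g.inner x (AFiber.mk 𝒱 x (E.vec a)) (∑ b, c b • AFiber.mk 𝒱 x (E.vec b)) +
      ∑ d, ((if d = a then 1 else 0) - E.coord d (E.vec a) x) *
        (c d - ∑ b, E.coord d (E.vec b) x * c b) := by
  rw [Matrix.mulVec, dotProduct]
  simp only [gramAt_apply, add_mul, Finset.sum_add_distrib, map_sum, map_smul, smul_eq_mul]
  congr 1
  · exact Finset.sum_congr rfl fun b _ => mul_comm _ _
  · simp only [Finset.sum_mul]
    rw [Finset.sum_comm]
    refine Finset.sum_congr rfl fun d _ => ?_
    simp only [mul_assoc]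
    rw [← Finset.mul_sum]
    congr 1
    simp only [sub_mul, Finset.sum_sub_distrib, ite_mul, one_mul, zero_mul, Finset.sum_ite_eq,
      Finset.mem_univ, if_true]

/-- The quadratic form at `c` is `|t|² + |c - coord t|²` with `t = ∑ c_b V_b`. If `t = 0`, the
second term is `|c|²`. -/
theorem DualFrame.gramAt_posDef (x : M) : (E.gramAt g x).PosDef := by
  refine Matrix.PosDef.of_dotProduct_mulVec_pos ?_ fun c hc => ?_
  · ext a b
    rw [Matrix.conjTranspose_apply, gramAt_apply, gramAt_apply, g.symm, star_trivial]
    congr 1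
    exact Finset.sum_congr rfl fun d _ => mul_comm _ _
  · set t := ∑ b, c b • AFiber.mk 𝒱 x (E.vec b) with ht
    have h1 : star c ⬝ᵥ (E.gramAt g x).mulVec c =
        g.inner x t t + ∑ d, (c d - ∑ b, E.coord d (E.vec b) x * c b) ^ 2 := by
      rw [dotProduct]
      simp only [gramAt_mulVec, Pi.star_apply, star_trivial, mul_add, Finset.sum_add_distrib]
      congr 1
      · conv_rhs => rw [ht, LinearMap.map_sum₂]
        exact Finset.sum_congr rfl fun b _ => by rw [LinearMap.map_smul₂, smul_eq_mul]
      · simp only [Finset.mul_sum]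
        rw [Finset.sum_comm]
        refine Finset.sum_congr rfl fun d _ => ?_
        simp only [← mul_assoc]
        rw [← Finset.sum_mul, sq]
        congr 1
        simp only [mul_sub, Finset.sum_sub_distrib, mul_ite, mul_one, mul_zero, Finset.sum_ite_eq,
          Finset.mem_univ, if_true]
        congr 1
        exact Finset.sum_congr rfl fun d _ => mul_comm _ _
    rw [h1]
    by_cases h : t = 0
    · have h2 : ∀ d, ∑ b, E.coord d (E.vec b) x * c b = 0 := fun d => by
        have := congrArg (E.fibreCoord d x) h
        rw [map_zero, ht, map_sum] at this
        simp only [map_smul, fibreCoord_mk, smul_eq_mul] at this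
        rw [← this]
        exact Finset.sum_congr rfl fun b _ => mul_comm _ _
      obtain ⟨d, hd⟩ := Function.ne_iff.1 hc
      rw [h, map_zero, zero_add]
      refine Finset.sum_pos' (fun d _ => sq_nonneg _) ⟨d, Finset.mem_univ d, ?_⟩
      rw [h2, sub_zero]
      exact sq_pos_of_ne_zero hd
    · exact add_pos_of_pos_of_nonneg (g.pos x t h) (Finset.sum_nonneg fun d _ => sq_nonneg _)

/-- `K` is the inverse of the modified Gram matrix. It is smooth since the determinant vanishes
nowhere and so is a unit of `C^∞(M)`, and positive definite as the inverse of a positive definite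
matrix. -/
theorem DualFrame.exists_isDualMetric : ∃ K, IsDualMetric E.vec K g := by
  have hdet : IsUnit (E.gram g).det := by
    refine SmoothFun.isUnit_of_ne_zero fun x => ?_
    have h1 : (E.gram g).det x = (E.gramAt g x).det :=
      RingHom.map_det (ContMDiffMap.evalRingHom x : SmoothFun m M →+* ℝ) (E.gram g)
    rw [h1]
    exact (E.gramAt_posDef g x).det_pos.ne'
  have hinv : ∀ x, (E.gramAt g x)⁻¹ =
      ((E.gram g)⁻¹).map (ContMDiffMap.evalRingHom x : SmoothFun m M →+* ℝ) := fun x => by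
    refine Matrix.inv_eq_right_inv ?_
    rw [gramAt, ← Matrix.map_mul, Matrix.mul_nonsing_inv _ hdet]
    exact Matrix.map_one _ (map_zero _) (map_one _)
  refine ⟨fun i j => (E.gram g)⁻¹ j i, fun x a => ?_, fun x c hc => ?_⟩
  · set c : Fin n → ℝ := fun i => E.fibreCoord i x a with hc
    have h1 : ∑ b, c b • AFiber.mk 𝒱 x (E.vec b) = a := E.sum_fibreCoord_smul x a
    have h2 : ∀ i, g.inner x a (AFiber.mk 𝒱 x (E.vec i)) = (E.gramAt g x).mulVec c i := fun i => by
      rw [gramAt_mulVec, h1, g.symm]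
      -- For coefficients that are the coordinates of an element of the fibre, the correction in the
      -- Gram matrix vanishes.
      refine (add_eq_left.2 (Finset.sum_eq_zero fun d _ => ?_)).symm
      have h3 := congrArg (E.fibreCoord d x) h1
      rw [map_sum] at h3
      simp only [map_smul, fibreCoord_mk, smul_eq_mul] at h3
      have h4 : ∑ b, E.coord d (E.vec b) x * c b = c d := by
        rw [hc]
        dsimp only
        rw [← h3]
        exact Finset.sum_congr rfl fun b _ => mul_comm _ _
      rw [h4, sub_self, mul_zero]
    have h5 : ∀ j, ∑ i, (E.gram g)⁻¹ j i x * g.inner x a (AFiber.mk 𝒱 x (E.vec i)) = c j := fun j => by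
      have h6 : (E.gramAt g x)⁻¹.mulVec ((E.gramAt g x).mulVec c) j = c j := by
        rw [Matrix.mulVec_mulVec,
          Matrix.nonsing_inv_mul _ (isUnit_iff_ne_zero.2 (E.gramAt_posDef g x).det_pos.ne'),
          Matrix.one_mulVec]
      rw [← h6, hinv]
      simp only [h2]
      rfl
    rw [Finset.sum_comm]
    simp only [← Finset.sum_smul, h5]
    exact h1
  · have h1 := (E.gramAt_posDef g x).inv.dotProduct_mulVec_pos hc
    rw [hinv] at h1
    refine h1.trans_eq ?_
    rw [dotProduct, Finset.sum_comm]
    refine Finset.sum_congr rfl fun i _ => ?_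
    rw [Matrix.mulVec, dotProduct, Finset.mul_sum]
    refine Finset.sum_congr rfl fun j _ => ?_
    rw [Pi.star_apply, star_trivial]
    change c i * ((E.gram g)⁻¹ i j x * c j) = _
    ring

variable (hbij : ∀ x ∈ (IQ m).interior M, Function.Bijective (anchor 𝒱 x))

include hbij in
/-- Koszul's formula for sections gives smooth functions. -/
theorem VMetric.exists_smooth_koszul
    (hbr : ∀ V ∈ 𝒱, ∀ W ∈ 𝒱, ∃ U ∈ 𝒱, ∀ x : M, U x = VectorField.mlieBracket (IQ m) V W x)
    (v w z : 𝒱) : ∃ Γ : SmoothFun m M, ∀ x ∈ (IQ m).interior M,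
      koszul g.riem (v : SmoothVF m M) (w : SmoothVF m M) (z : SmoothVF m M) x = Γ x := by
  have hbr' : ∀ v w : 𝒱, ∃ u : 𝒱, ∀ x : M, (u : SmoothVF m M) x =
      VectorField.mlieBracket (IQ m) (v : SmoothVF m M) (w : SmoothVF m M) x := fun v w => by
    obtain ⟨U, hU, h⟩ := hbr v v.2 w w.2
    exact ⟨⟨U, hU⟩, h⟩
  obtain ⟨u₁, h₁⟩ := hbr' v w
  obtain ⟨u₂, h₂⟩ := hbr' v z
  obtain ⟨u₃, h₃⟩ := hbr' w z
  refine ⟨(1 / 2 : ℝ) • ((v : SmoothVF m M).deriv (g.innerFun w z)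
    + (w : SmoothVF m M).deriv (g.innerFun v z) - (z : SmoothVF m M).deriv (g.innerFun v w)
    + g.innerFun u₁ z - g.innerFun u₂ w - g.innerFun u₃ v), fun x hx => ?_⟩
  have h4 : ∀ (a b c : 𝒱), dirDeriv (a : SmoothVF m M)
      (fun y => g.riem y ((b : SmoothVF m M) y) ((c : SmoothVF m M) y)) x =
        (a : SmoothVF m M).deriv (g.innerFun b c) x := fun a b c => by
    refine dirDeriv_congr ?_
    filter_upwards [interior_quadrant_mem_nhds hx] with y hy
    exact g.riem_mk (hbij y hy) b c
  have hb := hbij x hx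
  unfold koszul
  rw [h4, h4, h4, ← h₁, ← h₂, ← h₃, g.riem_mk hb, g.riem_mk hb, g.riem_mk hb]
  rfl

include E hbij in
/-- Up to the derivative along a section, the Laplacian is `∑ K_ab V_a V_b`. -/
theorem VMetric.exists_laplacian_eq
    (hbr : ∀ V ∈ 𝒱, ∀ W ∈ 𝒱, ∃ U ∈ 𝒱, ∀ x : M, U x = VectorField.mlieBracket (IQ m) V W x)
    {V : Fin n → 𝒱} {K : Fin n → Fin n → SmoothFun m M} (hK : IsDualMetric V K g) :
    ∃ X : 𝒱, ∀ x ∈ (IQ m).interior M, ∀ (u : M → ℝ) (U : Set M), IsOpen U → x ∈ U →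
      ContMDiffOn (IQ m) 𝓘(ℝ, ℝ) ∞ u U →
      laplacian g.riem u x = ∑ a, ∑ b, K a b x *
        dirDeriv (V a : SmoothVF m M) (dirDeriv (V b : SmoothVF m M) u) x +
        dirDeriv (X : SmoothVF m M) u x := by
  choose Γ hΓ using fun a b c => g.exists_smooth_koszul hbij hbr (V a) (V b) (V c)
  refine ⟨-∑ d, (∑ a, ∑ b, ∑ c, K a b * (K c d * Γ a b c)) • V d, fun x hx u U hU hxU hu => ?_⟩
  rw [g.laplacian_eq E hbij hx hK hU hxU hu]
  have h1 : dirDeriv ((-∑ d, (∑ a, ∑ b, ∑ c, K a b * (K c d * Γ a b c)) • V d : 𝒱) : SmoothVF m M) u x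
      = -∑ d, (∑ a, ∑ b, ∑ c, K a b x * (K c d x * Γ a b c x)) * dirDeriv (V d : SmoothVF m M) u x := by
    let φ : 𝒱 →ₗ[ℝ] ℝ := (mfderiv (IQ m) 𝓘(ℝ, ℝ) u x).toLinearMap ∘ₗ evalVF 𝒱 x
    have h2 : ∀ (f : SmoothFun m M) (v : 𝒱), φ (f • v) = f x * φ v := fun f v =>
      map_smul (mfderiv (IQ m) 𝓘(ℝ, ℝ) u x) (f x) ((v : SmoothVF m M) x)
    change φ (-∑ d, (∑ a, ∑ b, ∑ c, K a b * (K c d * Γ a b c)) • V d) = _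
    rw [map_neg, map_sum]
    congr 1
    refine Finset.sum_congr rfl fun d _ => ?_
    rw [h2]
    simp only [SmoothFun.sum_apply]
    rfl
  rw [h1]
  simp only [mul_sub, Finset.sum_sub_distrib]
  rw [sub_eq_add_neg]
  congr 2
  simp only [Finset.sum_mul, Finset.mul_sum]
  conv_rhs => rw [Finset.sum_comm]
  refine Finset.sum_congr rfl fun a _ => ?_
  conv_rhs => rw [Finset.sum_comm]
  refine Finset.sum_congr rfl fun b _ => ?_
  conv_rhs => rw [Finset.sum_comm]
  refine Finset.sum_congr rfl fun c _ => Finset.sum_congr rfl fun d _ => ?_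
  rw [hΓ a b c x hx]
  ring

end DualMetric

/-! ### Differential operators and ellipticity -/

section Operators

variable {m : ℕ} {M : Type*} [TopologicalSpace M] [ChartedSpace (EuclideanQuadrant m) M]
  [IsManifold (IQ m) ∞ M] {𝒱 : Submodule (SmoothFun m M) (SmoothVF m M)}

theorem deriv_mem_diffOp (v : 𝒱) : (v : SmoothVF m M).deriv ∈ DiffOp 𝒱 1 :=
  Submodule.mem_sup_right (Submodule.subset_span ⟨v, v.2, _, (v : SmoothVF m M).isDerivAlong_deriv,
    1, ⟨1, map_one (Algebra.lmul ℝ (SmoothFun m M))⟩, (mul_one _).symm⟩)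

theorem deriv_mul_deriv_mem_diffOp (v w : 𝒱) :
    (v : SmoothVF m M).deriv * (w : SmoothVF m M).deriv ∈ DiffOp 𝒱 2 :=
  Submodule.mem_sup_right (Submodule.subset_span ⟨v, v.2, _, (v : SmoothVF m M).isDerivAlong_deriv,
    _, deriv_mem_diffOp w, rfl⟩)

/-- The operator `∑ K_ij V_i V_j + X`. -/
def secondOrderOp {n : ℕ} (V : Fin n → 𝒱) (K : Fin n → Fin n → SmoothFun m M) (X : 𝒱) :
    Module.End ℝ (SmoothFun m M) :=
  ∑ i, ∑ j, ((K i j • V i : 𝒱) : SmoothVF m M).deriv * (V j : SmoothVF m M).deriv +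
    (X : SmoothVF m M).deriv

theorem secondOrderOp_apply {n : ℕ} (V : Fin n → 𝒱) (K : Fin n → Fin n → SmoothFun m M) (X : 𝒱)
    (f : SmoothFun m M) (x : M) : secondOrderOp V K X f x = ∑ i, ∑ j, K i j x *
      dirDeriv (V i : SmoothVF m M) (dirDeriv (V j : SmoothVF m M) f) x +
      dirDeriv (X : SmoothVF m M) f x := by
  unfold secondOrderOp
  rw [LinearMap.add_apply]
  change (_ : SmoothFun m M) x + _ = _
  congr 1
  simp only [LinearMap.sum_apply, SmoothFun.sum_apply]
  refine Finset.sum_congr rfl fun i _ => Finset.sum_congr rfl fun j _ => ?_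
  exact dirDeriv_smul_left (K i j) (V i : SmoothVF m M) _ x

theorem isEllipticOp_secondOrderOp {n : ℕ} (E : DualFrame 𝒱 n) {K : Fin n → Fin n → SmoothFun m M}
    {g : VMetric 𝒱} (hK : IsDualMetric E.vec K g) (X : 𝒱) :
    IsEllipticOp 𝒱 1 (secondOrderOp E.vec K X) := by
  refine ⟨add_mem (Submodule.sum_mem _ fun i _ => Submodule.sum_mem _ fun j _ =>
    deriv_mul_deriv_mem_diffOp _ _) (Submodule.mem_sup_left (deriv_mem_diffOp X)),
    fun x ξ => ∑ i, ∑ j, K i j x * (ξ (AFiber.mk 𝒱 x (E.vec i)) * ξ (AFiber.mk 𝒱 x (E.vec j))),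
    ?_, fun x ξ hξ => ?_⟩
  -- The coefficient is absorbed into the first factor, since `HasSymbol` asks for pure products of
  -- elements of `𝒱`, indexed by one finite ordinal.
  · let V : Fin (n * n) → Fin 2 → 𝒱 := fun c => ![K (finProdFinEquiv.symm c).1
      (finProdFinEquiv.symm c).2 • E.vec (finProdFinEquiv.symm c).1, E.vec (finProdFinEquiv.symm c).2]
    refine ⟨n * n, V, fun c i => (V c i : SmoothVF m M).deriv,
      fun c i => (V c i : SmoothVF m M).isDerivAlong_deriv, ?_, fun x ξ => ?_⟩
    · have h1 : ∑ c, (List.ofFn fun i => (V c i : SmoothVF m M).deriv).prod = ∑ i, ∑ j,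
          ((K i j • E.vec i : 𝒱) : SmoothVF m M).deriv * (E.vec j : SmoothVF m M).deriv := by
        rw [← finProdFinEquiv.sum_comp, Fintype.sum_prod_type]
        refine Finset.sum_congr rfl fun i _ => Finset.sum_congr rfl fun j _ => ?_
        have hV : V (finProdFinEquiv (i, j)) = ![K i j • E.vec i, E.vec j] := by
          simp only [V, Equiv.symm_apply_apply]
        have h2 : ∀ T : Fin 2 → Module.End ℝ (SmoothFun m M), (List.ofFn T).prod = T 0 * T 1 :=
          fun T => by simp [List.ofFn_succ]
        rw [h2, hV]
        rfl
      rw [h1, secondOrderOp, add_sub_cancel_left]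
      exact deriv_mem_diffOp X
    · rw [← finProdFinEquiv.sum_comp, Fintype.sum_prod_type]
      refine Finset.sum_congr rfl fun i _ => Finset.sum_congr rfl fun j _ => ?_
      rw [Fin.prod_univ_two]
      simp only [V, Equiv.symm_apply_apply, Matrix.cons_val_zero, Matrix.cons_val_one,
        AFiber.mk_smul, map_smul, smul_eq_mul, mul_assoc]
  -- The generators span the fibre, so a nonzero covector has a nonzero value on one of them.
  · refine (hK.pos x (fun i => ξ (AFiber.mk 𝒱 x (E.vec i))) fun h => hξ ?_).ne'
    refine LinearMap.ext fun a => ?_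
    rw [← E.sum_fibreCoord_smul x a, map_sum]
    refine Finset.sum_eq_zero fun i _ => ?_
    rw [map_smul, show ξ (AFiber.mk 𝒱 x (E.vec i)) = 0 from congrFun h i, smul_zero]

end Operators

/-! ### Laplacians of conformal lifts -/

namespace IsConformalLift

open Set Filter Topology

variable {m : ℕ} {M P : Type*} [TopologicalSpace M] [ChartedSpace (EuclideanQuadrant m) M]
  [IsManifold (IQ m) ∞ M] [TopologicalSpace P] [ChartedSpace (EuclideanQuadrant m) P]
  [IsManifold (IQ m) ∞ P] {𝒱 : Submodule (SmoothFun m M) (SmoothVF m M)} {β : P → M} {S : Set M}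
  {ρ : P → ℝ}

/-- The fibre map is an isometry taking lifted generators to generators. This is why `ρ² Δ_g` and
`Δ_h` share their second order coefficients. -/
theorem isDualMetric (H : IsConformalLift 𝒱 β S ρ) {n : ℕ} (E : DualFrame 𝒱 n)
    (hinj : ∀ x ∈ (IQ m).interior M, Function.Injective (anchor 𝒱 x)) {g : VMetric 𝒱}
    {K : Fin n → Fin n → SmoothFun m M} (hK : IsDualMetric E.vec K g) :
    IsDualMetric (H.dualFrame E hinj).vec (fun i j => H.pull (K i j)) (H.metric E hinj g) where
  sum_smul p a := by
    apply H.fibreMap_injective E hinj p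
    conv_rhs => rw [← hK.sum_smul (β p) (H.fibreMap E hinj p a)]
    simp only [map_sum, map_smul, metric_inner, dualFrame_vec, fibreMap_mk_up, pull_apply]
  pos p c hc := hK.pos (β p) c hc

/-- A function whose pull-back is smooth near `p` is smooth near `β p`. -/
theorem exists_contMDiffOn (H : IsConformalLift 𝒱 β S ρ) {P₀ : Set P} (hP₀ : IsOpen P₀)
    (f : SmoothFun m P) {u : M → ℝ} (hu : ∀ p ∈ P₀, u (β p) = f p) {p : P} (hp : p ∈ P₀)
    (hpS : β p ∉ S) :
    ∃ U : Set M, IsOpen U ∧ β p ∈ U ∧ ContMDiffOn (IQ m) 𝓘(ℝ, ℝ) ∞ u U := by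
  obtain ⟨Φ, hpΦ, hΦ⟩ := H.localDiffeo p hpS
  have hΦp : Φ p = β p := (hΦ hpΦ).symm
  refine ⟨Φ.target ∩ Φ.symm ⁻¹' P₀, ?_, ⟨?_, ?_⟩, ?_⟩
  · exact Φ.contMDiffOn_invFun.continuousOn.isOpen_inter_preimage Φ.open_target hP₀
  · rw [← hΦp]
    exact Φ.map_source hpΦ
  · rw [← hΦp]
    change Φ.symm (Φ p) ∈ P₀
    have : Φ.symm (Φ p) = p := Φ.left_inv hpΦ
    rwa [this]
  · have h1 : ContMDiffOn (IQ m) 𝓘(ℝ, ℝ) ∞ (fun x => f (Φ.symm x)) (Φ.target ∩ Φ.symm ⁻¹' P₀) :=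
      f.contMDiff.comp_contMDiffOn (Φ.contMDiffOn_invFun.mono inter_subset_left)
    refine h1.congr fun x hx => ?_
    have h2 : Φ (Φ.symm x) = x := Φ.right_inv hx.1
    have h3 : β (Φ.symm x) = x := (hΦ (Φ.map_target hx.1)).trans h2
    rw [← hu _ hx.2, h3]

/-- Second derivatives along lifts. -/
theorem dirDeriv_dirDeriv_upVF (H : IsConformalLift 𝒱 β S ρ) {P₀ : Set P} (hP₀ : IsOpen P₀)
    (f : SmoothFun m P) {u : M → ℝ} (hu : ∀ p ∈ P₀, u (β p) = f p) {p : P} (hp : p ∈ P₀)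
    {U : Set M} (hU : IsOpen U) (hpU : β p ∈ U) (huU : ContMDiffOn (IQ m) 𝓘(ℝ, ℝ) ∞ u U)
    (v w : 𝒱) :
    dirDeriv (H.upVF w) f p = ρ p * dirDeriv (w : SmoothVF m M) u (β p) ∧
    dirDeriv (H.upVF v) (dirDeriv (H.upVF w) f) p =
      ρ p ^ 2 * dirDeriv (v : SmoothVF m M) (dirDeriv (w : SmoothVF m M) u) (β p) +
        H.logDeriv v p * dirDeriv (H.upVF w) f p := by
  have hβ : ∀ q, MDifferentiableAt (IQ m) (IQ m) β q := fun q =>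
    H.smooth.mdifferentiableAt (by simp)
  -- The first derivative is needed on a neighbourhood because it is differentiated again. The
  -- derivative of its factor `ρ` contributes the logarithmic derivative term.
  have h1 : ∀ᶠ q in 𝓝 p, dirDeriv (H.upVF w) f q = ρ q * dirDeriv (w : SmoothVF m M) u (β q) := by
    filter_upwards [hP₀.mem_nhds hp, (hU.preimage H.smooth.continuous).mem_nhds hpU] with q hq hqU
    rw [← dirDeriv_comp (hβ q) ((huU.contMDiffAt (hU.mem_nhds hqU)).mdifferentiableAt (by simp))
      (H.mfderiv_upVF w q)]
    refine dirDeriv_congr ?_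
    filter_upwards [hP₀.mem_nhds hq] with z hz using (hu z hz).symm
  refine ⟨h1.self_of_nhds, ?_⟩
  have h2 : MDifferentiableAt (IQ m) 𝓘(ℝ, ℝ) (dirDeriv (w : SmoothVF m M) u) (β p) :=
    (((w : SmoothVF m M).contMDiffOn_dirDeriv hU huU).contMDiffAt (hU.mem_nhds hpU)).mdifferentiableAt
      (by simp)
  have h3 : MDifferentiableAt (IQ m) 𝓘(ℝ, ℝ) (fun q => dirDeriv (w : SmoothVF m M) u (β q)) p :=
    h2.comp p (hβ p)
  rw [dirDeriv_congr h1, dirDeriv_mul (H.smooth_factor.mdifferentiableAt (by simp)) h3,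
    dirDeriv_comp (hβ p) h2 (H.mfderiv_upVF v p), H.dirDeriv_upVF_factor, h1.self_of_nhds]
  ring

theorem laplacian_comparison (H : IsConformalLift 𝒱 β S ρ) (h𝒱 : IsLieManifold 𝒱)
    (g : VMetric 𝒱) {P₀ : Set P} (hP₀ : P₀ = {p | β p ∈ (IQ m).interior M \ S}) :
    ∃ h : VMetric (blownUpModule 𝒱 β S ρ),
      (∀ p ∈ P₀, ∀ v w : TangentSpace (IQ m) p,
        h.riem p v w = (ρ p ^ 2)⁻¹ * g.riem (β p)
          (mfderiv (IQ m) (IQ m) β p v) (mfderiv (IQ m) (IQ m) β p w)) ∧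
      (∃ D ∈ DiffOp (blownUpModule 𝒱 β S ρ) 1, ∀ (f : SmoothFun m P) (u : M → ℝ),
        (∀ p ∈ P₀, u (β p) = f p) → ∀ p ∈ P₀,
          D f p = ρ p ^ 2 * laplacian g.riem u (β p) - laplacian h.riem f p) ∧
      (∃ L : Module.End ℝ (SmoothFun m P), IsEllipticOp (blownUpModule 𝒱 β S ρ) 1 L ∧
        ∀ (f : SmoothFun m P) (u : M → ℝ),
          (∀ p ∈ P₀, u (β p) = f p) → ∀ p ∈ P₀,
            L f p = ρ p ^ 2 * laplacian g.riem u (β p)) := by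
  obtain ⟨n, ⟨E⟩⟩ := exists_dualFrame h𝒱.finite h𝒱.projective
  have hinj := fun x hx => (h𝒱.anchor_iso x hx).1
  have hW := H.isLieManifold h𝒱
  obtain ⟨K, hK⟩ := E.exists_isDualMetric g
  have hK' := H.isDualMetric E hinj hK
  set F := H.dualFrame E hinj with hF
  set h := H.metric E hinj g with hh
  set K' : Fin n → Fin n → SmoothFun m P := fun i j => H.pull (K i j) with hK'def
  obtain ⟨X, hX⟩ := g.exists_laplacian_eq E h𝒱.anchor_iso h𝒱.bracket hK
  obtain ⟨X', hX'⟩ := h.exists_laplacian_eq F hW.anchor_iso hW.bracket hK'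
  -- Solving `W_i W_j = ρ² V_i V_j + a_i W_j` for the second term gives `ρ² Δ_g = ∑ K_ij W_i W_j +
  -- Y`. The term `ρ² X` is `ρ` times the lift of `ρ X`.
  set Y : blownUpModule 𝒱 β S ρ :=
    H.factor • H.up X - ∑ i, ∑ j, (K' i j * H.logDeriv (E.vec i)) • F.vec j with hY
  have hopen : IsOpen P₀ := by
    rw [hP₀]
    exact ((ModelWithCorners.isOpen_interior (n := ∞) (by simp)).sdiff H.isClosed).preimage
      H.smooth.continuous
  have hint : ∀ p ∈ P₀, β p ∈ (IQ m).interior M ∧ β p ∉ S ∧ p ∈ (IQ m).interior P := fun p hp => by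
    rw [hP₀] at hp
    exact ⟨hp.1, hp.2, (H.isInteriorPoint_iff hp.2).2 hp.1⟩
  have hYapp : ∀ (f : SmoothFun m P) (p : P), dirDeriv (Y : SmoothVF m P) f p =
      ρ p * dirDeriv (H.upVF X) f p - ∑ i, ∑ j, K' i j p * (H.logDeriv (E.vec i) p *
        dirDeriv (F.vec j : SmoothVF m P) f p) := fun f p => by
    let φ : blownUpModule 𝒱 β S ρ →ₗ[ℝ] ℝ :=
      (mfderiv (IQ m) 𝓘(ℝ, ℝ) f p).toLinearMap ∘ₗ evalVF (blownUpModule 𝒱 β S ρ) p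
    have h2 : ∀ (a : SmoothFun m P) (v : blownUpModule 𝒱 β S ρ), φ (a • v) = a p * φ v :=
      fun a v => map_smul (mfderiv (IQ m) 𝓘(ℝ, ℝ) f p) (a p) ((v : SmoothVF m P) p)
    change φ Y = _
    rw [hY, map_sub, h2]
    congr 1
    simp only [map_sum, h2]
    refine Finset.sum_congr rfl fun i _ => Finset.sum_congr rfl fun j _ => ?_
    exact mul_assoc _ _ _
  have hL : ∀ (f : SmoothFun m P) (u : M → ℝ), (∀ p ∈ P₀, u (β p) = f p) → ∀ p ∈ P₀,
      secondOrderOp F.vec K' Y f p = ρ p ^ 2 * laplacian g.riem u (β p) := by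
    intro f u hu p hp
    obtain ⟨h1, h2, h3⟩ := hint p hp
    obtain ⟨U, hU, hpU, huU⟩ := H.exists_contMDiffOn hopen f hu hp h2
    have h4 := fun i j => H.dirDeriv_dirDeriv_upVF hopen f hu hp hU hpU huU (E.vec i) (E.vec j)
    have h5 := (H.dirDeriv_dirDeriv_upVF hopen f hu hp hU hpU huU X X).1
    rw [hX _ h1 u U hU hpU huU, secondOrderOp_apply, hYapp, h5]
    have h6 : ∀ i j, dirDeriv (F.vec i : SmoothVF m P) (dirDeriv (F.vec j : SmoothVF m P) f) p = _ :=
      fun i j => (h4 i j).2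
    have h7 : ∀ j, dirDeriv (H.upVF (E.vec j)) f p = dirDeriv (F.vec j : SmoothVF m P) f p :=
      fun j => rfl
    simp only [h6, h7, mul_add, Finset.sum_add_distrib, Finset.mul_sum]
    have h8 : ∀ i j, K' i j p = K i j (β p) := fun i j => rfl
    simp only [h8]
    have h9 : ∀ i j, K i j (β p) * (ρ p ^ 2 * dirDeriv (E.vec i : SmoothVF m M)
        (dirDeriv (E.vec j : SmoothVF m M) u) (β p)) = ρ p ^ 2 * (K i j (β p) *
        dirDeriv (E.vec i : SmoothVF m M) (dirDeriv (E.vec j : SmoothVF m M) u) (β p)) :=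
      fun i j => mul_left_comm _ _ _
    simp only [h9]
    ring
  refine ⟨h, fun p hp v w => H.metric_riem E h𝒱.anchor_iso g (hint p hp).2.2 v w,
    -- Both operators have the second order part `∑ K_ij W_i W_j`, so the difference is the
    -- derivative along a section of `B`.
    ⟨((Y - X' : blownUpModule 𝒱 β S ρ) : SmoothVF m P).deriv, deriv_mem_diffOp _,
      fun f u hu p hp => ?_⟩,
    ⟨secondOrderOp F.vec K' Y, isEllipticOp_secondOrderOp F hK' Y, hL⟩⟩
  rw [← hL f u hu p hp, hX' p (hint p hp).2.2 f univ isOpen_univ (mem_univ _) f.contMDiff.contMDiffOn,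
    secondOrderOp_apply, add_sub_add_left_eq_sub]
  exact map_sub (mfderiv (IQ m) 𝓘(ℝ, ℝ) f p) ((Y : SmoothVF m P) p) ((X' : SmoothVF m P) p)

end IsConformalLift

/-! ### The theorem for iterated blow-ups. -/

theorem mainTheorem9 (m k : ℕ)
    (N : ℕ → Type*) [∀ l, TopologicalSpace (N l)] [∀ l, T2Space (N l)]
    [∀ l, ChartedSpace (EuclideanQuadrant m) (N l)] [∀ l, IsManifold (IQ m) ∞ (N l)]
    (𝒱 : Submodule (SmoothFun m (N 0)) (SmoothVF m (N 0))) (h𝒱 : IsLieManifold 𝒱)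
    (X : ℕ → Set (N 0)) (hX : IsWeaklyTransversal m k X) (hX' : IsAdmissiblyOrdered k X)
    (β : ∀ l, N (l + 1) → N l)
    (hβ : ∀ l < k, IsBlowup m (liftFamily β X l l) (β l))
    (r : ∀ l, N l → ℝ)
    (hr : ∀ l < k, IsSmoothedDistance m (liftFamily β X l l) (r l))
    (g : VMetric 𝒱) :
    ∀ (S : Set (N 0)) (P₀ : Set (N k)) (ρ : N k → ℝ)
      (𝒲 : Submodule (SmoothFun m (N k)) (SmoothVF m (N k))),
      S = ⋃ i ∈ Set.Iio k, X i →
      P₀ = {p | blowdown β k p ∈ (IQ m).interior (N 0) \ S} →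
      ρ = rhoFun β r k →
      𝒲 = blownUpModule 𝒱 (blowdown β k) S ρ →
      IsLieManifold 𝒲 ∧
      ∃ h : VMetric 𝒲,
        (∀ p ∈ P₀, ∀ v w : TangentSpace (IQ m) p,
          h.riem p v w = (ρ p ^ 2)⁻¹ * g.riem (blowdown β k p)
            (mfderiv (IQ m) (IQ m) (blowdown β k) p v)
            (mfderiv (IQ m) (IQ m) (blowdown β k) p w)) ∧
        (∃ D ∈ DiffOp 𝒲 1, ∀ (f : SmoothFun m (N k)) (u : N 0 → ℝ),
          (∀ p ∈ P₀, u (blowdown β k p) = f p) → ∀ p ∈ P₀,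
            D f p = ρ p ^ 2 * laplacian g.riem u (blowdown β k p) - laplacian h.riem f p) ∧
        (∃ L : Module.End ℝ (SmoothFun m (N k)), IsEllipticOp 𝒲 1 L ∧
          ∀ (f : SmoothFun m (N k)) (u : N 0 → ℝ),
            (∀ p ∈ P₀, u (blowdown β k p) = f p) → ∀ p ∈ P₀,
              L f p = ρ p ^ 2 * laplacian g.riem u (blowdown β k p)) := by
  rintro S P₀ ρ 𝒲 rfl hP₀ rfl rfl
  have H := isConformalLift_blowdown 𝒱 h𝒱.compact h𝒱.tangent (fun i hi => (hX.submanifold i hi).1)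
    hβ hr k le_rfl
  exact ⟨H.isLieManifold h𝒱, H.laplacian_comparison h𝒱 g hP₀⟩
end
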